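/- **Conventions.** All manifolds and maps are smooth. $\Sigma_h$ (resp. $N_g$) is the closed connected orientable (resp. non-orientable) surface of genus $h$ (resp. $g$). In groups of isotopy classes of diffeomorphisms of a surface the product is $[\omega][\omega']=[\omega'\circ\omega]$. An *orientation double covering* $\Theta:M\to N$ is a local diffeomorphism from an oriented manifold onto a connected one with two-point fibres such that $(d\Theta_{p_2})^{-1}\circ d\Theta_{p_1}$ reverses orientation for the two points $p_1,p_2$ of each fibre. The *standard* one of $X$ is $\pi:\widetilde X=\{(p,o_p): p\in X,\ o_p \text{ an orientation of } T_pX\}\to X$, $\pi(p,o_p)=p$, with the tautological orientation of $\widetilde X$. Fix an orientation double covering $\widetilde J:\Sigma_{g-1}\to N_g$. A *Lefschetz fibration* is a smooth map $f:X\to\Sigma$ from a compact connected 4-manifold to a compact connected orientable 2-manifold with $\partial X=f^{-1}(\partial\Sigma)$, $\mathrm{Crit}(f)\subset\mathrm{Int}(X)$, and $f(z,w)=zw$ in suitable complex coordinates about each critical point and its image. It is non-orientable if $X$ is, and has genus $g$ if its regular fibres are diffeomorphic to $N_g$ (for orientable $X$: to $\Sigma_g$). If $X$ is oriented, $f$ is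 *achiral* if for some critical point such coordinates on $X$ reverse orientation. Let $\Sigma$ be $\mathbb D^2$ or $\mathbb S^2$, oriented, and $\Delta_f$ the set of critical values of $f$. Fix an interior point $y\in\Sigma\setminus\Delta_f$ and a diffeomorphism $\Xi$ from $f^{-1}(y)$ to the model surface $F$ (orientation preserving if $X$ and $F$ are oriented). Let $\rho_f$ be the monodromy representation: $\rho_f([a])=[\Xi\circ\Phi_1]$ for a trivialization $\Phi$ of $f$ along $a$ with $\Phi_0=\Xi^{-1}$. Choose a Hurwitz system $(\mu_1,\dots,\mu_k)$, i.e. smoothly embedded arcs from $y$ to the points of $\Delta_f$, one for each, disjoint apart from $y$ and leaving $y$ in counterclockwise order, with (counterclockwise) meridian loops $\alpha_i$. A word $t_{C_1}^{\zeta_1}\cdots t_{C_m}^{\zeta_m}$ ($\zeta_j=\pm1$) in Dehn twists of $F$ is a *monodromy factorization* of $f$ if, for some such choices, it can be cut into consecutive blocks, one for each $\mu_i$, such that the curves of the $i$-th block are, up to isotopy, the vanishing cycles determined by $\mu_i$ of the critical points over $\mu_i(1)$, one for each critical point, and $\rho_f(\alpha_i)$ is the product of the twists of that block; hence $\rho_f(\alpha_1\cdots\alpha_k)$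 is the product of all of them, which is $1$ if $\Sigma=\mathbb S^2$. On $\Sigma_h$, $t_C$ is the right handed twist for the orientation of $\Sigma_h$; on $N_g$, $t_{c;\theta_c}$ is the twist about the two-sided curve $c$ that is right handed for the orientation $\theta_c$ of a tubular neighbourhood of $c$, and the factorization is *positive* if it is a product of such right handed twists. **Corollary 4.3.** Let $g\ge 3$, let $f:X\to\Sigma$ be a non-orientable Lefschetz fibration of genus $g$ over $\Sigma=\mathbb D^2$ or $\mathbb S^2$, and let $t_{c_1;\theta_{c_1}}\cdots t_{c_n;\theta_{c_n}}$ be a positive monodromy factorization of $f$. For each $i$ let $\gamma_i\subset\widetilde J^{-1}(c_i)$ be the part along which $\widetilde J$ carries the orientation of $\Sigma_{g-1}$ to $\theta_{c_i}$, and $\overline{\gamma_i}=\widetilde J^{-1}(c_i)\setminus\gamma_i$. Then $f\circ\pi:\widetilde X\to\Sigma$ is a Lefschetz fibration of genus $g-1$ with oriented total space, achiral if $n\ge1$, and $$t_{\gamma_1}t_{\overline{\gamma_1}}^{-1}\cdots t_{\gamma_n}t_{\overline{\gamma_n}}^{-1}$$ is a monodromy factorization of $f\circ\pi$. -/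

import Mathlib

open scoped Manifold ContDiff Topology
open Set

noncomputable section

/-! ### Orientations -/

section Orientation

variable {E : Type*} [NormedAddCommGroup E] [NormedSpace ℝ E]

/-- The sign of the determinant of an endomorphism (meant for invertible ones). -/
def jacSign (L : E →L[ℝ] E) : ℤˣ := if 0 < L.det then 1 else -1

theorem jacSign_comp {A B : E →L[ℝ] E} (hA : A.det ≠ 0) (hB : B.det ≠ 0) :
    jacSign (A.comp B) = jacSign A * jacSign B := by
  have h : (A.comp B).det = A.det * B.det := by
    simp [ContinuousLinearMap.det]
  unfold jacSign
  rw [h]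
  rcases lt_or_gt_of_ne hA with a | a <;> rcases lt_or_gt_of_ne hB with b | b
  · simp [mul_pos_of_neg_of_neg a b, a.not_gt, b.not_gt]
  · simp [(mul_neg_of_neg_of_pos a b).not_gt, a.not_gt, b]
  · simp [(mul_neg_of_pos_of_neg a b).not_gt, a, b.not_gt]
  · simp [mul_pos a b, a, b]

variable {H : Type*} [TopologicalSpace H] (I : ModelWithCorners ℝ E H)
  {M : Type*} [TopologicalSpace M] [ChartedSpace H M]

/-- A choice of orientation of each tangent space that is locally constant in charts.
`TangentSpace I x` is by construction the model space `E`, read in the preferred chart at `x`;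
thus an orientation of it is a sign, relative to one fixed (standard) orientation of `E`, and
`tangentCoordChange I x x₀ x` is the passage from the preferred chart at `x` to that at `x₀`. -/
def IsOrientation [IsManifold I 1 M] (σ : M → ℤˣ) : Prop :=
  ∀ x₀, ∀ᶠ x in 𝓝 x₀, jacSign (tangentCoordChange I x x₀ x) * σ x = σ x₀

variable (M) in
/-- Orientability of a manifold. -/
def IsOrientableManifold [IsManifold I 1 M] : Prop := ∃ σ : M → ℤˣ, IsOrientation I σ

/-- The differential of a map at a point, read in the preferred charts at the point and its image. -/
def diffAt {E' : Type*} [NormedAddCommGroup E'] [NormedSpace ℝ E']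
    {H' : Type*} [TopologicalSpace H'] (I' : ModelWithCorners ℝ E' H')
    {M' : Type*} [TopologicalSpace M'] [ChartedSpace H' M'] (f : M → M') (x : M) : E →L[ℝ] E' :=
  mfderiv I I' f x

/-- An orientation double covering `Θ : M → N`, with respect to the orientation `σ` of `M`: a local
diffeomorphism onto a connected manifold with two-point fibres, such that for the two points
`p₁ ≠ p₂` of a fibre the isomorphism `(dΘ_{p₂})⁻¹ ∘ dΘ_{p₁}` reverses orientation. -/
structure IsOrientationDoubleCovering {N : Type*} [TopologicalSpace N] [ChartedSpace H N]
    [IsManifold I 1 M] (σ : M → ℤˣ) (Θ : M → N) : Prop where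
  connectedSpace : ConnectedSpace N
  isOrientation : IsOrientation I σ
  isLocalDiffeomorph : IsLocalDiffeomorph I I ∞ Θ
  two_points : ∀ q, (Θ ⁻¹' {q}).encard = 2
  reversing : ∀ p₁ p₂, p₁ ≠ p₂ → Θ p₁ = Θ p₂ →
    jacSign (diffAt I I Θ p₁) * σ p₁ =
      -(jacSign (diffAt I I Θ p₂) * σ p₂)

end Orientation

/-! ### The standard orientation double covering -/

/-- The set of pairs `(p, o_p)` of a point `p` of `M` and an orientation `o_p` of `T_p M`. -/
@[ext]
structure OrientationCover {E : Type*} [NormedAddCommGroup E] [NormedSpace ℝ E]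
    {H : Type*} [TopologicalSpace H] (I : ModelWithCorners ℝ E H)
    (M : Type*) [TopologicalSpace M] [ChartedSpace H M] where
  /-- the point -/
  pt : M
  /-- the orientation of the tangent space at the point -/
  sgn : ℤˣ

namespace OrientationCover

variable {E : Type*} [NormedAddCommGroup E] [NormedSpace ℝ E]
  {H : Type*} [TopologicalSpace H] (I : ModelWithCorners ℝ E H)
  {M : Type*} [TopologicalSpace M] [ChartedSpace H M]

section Jac

variable [IsManifold I 1 M]

theorem det_ne_zero {x y z : M} (hx : z ∈ (chartAt H x).source) (hy : z ∈ (chartAt H y).source) :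
    (tangentCoordChange I x y z).det ≠ 0 := by
  have h : (tangentCoordChange I y x z).comp (tangentCoordChange I x y z)
      = ContinuousLinearMap.id ℝ E := by
    ext v
    have hx' : z ∈ (extChartAt I x).source := by rwa [extChartAt_source]
    have hy' : z ∈ (extChartAt I y).source := by rwa [extChartAt_source]
    rw [ContinuousLinearMap.comp_apply, tangentCoordChange_comp ⟨⟨hx', hy'⟩, hx'⟩,
      tangentCoordChange_self hx', ContinuousLinearMap.id_apply]
  intro h0
  have h1 := congrArg ContinuousLinearMap.det h
  have h2 : ((tangentCoordChange I y x z).comp (tangentCoordChange I x y z)).det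
      = (tangentCoordChange I y x z).det * (tangentCoordChange I x y z).det := by
    simp only [ContinuousLinearMap.det, ContinuousLinearMap.toLinearMap_comp,
      LinearMap.det_comp]
  rw [h2, h0] at h1
  simp [ContinuousLinearMap.det] at h1

theorem jacSign_cocycle {w x y z : M} (hw : z ∈ (chartAt H w).source)
    (hx : z ∈ (chartAt H x).source) (hy : z ∈ (chartAt H y).source) :
    jacSign (tangentCoordChange I w y z)
      = jacSign (tangentCoordChange I x y z) * jacSign (tangentCoordChange I w x z) := by
  rw [← jacSign_comp (det_ne_zero I hx hy) (det_ne_zero I hw hx)]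
  congr 1
  ext v
  rw [ContinuousLinearMap.comp_apply, tangentCoordChange_comp]
  simp only [extChartAt_source]
  exact ⟨⟨hw, hx⟩, hy⟩

theorem jacSign_self {x z : M} (hx : z ∈ (chartAt H x).source) :
    jacSign (tangentCoordChange I x x z) = 1 := by
  have := jacSign_cocycle I hx hx hx
  simpa using this

/-- The chart `φ^s = φ ∘ π`, for `φ` the preferred chart at `p` and a sign `s`, on the set of the
`(q, o_q)` such that `q` is in the domain of `φ` and `φ` maps `o_q` to the orientation `s` of `E`. -/
def chart (p : M) (s : ℤˣ) : PartialEquiv (OrientationCover I M) H where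
  toFun x := chartAt H p x.pt
  invFun h := ⟨(chartAt H p).symm h, jacSign (tangentCoordChange I ((chartAt H p).symm h) p
    ((chartAt H p).symm h)) * s⟩
  source := {x | x.pt ∈ (chartAt H p).source ∧
    jacSign (tangentCoordChange I x.pt p x.pt) * x.sgn = s}
  target := (chartAt H p).target
  map_source' x hx := (chartAt H p).map_source hx.1
  map_target' h hh := by
    refine ⟨(chartAt H p).map_target hh, ?_⟩
    rw [← mul_assoc, Int.units_mul_self, one_mul]
  left_inv' x hx := by
    have h1 : (chartAt H p).symm (chartAt H p x.pt) = x.pt := (chartAt H p).left_inv hx.1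
    ext
    · exact h1
    · simp only [h1]
      rw [← hx.2, ← mul_assoc, Int.units_mul_self, one_mul]
  right_inv' h hh := (chartAt H p).right_inv hh

theorem chart_trans_source (p p' : M) (s s' : ℤˣ) :
    ((chart I p s).symm.trans (chart I p' s')).source =
      (chartAt H p).target ∩ (chartAt H p).symm ⁻¹' {q | q ∈ (chartAt H p').source ∧
        jacSign (tangentCoordChange I p p' q) = s * s'} := by
  ext h
  rw [PartialEquiv.trans_source, PartialEquiv.symm_source]
  simp only [chart, PartialEquiv.coe_symm_mk, mem_inter_iff, mem_preimage, mem_ofPred_eq]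
  refine and_congr_right fun hh => and_congr_right fun hq => ?_
  have hp := (chartAt H p).map_target hh
  rw [← mul_assoc, jacSign_cocycle I (mem_chart_source H _) hp hq, mul_assoc _ _ (jacSign _),
    Int.units_mul_self, mul_one]
  constructor
  · rintro rfl
    rw [mul_comm s, mul_assoc, Int.units_mul_self, mul_one]
  · intro h1
    rw [h1, mul_comm s, mul_assoc, Int.units_mul_self, mul_one]

theorem isOpen_jacSign [FiniteDimensional ℝ E] (p p' : M) (e : ℤˣ) :
    IsOpen ((chartAt H p).source ∩ {q | q ∈ (chartAt H p').source ∧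
      jacSign (tangentCoordChange I p p' q) = e}) := by
  have hc : ContinuousOn (fun q => (tangentCoordChange I p p' q).det)
      ((chartAt H p).source ∩ (chartAt H p').source) := by
    have := continuousOn_tangentCoordChange (I := I) p p'
    simp only [extChartAt_source] at this
    exact ContinuousLinearMap.continuous_det.comp_continuousOn this
  have ho : IsOpen ((chartAt H p).source ∩ (chartAt H p').source) :=
    (chartAt H p).open_source.inter (chartAt H p').open_source
  rcases Int.units_eq_one_or e with rfl | rfl
  · convert hc.isOpen_inter_preimage ho (isOpen_Ioi (a := (0 : ℝ))) using 1
    ext q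
    simp only [mem_inter_iff, mem_ofPred_eq, mem_preimage, mem_Ioi, jacSign]
    rw [and_assoc]
    refine and_congr_right fun _ => and_congr_right fun _ => ?_
    constructor
    · intro h3
      by_contra hcon
      rw [if_neg hcon] at h3
      exact absurd h3 (by decide)
    · exact fun h3 => if_pos h3
  · convert hc.isOpen_inter_preimage ho (isOpen_Iio (a := (0 : ℝ))) using 1
    ext q
    simp only [mem_inter_iff, mem_ofPred_eq, mem_preimage, mem_Iio, jacSign]
    constructor
    · rintro ⟨h1, h2, h3⟩
      refine ⟨⟨h1, h2⟩, lt_of_le_of_ne ?_ (det_ne_zero I h1 h2)⟩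
      by_contra hcon
      rw [if_pos (not_le.mp hcon)] at h3
      exact absurd h3 (by decide)
    · rintro ⟨⟨h1, h2⟩, h3⟩
      exact ⟨h1, h2, if_neg h3.not_gt⟩

theorem isOpen_chart_trans_source [FiniteDimensional ℝ E] (p p' : M) (s s' : ℤˣ) :
    IsOpen ((chart I p s).symm.trans (chart I p' s')).source := by
  rw [chart_trans_source]
  have h := (chartAt H p).symm.isOpen_inter_preimage (isOpen_jacSign I p p' (s * s'))
  convert h using 1
  ext h
  simp only [mem_inter_iff, mem_preimage, mem_ofPred_eq, OpenPartialHomeomorph.symm_source]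
  constructor
  · rintro ⟨h1, h2⟩
    exact ⟨h1, (chartAt H p).map_target h1, h2⟩
  · rintro ⟨h1, -, h2⟩
    exact ⟨h1, h2⟩

theorem chart_trans_source_subset (p p' : M) (s s' : ℤˣ) :
    ((chart I p s).symm.trans (chart I p' s')).source ⊆
      ((chartAt H p).symm.trans (chartAt H p')).source := by
  rw [chart_trans_source, OpenPartialHomeomorph.trans_source]
  exact fun h hh => ⟨hh.1, hh.2.1⟩

variable (M) in
/-- The atlas of all the charts `φ^s`. -/
def core [FiniteDimensional ℝ E] : ChartedSpaceCore H (OrientationCover I M) where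
  atlas := range fun ps : M × ℤˣ => chart I ps.1 ps.2
  chartAt x := chart I x.pt x.sgn
  mem_chart_source x := by
    refine ⟨mem_chart_source H x.pt, ?_⟩
    rw [jacSign_self I (mem_chart_source H x.pt), one_mul]
  chart_mem_atlas x := ⟨(x.pt, x.sgn), rfl⟩
  open_source := by
    rintro _ _ ⟨⟨p, s⟩, rfl⟩ ⟨⟨p', s'⟩, rfl⟩
    exact isOpen_chart_trans_source I p p' s s'
  continuousOn_toFun := by
    rintro _ _ ⟨⟨p, s⟩, rfl⟩ ⟨⟨p', s'⟩, rfl⟩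
    exact ((chartAt H p).symm.trans (chartAt H p')).continuousOn.mono
      (chart_trans_source_subset I p p' s s')

variable [FiniteDimensional ℝ E]

instance : TopologicalSpace (OrientationCover I M) := (core I M).toTopologicalSpace

instance : ChartedSpace H (OrientationCover I M) := (core I M).toChartedSpace

end Jac

instance [FiniteDimensional ℝ E] [IsManifold I ∞ M] : IsManifold I ∞ (OrientationCover I M) := by
  apply isManifold_of_contDiffOn
  intro e e' he he'
  have key : ∀ e ∈ atlas H (OrientationCover I M), ∃ (p : M) (s : ℤˣ),
      e.toPartialEquiv = chart I p s := by
    intro e he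
    change e ∈ ⋃ (e : PartialEquiv (OrientationCover I M) H) (he : e ∈ (core I M).atlas),
      {(core I M).openPartialHomeomorph e he} at he
    simp only [mem_iUnion, mem_singleton_iff] at he
    obtain ⟨_, ⟨⟨p, s⟩, rfl⟩, rfl⟩ := he
    exact ⟨p, s, rfl⟩
  obtain ⟨p, s, hp⟩ := key e he
  obtain ⟨p', s', hp'⟩ := key e' he'
  have hM : ContDiffOn ℝ ∞ (I ∘ ((chartAt H p).symm.trans (chartAt H p')) ∘ I.symm)
      (I.symm ⁻¹' ((chartAt H p).symm.trans (chartAt H p')).source ∩ range I) :=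
    (((contDiffGroupoid ∞ I).compatible (chart_mem_atlas H p) (chart_mem_atlas H p'))).1
  have h1 : ((e.symm.trans e').source) = ((chart I p s).symm.trans (chart I p' s')).source := by
    rw [← hp, ← hp']; rfl
  have h2 : ⇑(e.symm.trans e') = (chartAt H p).symm.trans (chartAt H p') := by
    have a : ⇑e.symm = (chart I p s).symm := by rw [← hp]; rfl
    have b : ⇑e' = chart I p' s' := by rw [← hp']; rfl
    ext h
    rw [OpenPartialHomeomorph.coe_trans, a, b]
    rfl
  rw [h1, h2]
  exact hM.mono fun x hx => ⟨chart_trans_source_subset I p p' s s' hx.1, hx.2⟩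

end OrientationCover

/-! ### Closed surfaces and their mapping class groups -/

section Surface

universe u

/-- The dimension of the first singular homology group with coefficients in `ℤ/2`. -/
def bettiOneModTwo (M : Type u) [TopologicalSpace M] : ℕ :=
  Module.finrank (ZMod 2)
    (((AlgebraicTopology.singularHomologyFunctor (ModuleCat.{u} (ZMod 2)) 1).obj
      (ModuleCat.of (ZMod 2) (ULift.{u} (ZMod 2)))).obj (TopCat.of M))

/-- `N` is a copy of `N_g`, the closed connected non-orientable surface of genus `g`
(the connected sum of `g` projective planes). -/
structure IsNonorientableSurface (g : ℕ) (N : Type u) [TopologicalSpace N]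
    [ChartedSpace (EuclideanSpace ℝ (Fin 2)) N] [IsManifold (𝓡 2) ∞ N] : Prop where
  t2Space : T2Space N
  compactSpace : CompactSpace N
  connectedSpace : ConnectedSpace N
  not_orientable : ¬ IsOrientableManifold (𝓡 2) N
  genus : bettiOneModTwo N = g

/-- `S` is a copy of `Σ_h`, the closed connected orientable surface of genus `h`. -/
structure IsOrientableSurface (h : ℕ) (S : Type u) [TopologicalSpace S]
    [ChartedSpace (EuclideanSpace ℝ (Fin 2)) S] [IsManifold (𝓡 2) ∞ S] : Prop where
  t2Space : T2Space S
  compactSpace : CompactSpace S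
  connectedSpace : ConnectedSpace S
  orientable : IsOrientableManifold (𝓡 2) S
  genus : bettiOneModTwo S = 2 * h

variable (S : Type u) [TopologicalSpace S] [ChartedSpace (EuclideanSpace ℝ (Fin 2)) S]

/-- The auto-diffeomorphisms of a surface. -/
def SelfDiffeo : Type u := S ≃ₘ^∞⟮𝓡 2, 𝓡 2⟯ S

variable {S}

/-- The product `D * D'` means: first `D`, then `D'`. -/
instance : Group (SelfDiffeo S) where
  mul D D' := Diffeomorph.trans D D'
  one := Diffeomorph.refl (𝓡 2) S ∞
  inv D := Diffeomorph.symm D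
  mul_assoc _ _ _ := rfl
  one_mul _ := rfl
  mul_one _ := rfl
  inv_mul_cancel D := Diffeomorph.ext fun p => Diffeomorph.apply_symm_apply D p

/-- The underlying map of an auto-diffeomorphism. -/
def SelfDiffeo.toMap (D : SelfDiffeo S) : S → S := Diffeomorph.toEquiv D

theorem SelfDiffeo.toMap_mul (D D' : SelfDiffeo S) (p : S) :
    (D * D').toMap p = D'.toMap (D.toMap p) := rfl

theorem SelfDiffeo.contMDiff (D : SelfDiffeo S) : ContMDiff (𝓡 2) (𝓡 2) ∞ D.toMap :=
  Diffeomorph.contMDiff D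

/-- A smooth family of diffeomorphisms, depending on a real parameter, whose inverses also form a
smooth family. -/
def IsSmoothFamily (F : ℝ → SelfDiffeo S) : Prop :=
  ContMDiff (𝓘(ℝ, ℝ).prod (𝓡 2)) (𝓡 2) ∞ (fun q : ℝ × S => (F q.1).toMap q.2) ∧
  ContMDiff (𝓘(ℝ, ℝ).prod (𝓡 2)) (𝓡 2) ∞ (fun q : ℝ × S => (F q.1)⁻¹.toMap q.2)

theorem IsSmoothFamily.mul {F G : ℝ → SelfDiffeo S} (hF : IsSmoothFamily F)
    (hG : IsSmoothFamily G) : IsSmoothFamily (fun t => F t * G t) := by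
  refine ⟨hG.1.comp (contMDiff_fst.prodMk hF.1), ?_⟩
  have := hF.2.comp (contMDiff_fst.prodMk hG.2)
  convert this using 2 with q
  simp only [mul_inv_rev]
  rfl

theorem IsSmoothFamily.const (D : SelfDiffeo S) : IsSmoothFamily (fun _ => D) :=
  ⟨D.contMDiff.comp contMDiff_snd, (D⁻¹).contMDiff.comp contMDiff_snd⟩

variable (S) in
/-- The normal subgroup of the diffeomorphisms that are smoothly isotopic to the identity. -/
def isotopicToId : Subgroup (SelfDiffeo S) where
  carrier := {D | ∃ F : ℝ → SelfDiffeo S, IsSmoothFamily F ∧ F 0 = 1 ∧ F 1 = D}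
  mul_mem' := by
    rintro _ _ ⟨F, hF, hF0, rfl⟩ ⟨G, hG, hG0, rfl⟩
    exact ⟨fun t => F t * G t, hF.mul hG, by simp [hF0, hG0], rfl⟩
  one_mem' := ⟨fun _ => 1, IsSmoothFamily.const 1, rfl, rfl⟩
  inv_mem' := by
    rintro _ ⟨F, hF, hF0, rfl⟩
    exact ⟨fun t => (F t)⁻¹, ⟨hF.2, by simpa only [inv_inv] using hF.1⟩, by simp [hF0], rfl⟩

instance : (isotopicToId S).Normal where
  conj_mem := by
    rintro _ ⟨F, hF, hF0, rfl⟩ D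
    exact ⟨fun t => D * F t * D⁻¹, ((IsSmoothFamily.const D).mul hF).mul (IsSmoothFamily.const D⁻¹),
      by simp [hF0], rfl⟩

variable (S) in
/-- The group of isotopy classes of auto-diffeomorphisms of a closed surface, with the product
`[D] * [D'] = [D' ∘ D]`. The mapping class group of a non-orientable surface is this group; that of
an oriented surface is the subgroup of the classes of orientation preserving diffeomorphisms, which
contains all Dehn twists and all monodromies of fibrations with oriented fibres. -/
abbrev MappingClasses : Type u := SelfDiffeo S ⧸ isotopicToId S

/-- Two subsets (curves) are ambient isotopic. -/
def AreIsotopic (C C' : Set S) : Prop := ∃ D ∈ isotopicToId S, D.toMap '' C = C'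

/-! ### Determinants with respect to standard orientations -/

/-- The determinant with respect to the standard basis. -/
def stdDet (n : ℕ) (v : Fin n → EuclideanSpace ℝ (Fin n)) : ℝ :=
  (EuclideanSpace.basisFun (Fin n) ℝ).toBasis.det v

/-- A vector of the standard basis. -/
def stdVec (n : ℕ) (i : Fin n) : EuclideanSpace ℝ (Fin n) := EuclideanSpace.single i 1

/-- The real determinant of two complex numbers, positive on `(1, i)`. -/
def complexDet (v w : ℂ) : ℝ := Complex.basisOneI.det ![v, w]

/-- The real determinant of four vectors of `ℂ²`, positive on `(1, 0), (i, 0), (0, 1), (0, i)`. -/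
def complexDetTwo (v₀ v₁ v₂ v₃ : ℂ × ℂ) : ℝ :=
  (Complex.basisOneI.prod Complex.basisOneI).det (Sum.elim ![v₀, v₁] ![v₂, v₃])

/-- A sign as a real number. -/
def signReal (u : ℤˣ) : ℝ := ((u : ℤ) : ℝ)

/-! ### Dehn twists -/

/-- `T` is a right handed Dehn twist about the curve `C`, with respect to the orientation `θ` of a
tubular neighbourhood of `C`. Here `A` parametrizes a tubular neighbourhood of `C` by the annulus
`(ℝ / ℤ) × ℝ`, with core `C = A (ℝ × {0})` and compatibly with the orientations (only the values of
`θ` on `C` matter), and `T` is `(x, t) ↦ (x + β t, t)` on the annulus and the identity elsewhere,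
where `β` passes from `0` to `1`: an arc that crosses `C` is turned to the right. -/
def IsRightDehnTwist (θ : S → ℤˣ) (C : Set S) (T : SelfDiffeo S) : Prop :=
  ∃ (A : ℝ × ℝ → S) (β : ℝ → ℝ),
    ContMDiff 𝓘(ℝ, ℝ × ℝ) (𝓡 2) ∞ A ∧
    (∀ q, Function.Injective (diffAt 𝓘(ℝ, ℝ × ℝ) (𝓡 2) A q)) ∧
    (∀ x t x' t', A (x, t) = A (x', t') ↔ t = t' ∧ ∃ k : ℤ, x' = x + k) ∧
    C = range (fun x : ℝ => A (x, 0)) ∧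
    (∀ x : ℝ, 0 < signReal (θ (A (x, 0))) *
      stdDet 2 ![diffAt 𝓘(ℝ, ℝ × ℝ) (𝓡 2) A (x, 0) (1, 0),
        diffAt 𝓘(ℝ, ℝ × ℝ) (𝓡 2) A (x, 0) (0, 1)]) ∧
    ContDiff ℝ ∞ β ∧ (∀ t ≤ -1, β t = 0) ∧ (∀ t ≥ 1, β t = 1) ∧
    (∀ x t, T.toMap (A (x, t)) = A (x + β t, t)) ∧
    (∀ p, p ∉ range A → T.toMap p = p)

variable (S) in
/-- A curve `c` together with an orientation `θ_c` of its tubular neighbourhood, given by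
its values on `c` (the values elsewhere are irrelevant). -/
structure OrientedCurve where
  /-- the curve -/
  carrier : Set S
  /-- the orientation of the surface along the curve -/
  orient : S → ℤˣ

variable (S) in
/-- A letter `t_{c;θ}` or `t_{c;θ}⁻¹`. -/
structure TwistLetter where
  /-- the curve and the orientation with respect to which the twist is right handed -/
  curve : OrientedCurve S
  /-- the exponent `1` or `-1` -/
  exponent : ℤˣ

/-- The mapping class `τ` is the one denoted by the letter `t_{c;θ}` or `t_{c;θ}⁻¹`. -/
def TwistLetter.Represents (l : TwistLetter S) (τ : MappingClasses S) : Prop :=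
  ∃ T : SelfDiffeo S, IsRightDehnTwist l.curve.orient l.curve.carrier T ∧
    τ = (QuotientGroup.mk T : MappingClasses S) ^ (l.exponent : ℤ)

/-- For an orientation double covering `J : S → N` and the orientation `σ` of `S`: the part `γ` of
the preimage of `c` along which the orientation of `S` corresponds to the orientation `θ_c`. -/
def OrientedCurve.upperLift {N : Type*} [TopologicalSpace N]
    [ChartedSpace (EuclideanSpace ℝ (Fin 2)) N] (σ : S → ℤˣ) (J : S → N)
    (c : OrientedCurve N) : Set S :=
  {s | J s ∈ c.carrier ∧ jacSign (diffAt (𝓡 2) (𝓡 2) J s) * σ s = c.orient (J s)}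

/-- The remaining part of the preimage of `c`. -/
def OrientedCurve.lowerLift {N : Type*} [TopologicalSpace N]
    [ChartedSpace (EuclideanSpace ℝ (Fin 2)) N] (σ : S → ℤˣ) (J : S → N)
    (c : OrientedCurve N) : Set S :=
  J ⁻¹' c.carrier \ c.upperLift σ J

end Surface

/-! ### Lefschetz fibrations -/

section Lefschetz

variable {X : Type*} [TopologicalSpace X] [ChartedSpace (EuclideanHalfSpace 4) X]
  {B : Type*} [TopologicalSpace B] [ChartedSpace (EuclideanHalfSpace 2) B]
  {S : Type*} [TopologicalSpace S] [ChartedSpace (EuclideanSpace ℝ (Fin 2)) S]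

/-- The critical points of a map from a 4-manifold to a 2-manifold. -/
def criticalPoints (f : X → B) : Set X :=
  {x | ¬ Function.Surjective (diffAt (𝓡∂ 4) (𝓡∂ 2) f x)}

/-- The critical values. -/
def criticalValues (f : X → B) : Set B := f '' criticalPoints f

/-- The complex coordinate charts `φ` about `x` and `ψ` about `f x` express `f` as
`(z, w) ↦ z * w`. -/
structure IsLefschetzChart (f : X → B) (x : X)
    (φ : PartialDiffeomorph (𝓡∂ 4) 𝓘(ℝ, ℂ × ℂ) X (ℂ × ℂ) ∞)
    (ψ : PartialDiffeomorph (𝓡∂ 2) 𝓘(ℝ, ℂ) B ℂ ∞) : Prop where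
  mem_source : x ∈ φ.source
  map_center : φ.toFun x = 0
  mapsTo : MapsTo f φ.source ψ.source
  value_center : ψ.toFun (f x) = 0
  local_form : ∀ q ∈ φ.source, ψ.toFun (f q) = (φ.toFun q).1 * (φ.toFun q).2

/-- Lefschetz fibrations (possibly achiral, possibly with non-orientable total space). -/
structure IsLefschetzFibration [IsManifold (𝓡∂ 4) ∞ X] [IsManifold (𝓡∂ 2) ∞ B]
    (f : X → B) : Prop where
  t2_total : T2Space X
  compact_total : CompactSpace X
  connected_total : ConnectedSpace X
  t2_base : T2Space B
  compact_base : CompactSpace B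
  connected_base : ConnectedSpace B
  orientable_base : IsOrientableManifold (𝓡∂ 2) B
  smooth : ContMDiff (𝓡∂ 4) (𝓡∂ 2) ∞ f
  boundary_eq : (𝓡∂ 4).boundary X = f ⁻¹' (𝓡∂ 2).boundary B
  critical_interior : criticalPoints f ⊆ (𝓡∂ 4).interior X
  exists_chart : ∀ x ∈ criticalPoints f, ∃ φ ψ, IsLefschetzChart f x φ ψ

/-- With respect to the orientation `σX` of the total space, some critical point has a chart in
which `f` is `(z, w) ↦ z * w` and which reverses orientation. -/
def IsAchiral (σX : X → ℤˣ) (f : X → B) : Prop :=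
  ∃ x ∈ criticalPoints f, ∃ φ ψ, IsLefschetzChart f x φ ψ ∧
    signReal (σX x) * complexDetTwo
      (diffAt (𝓡∂ 4) 𝓘(ℝ, ℂ × ℂ) φ.toFun x (stdVec 4 0))
      (diffAt (𝓡∂ 4) 𝓘(ℝ, ℂ × ℂ) φ.toFun x (stdVec 4 1))
      (diffAt (𝓡∂ 4) 𝓘(ℝ, ℂ × ℂ) φ.toFun x (stdVec 4 2))
      (diffAt (𝓡∂ 4) 𝓘(ℝ, ℂ × ℂ) φ.toFun x (stdVec 4 3)) < 0

/-- `j` is a diffeomorphism of the closed surface `S` onto the regular fibre of `f` over `b`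
(the inverse of an identification of the fibre with `S`). -/
structure IsFiberParam (f : X → B) (b : B) (j : S → X) : Prop where
  smooth : ContMDiff (𝓡 2) (𝓡∂ 4) ∞ j
  injective : Function.Injective j
  immersion : ∀ p, Function.Injective (diffAt (𝓡 2) (𝓡∂ 4) j p)
  range_eq : range j = f ⁻¹' {b}

variable (S) in
/-- Every regular fibre is diffeomorphic to `S`. -/
def HasRegularFiber (f : X → B) : Prop :=
  ∀ b, b ∉ criticalValues f → ∃ j : S → X, IsFiberParam f b j

/-- The parametrization `j` of the fibre is orientation preserving, where the orientation of the
fibre is the one that, together with that of the base, gives that of the total space. -/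
def IsOrientedFiberParam (σX : X → ℤˣ) (σB : B → ℤˣ) (σS : S → ℤˣ) (f : X → B) (j : S → X) :
    Prop :=
  ∀ (p : S) (v w : EuclideanSpace ℝ (Fin 4)),
    let d := signReal (σB (f (j p))) *
      stdDet 2 ![diffAt (𝓡∂ 4) (𝓡∂ 2) f (j p) v, diffAt (𝓡∂ 4) (𝓡∂ 2) f (j p) w]
    d ≠ 0 → 0 < d * signReal (σS p) * (signReal (σX (j p)) *
      stdDet 4 ![v, w, diffAt (𝓡 2) (𝓡∂ 4) j p (stdVec 2 0), diffAt (𝓡 2) (𝓡∂ 4) j p (stdVec 2 1)])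

/-- `Φ` is a smooth trivialization, with fibre `S`, of the restriction of `f` to the path `a` on
`[0, r]`. -/
structure IsTrivializationAlong (f : X → B) (a : ℝ → B) (r : ℝ) (Φ : ℝ × S → X) : Prop where
  smooth : ContMDiffOn (𝓘(ℝ, ℝ).prod (𝓡 2)) (𝓡∂ 4) ∞ Φ (Icc 0 r ×ˢ univ)
  fiber : ∀ t ∈ Icc 0 r, IsFiberParam f (a t) (fun p => Φ (t, p))

/-- The image of the class `α` of loops in the complement of the critical values under the monodromy
representation of `f`, for the identification `j⁻¹` of the fibre over `y` with `S`, is `τ`: along a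
smooth loop of the class there is a trivialization `Φ` that starts at `j`, and `τ` is the class of
`j⁻¹ ∘ Φ₁`. -/
def HasMonodromy (f : X → B) (j : S → X) {y : {b : B // b ∉ criticalValues f}}
    (α : Path.Homotopic.Quotient y y) (τ : MappingClasses S) : Prop :=
  ∃ (a : Path y y) (Φ : ℝ × S → X) (D : SelfDiffeo S), Path.Homotopic.Quotient.mk a = α ∧
    IsTrivializationAlong f (fun t => (a.extend t : B)) 1 Φ ∧
    (∀ p, Φ (0, p) = j p) ∧ (∀ p, Φ (1, p) = j (D.toMap p)) ∧ τ = QuotientGroup.mk D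

/-- `C` is (isotopic to) the vanishing cycle in `S` that belongs to the critical point `x` and the
path `μ` from the base point `μ 0` to the critical value `f x = μ 1`, for the parametrization `j`
of the fibre over `μ 0`. The circles `{z w = ψ (μ t), |z| = |w|}` shrink to `x` as `t` goes from
`s` to `1`, and the one over `μ s` is carried to the fibre over `μ 0` along `μ`. -/
def IsVanishingCycle (f : X → B) (j : S → X) (μ : ℝ → B) (x : X) (C : Set S) : Prop :=
  x ∈ criticalPoints f ∧ μ 1 = f x ∧
  ∃ φ ψ, IsLefschetzChart f x φ ψ ∧ ∃ s ∈ Ioo (0 : ℝ) 1,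
    (∀ t ∈ Icc s 1, μ t ∈ ψ.source ∧
      ∀ z w : ℂ, z * w = ψ.toFun (μ t) → ‖z‖ = ‖w‖ → (z, w) ∈ φ.target) ∧
    ∃ Φ : ℝ × S → X, IsTrivializationAlong f μ s Φ ∧ (∀ p, Φ (0, p) = j p) ∧
      AreIsotopic {p | ∃ z w : ℂ, z * w = ψ.toFun (μ s) ∧ ‖z‖ = ‖w‖ ∧ φ.invFun (z, w) = Φ (s, p)} C

/-! ### Hurwitz systems and monodromy factorizations -/

/-- The complex chart `ψ` of the oriented 2-manifold `B` is orientation preserving. -/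
def IsOrientedChart (σB : B → ℤˣ) (ψ : PartialDiffeomorph (𝓡∂ 2) 𝓘(ℝ, ℂ) B ℂ ∞) : Prop :=
  ∀ b ∈ ψ.source, 0 < signReal (σB b) *
    complexDet (diffAt (𝓡∂ 2) 𝓘(ℝ, ℂ) ψ.toFun b (stdVec 2 0))
      (diffAt (𝓡∂ 2) 𝓘(ℝ, ℂ) ψ.toFun b (stdVec 2 1))

/-- A Hurwitz system: smoothly embedded arcs `μ i` (only their values on `[0, 1]` matter) from the
interior point `y` to the points of `Δ`, one arc for each point, disjoint apart from `y`, that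
meet every small circle about `y` in counterclockwise order. -/
structure IsHurwitzSystem (σB : B → ℤˣ) (Δ : Set B) (y : B) {n : ℕ} (μ : Fin n → ℝ → B) :
    Prop where
  interior : y ∈ (𝓡∂ 2).interior B
  smooth : ∀ i, ContMDiffOn 𝓘(ℝ, ℝ) (𝓡∂ 2) ∞ (μ i) (Icc 0 1)
  immersion : ∀ i, ∀ t ∈ Icc (0 : ℝ) 1,
    Function.Injective (mfderivWithin 𝓘(ℝ, ℝ) (𝓡∂ 2) (μ i) (Icc 0 1) t)
  injOn : ∀ i, InjOn (μ i) (Icc 0 1)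
  source : ∀ i, μ i 0 = y
  target_injective : Function.Injective (fun i => μ i 1)
  target_range : range (fun i => μ i 1) = Δ
  avoid : ∀ i, ∀ t ∈ Ico (0 : ℝ) 1, μ i t ∉ Δ
  disjoint : ∀ i k, i ≠ k → μ i '' Icc 0 1 ∩ μ k '' Icc 0 1 = {y}
  counterclockwise : ∃ ψ, IsOrientedChart σB ψ ∧ y ∈ ψ.source ∧ ψ.toFun y = 0 ∧
    ∀ᶠ r : ℝ in 𝓝[>] 0, ∃ ϑ : Fin n → ℝ, StrictMono ϑ ∧ (∀ i k, ϑ k < ϑ i + 2 * Real.pi) ∧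
      ∀ i, ∃ t ∈ Ioo (0 : ℝ) 1, μ i t ∈ ψ.source ∧
        ψ.toFun (μ i t) = r * Complex.exp (ϑ i * Complex.I)

/-- `α` is the class of the meridian loop of the arc `μ` from `y` to a point of `Δ`: go along `μ` to
`μ s`, once counterclockwise around `μ 1` on a small circle, and back along `μ`. -/
def IsMeridian (σB : B → ℤˣ) (Δ : Set B) {y : {b : B // b ∉ Δ}} (μ : ℝ → B)
    (α : Path.Homotopic.Quotient y y) : Prop :=
  ∃ ψ, IsOrientedChart σB ψ ∧ μ 1 ∈ ψ.source ∧ ψ.toFun (μ 1) = 0 ∧ ∃ s ∈ Ioo (0 : ℝ) 1,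
    Metric.closedBall (0 : ℂ) ‖ψ.toFun (μ s)‖ ⊆ ψ.target ∧
    (∀ b ∈ Δ, b ∈ ψ.source → ‖ψ.toFun b‖ ≤ ‖ψ.toFun (μ s)‖ → b = μ 1) ∧
    (∀ t ∈ Icc s 1, μ t ∈ ψ.source ∧ ‖ψ.toFun (μ t)‖ ≤ ‖ψ.toFun (μ s)‖) ∧
    ∃ a : Path y y, Path.Homotopic.Quotient.mk a = α ∧ ∀ t : unitInterval,
      (a t : B) =
        if (t : ℝ) ≤ 1 / 3 then μ (3 * t * s)
        else if (t : ℝ) ≤ 2 / 3 then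
          ψ.invFun (Complex.exp (2 * Real.pi * (3 * t - 1) * Complex.I) * ψ.toFun (μ s))
        else μ ((3 - 3 * t) * s)

/-- The product of loop classes, traversed from left to right. -/
def loopProduct {Y : Type*} [TopologicalSpace Y] {y : Y} (l : List (Path.Homotopic.Quotient y y)) :
    Path.Homotopic.Quotient y y :=
  l.foldr Path.Homotopic.Quotient.trans (Path.Homotopic.Quotient.refl y)

variable (B) in
/-- `B` is (diffeomorphic to) the unit disk. -/
def IsDisk : Prop := ∃ e : B → ℂ, ContMDiff (𝓡∂ 2) 𝓘(ℝ, ℂ) ∞ e ∧ Function.Injective e ∧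
  (∀ b, Function.Injective (diffAt (𝓡∂ 2) 𝓘(ℝ, ℂ) e b)) ∧ range e = Metric.closedBall 0 1

variable (B) in
/-- `B` is (diffeomorphic to) the unit sphere. -/
def IsSphere : Prop := ∃ e : B → EuclideanSpace ℝ (Fin 3),
  ContMDiff (𝓡∂ 2) 𝓘(ℝ, EuclideanSpace ℝ (Fin 3)) ∞ e ∧ Function.Injective e ∧
  (∀ b, Function.Injective (diffAt (𝓡∂ 2) 𝓘(ℝ, EuclideanSpace ℝ (Fin 3)) e b)) ∧
  range e = Metric.sphere 0 1

/-- The word `l` in Dehn twists is a monodromy factorization of `f`, for the identification `j⁻¹` of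
the fibre over `y` with `S`. There is a Hurwitz system `μ` with meridians `α i`, and `l` is cut
into consecutive blocks, one for each critical value `μ i 1`, such that the curves of the
block are the vanishing cycles of the critical points over this value (a single one if `f` is
injective on the critical points), and the monodromy around the value is the product of the
twists of the block; finally the monodromy along the product of the meridians (which is the class of
the boundary if `B` is a disk, and trivial if `B` is a sphere) is the product of all the twists. -/
def IsMonodromyFactorizationAt (σB : B → ℤˣ) (f : X → B) (y : {b : B // b ∉ criticalValues f})
    (j : S → X) (l : List (TwistLetter S)) : Prop :=
  ∃ (n : ℕ) (μ : Fin n → ℝ → B) (α : Fin n → Path.Homotopic.Quotient y y)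
    (block : Fin n → List (TwistLetter S)) (τ : Fin n → List (MappingClasses S)),
    IsHurwitzSystem σB (criticalValues f) (y : B) μ ∧
    (∀ i, IsMeridian σB (criticalValues f) (μ i) (α i)) ∧
    l = (List.ofFn block).flatten ∧
    (∀ i, List.Forall₂ TwistLetter.Represents (block i) (τ i)) ∧
    (∀ i, ∃ x : List X, x.Nodup ∧ (∀ q, q ∈ x ↔ q ∈ criticalPoints f ∧ f q = μ i 1) ∧
      List.Forall₂ (fun q c => IsVanishingCycle f j (μ i) q c.curve.carrier) x (block i)) ∧
    (∀ i, HasMonodromy f j (α i) (τ i).prod) ∧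
    HasMonodromy f j (loopProduct (List.ofFn α)) (List.ofFn τ).flatten.prod ∧
    (IsSphere B → (List.ofFn τ).flatten.prod = 1)

/-- The word `t_{c₁;θ₁} ⋯ t_{cₙ;θₙ}` of right handed Dehn twists is a positive monodromy factorization
of the Lefschetz fibration `f` with (non-orientable) regular fibre `S`. -/
def HasPositiveMonodromyFactorization (σB : B → ℤˣ) (f : X → B) (c : List (OrientedCurve S)) :
    Prop :=
  ∃ (y : {b : B // b ∉ criticalValues f}) (j : S → X), IsFiberParam f (y : B) j ∧
    IsMonodromyFactorizationAt σB f y j (c.map fun e => ⟨e, 1⟩)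

/-- The word `t_{C₁}^{ζ₁} ⋯ t_{Cₙ}^{ζₙ}` with `ζᵢ = ±1` is a monodromy factorization of the Lefschetz
fibration `f` with oriented total space, oriented base and oriented regular fibre `S`. -/
def HasMonodromyFactorization (σX : X → ℤˣ) (σB : B → ℤˣ) (σS : S → ℤˣ) (f : X → B)
    (l : List (Set S × ℤˣ)) : Prop :=
  ∃ (y : {b : B // b ∉ criticalValues f}) (j : S → X), IsFiberParam f (y : B) j ∧
    IsOrientedFiberParam σX σB σS f j ∧
    IsMonodromyFactorizationAt σB f y j (l.map fun e => ⟨⟨e.1, σS⟩, e.2⟩)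

end Lefschetz

end

noncomputable section

/-! ### Orientations along maps and the topology of the orientation cover -/

section OrientsAlong

variable {E : Type*} [NormedAddCommGroup E] [NormedSpace ℝ E]
  {H : Type*} [TopologicalSpace H] (I : ModelWithCorners ℝ E H)
  {M : Type*} [TopologicalSpace M] [ChartedSpace H M] [IsManifold I 1 M]
  {P : Type*} [TopologicalSpace P] {Q : Type*} [TopologicalSpace Q]

/-- The signs `e p`, regarded as orientations of the tangent spaces at the points `u p`, are locally
constant in charts, within `s` at `p₀`. -/
def OrientsAlong (u : P → M) (e : P → ℤˣ) (s : Set P) (p₀ : P) : Prop :=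
  ∀ᶠ p in 𝓝[s] p₀, jacSign (tangentCoordChange I (u p) (u p₀) (u p)) * e p = e p₀

variable {I}

theorem IsOrientation.orientsAlong {σ : M → ℤˣ} (h : IsOrientation I σ) {u : P → M} {s : Set P}
    {p₀ : P} (hu : ContinuousWithinAt u s p₀) : OrientsAlong I u (σ ∘ u) s p₀ :=
  hu.tendsto.eventually (h (u p₀))

theorem OrientsAlong.comp {u : P → M} {e : P → ℤˣ} {s : Set P} {w : Q → P} {t : Set Q} {q₀ : Q}
    (h : OrientsAlong I u e s (w q₀)) (hw : ContinuousWithinAt w t q₀) (hm : MapsTo w t s) :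
    OrientsAlong I (u ∘ w) (e ∘ w) t q₀ :=
  (tendsto_nhdsWithin_of_tendsto_nhds_of_eventually_within _ hw
    (eventually_nhdsWithin_of_forall hm)).eventually h

theorem OrientsAlong.mul_left {u : P → M} {e : P → ℤˣ} {s : Set P} {p₀ : P}
    (h : OrientsAlong I u e s p₀) (k : ℤˣ) : OrientsAlong I u (fun p => k * e p) s p₀ := by
  filter_upwards [h] with p hp
  rw [mul_left_comm, hp]

theorem orientsAlong_neg {u : P → M} {e : P → ℤˣ} {s : Set P} {p₀ : P}
    (h : OrientsAlong I u e s p₀) : OrientsAlong I u (fun p => -e p) s p₀ := by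
  simpa using h.mul_left (-1)

theorem units_eq_or_eq_neg (a b : ℤˣ) : a = b ∨ a = -b := by
  rcases Int.units_eq_one_or a with rfl | rfl <;> rcases Int.units_eq_one_or b with rfl | rfl <;>
    simp

end OrientsAlong

namespace OrientationCover

section Flip

variable {E : Type*} [NormedAddCommGroup E] [NormedSpace ℝ E]
  {H : Type*} [TopologicalSpace H] {I : ModelWithCorners ℝ E H}
  {M : Type*} [TopologicalSpace M] [ChartedSpace H M]

/-- The deck transformation. -/
def flip (x : OrientationCover I M) : OrientationCover I M := ⟨x.pt, -x.sgn⟩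

theorem eq_or_eq_flip {x y : OrientationCover I M} (h : x.pt = y.pt) : x = y ∨ x = y.flip := by
  rcases units_eq_or_eq_neg x.sgn y.sgn with h1 | h1
  · exact Or.inl (OrientationCover.ext h h1)
  · exact Or.inr (OrientationCover.ext h h1)

theorem flip_ne (x : OrientationCover I M) : x.flip ≠ x := by
  intro h
  have := congrArg sgn h
  simp only [flip] at this
  exact units_ne_neg_self _ this.symm

end Flip

variable {E : Type*} [NormedAddCommGroup E] [NormedSpace ℝ E]
  {H : Type*} [TopologicalSpace H] {I : ModelWithCorners ℝ E H}
  {M : Type*} [TopologicalSpace M] [ChartedSpace H M] [IsManifold I 1 M] [FiniteDimensional ℝ E]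

theorem continuous_pt : Continuous (pt : OrientationCover I M → M) := by
  refine continuous_iff_continuousAt.2 fun x => ?_
  have h : ContinuousAt ((chartAt H x.pt).symm ∘ chartAt H x) x :=
    ContinuousAt.comp ((chartAt H x.pt).continuousAt_symm (mem_chart_target H x.pt))
      ((chartAt H x).continuousAt (mem_chart_source H x))
  refine h.congr ?_
  filter_upwards [(chartAt H x).open_source.mem_nhds (mem_chart_source H x)] with z hz
  exact (chartAt H x.pt).left_inv hz.1

variable {P : Type*} [TopologicalSpace P]

theorem continuousWithinAt_iff {F : P → OrientationCover I M} {s : Set P} {p₀ : P} :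
    ContinuousWithinAt F s p₀ ↔ ContinuousWithinAt (fun p => (F p).pt) s p₀ ∧
      OrientsAlong I (fun p => (F p).pt) (fun p => (F p).sgn) s p₀ := by
  constructor
  · intro h
    refine ⟨continuous_pt.continuousAt.comp_continuousWithinAt h, ?_⟩
    have := h.tendsto.eventually
      ((chartAt H (F p₀)).open_source.mem_nhds (mem_chart_source H (F p₀)))
    filter_upwards [this] with p hp
    exact hp.2
  · rintro ⟨h1, h2⟩
    have hs : ∀ᶠ p in 𝓝[s] p₀, F p ∈ (chartAt H (F p₀)).source := by
      filter_upwards [h1.tendsto.eventually ((chartAt H (F p₀).pt).open_source.mem_nhds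
        (mem_chart_source H (F p₀).pt)), h2] with p hp hp2
      exact ⟨hp, hp2⟩
    have hc : ContinuousWithinAt (fun p => (chartAt H (F p₀)).symm (chartAt H (F p₀).pt (F p).pt))
        s p₀ := by
      refine ContinuousAt.comp_continuousWithinAt (f := fun p => chartAt H (F p₀).pt (F p).pt) ?_ ?_
      · exact (chartAt H (F p₀)).continuousAt_symm (mem_chart_target H (F p₀))
      · exact ContinuousAt.comp_continuousWithinAt (f := fun p => (F p).pt)
          ((chartAt H (F p₀).pt).continuousAt (mem_chart_source H (F p₀).pt)) h1
    refine hc.congr_of_eventuallyEq ?_ ?_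
    · filter_upwards [hs] with p hp
      exact ((chartAt H (F p₀)).left_inv hp).symm
    · exact ((chartAt H (F p₀)).left_inv (mem_chart_source H (F p₀))).symm

theorem orientsAlong_sgn (x₀ : OrientationCover I M) :
    OrientsAlong I (pt : OrientationCover I M → M) sgn univ x₀ :=
  (continuousWithinAt_iff.1 (continuousWithinAt_id (s := univ) (x := x₀))).2

variable {E' : Type*} [NormedAddCommGroup E'] [NormedSpace ℝ E']
  {H' : Type*} [TopologicalSpace H'] {I' : ModelWithCorners ℝ E' H'}

theorem contMDiffWithinAt_iff [ChartedSpace H' P] {F : P → OrientationCover I M} {s : Set P}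
    {p₀ : P} {n : WithTop ℕ∞} :
    ContMDiffWithinAt I' I n F s p₀ ↔ ContMDiffWithinAt I' I n (fun p => (F p).pt) s p₀ ∧
      OrientsAlong I (fun p => (F p).pt) (fun p => (F p).sgn) s p₀ := by
  rw [_root_.contMDiffWithinAt_iff, _root_.contMDiffWithinAt_iff, continuousWithinAt_iff,
    and_right_comm]
  rfl

theorem contMDiff_pt {n : WithTop ℕ∞} :
    ContMDiff I I n (pt : OrientationCover I M → M) := by
  intro x
  have h : ContMDiffWithinAt I I n (id : OrientationCover I M → _) univ x :=
    contMDiffWithinAt_id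
  exact (contMDiffWithinAt_iff.1 h).1

theorem isOrientation_sgn [IsManifold I 1 (OrientationCover I M)] :
    IsOrientation I (sgn : OrientationCover I M → ℤˣ) := by
  intro x₀
  have := orientsAlong_sgn x₀
  rw [OrientsAlong, nhdsWithin_univ] at this
  exact this

theorem diffAt_pt (x : OrientationCover I M) :
    diffAt I I (pt : OrientationCover I M → M) x = ContinuousLinearMap.id ℝ E := by
  have h : MDifferentiableAt I I (pt : OrientationCover I M → M) x :=
    (contMDiff_pt (n := 1) x).mdifferentiableAt one_ne_zero
  rw [diffAt, h.mfderiv]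
  have h2 : HasFDerivWithinAt (writtenInExtChartAt I I x (pt : OrientationCover I M → M))
      (ContinuousLinearMap.id ℝ E) (range I) (extChartAt I x x) := by
    refine (hasFDerivWithinAt_id _ _).congr_of_eventuallyEq ?_ ?_
    · filter_upwards [extChartAt_target_mem_nhdsWithin (I := I) x] with h hh
      exact (extChartAt I x.pt).right_inv hh
    · exact (extChartAt I x.pt).right_inv (mem_extChartAt_target x.pt)
  exact h2.fderivWithin (I.uniqueDiffOn _ (mem_range_self _))

/-- The points over `U` with the orientations of a given field of orientations on `U`
are an open set. -/
theorem isOpen_sheet {U : Set M} (hU : IsOpen U) {o : M → ℤˣ}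
    (ho : ∀ x ∈ U, OrientsAlong I id o univ x) :
    IsOpen {x : OrientationCover I M | x.pt ∈ U ∧ x.sgn = o x.pt} := by
  rw [isOpen_iff_mem_nhds]
  rintro x ⟨hx, hxs⟩
  have h1 := orientsAlong_sgn x
  rw [OrientsAlong, nhdsWithin_univ] at h1
  have h2 := ho x.pt hx
  rw [OrientsAlong, nhdsWithin_univ] at h2
  filter_upwards [h1, continuous_pt.continuousAt.eventually h2,
    continuous_pt.continuousAt.eventually (hU.mem_nhds hx)] with z hz1 hz2 hz3
  refine ⟨hz3, mul_left_cancel (a := jacSign (tangentCoordChange I z.pt x.pt z.pt)) ?_⟩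
  rw [hz1, hxs]
  exact hz2.symm

theorem isOpenMap_pt : IsOpenMap (pt : OrientationCover I M → M) := by
  refine IsOpenMap.of_nhds_le fun x => ?_
  intro W hW
  rw [Filter.mem_map] at hW
  have h1 : ContinuousAt (fun q => (chartAt H x).symm (chartAt H x.pt q)) x.pt := by
    refine ContinuousAt.comp (f := chartAt H x.pt) ?_ ?_
    · exact (chartAt H x).continuousAt_symm (mem_chart_target H x)
    · exact (chartAt H x.pt).continuousAt (mem_chart_source H x.pt)
  have h0 : (chartAt H x).symm (chartAt H x.pt x.pt) = x :=
    (chartAt H x).left_inv (mem_chart_source H x)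
  have h2 : ∀ᶠ q in 𝓝 x.pt, (chartAt H x).symm (chartAt H x.pt q) ∈ pt ⁻¹' W := by
    refine h1.eventually ?_
    simp only [h0]
    exact hW
  filter_upwards [h2, (chartAt H x.pt).open_source.mem_nhds (mem_chart_source H x.pt)] with q hq hq2
  have : ((chartAt H x).symm (chartAt H x.pt q)).pt = q := (chartAt H x.pt).left_inv hq2
  rw [mem_preimage, this] at hq
  exact hq

theorem continuous_flip : Continuous (flip : OrientationCover I M → OrientationCover I M) := by
  refine continuous_iff_continuousAt.2 fun x => ?_
  rw [← continuousWithinAt_univ]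
  refine continuousWithinAt_iff.2 ⟨continuous_pt.continuousWithinAt, ?_⟩
  exact orientsAlong_neg (orientsAlong_sgn x)

instance [T2Space M] : T2Space (OrientationCover I M) := by
  refine ⟨fun x y hxy => ?_⟩
  by_cases h : x.pt = y.pt
  · have hx : y = x.flip := (eq_or_eq_flip h.symm).resolve_left hxy.symm
    refine ⟨(chartAt H x).source, (chartAt H y).source, (chartAt H x).open_source,
      (chartAt H y).open_source, mem_chart_source H x, mem_chart_source H y, ?_⟩
    rw [Set.disjoint_left]
    rintro z ⟨-, hz1⟩ ⟨-, hz2⟩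
    rw [← h, hz1, hx] at hz2
    exact units_ne_neg_self _ hz2
  · obtain ⟨U, V, hU, hV, hxU, hyV, hd⟩ := t2_separation h
    exact ⟨pt ⁻¹' U, pt ⁻¹' V, hU.preimage continuous_pt, hV.preimage continuous_pt, hxU, hyV,
      hd.preimage _⟩

theorem isClosedMap_pt : IsClosedMap (pt : OrientationCover I M → M) := by
  intro C hC
  have h : (pt '' C)ᶜ = pt '' (Cᶜ ∩ flip ⁻¹' Cᶜ) := by
    ext p
    constructor
    · intro hp
      refine ⟨⟨p, 1⟩, ⟨fun h => hp ⟨_, h, rfl⟩, fun h => hp ⟨_, h, rfl⟩⟩, rfl⟩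
    · rintro ⟨x, ⟨h1, h2⟩, rfl⟩ ⟨y, hy, hxy⟩
      rcases eq_or_eq_flip hxy with rfl | rfl
      · exact h1 hy
      · exact h2 hy
  rw [← isOpen_compl_iff, h]
  exact isOpenMap_pt _ (hC.isOpen_compl.inter (hC.isOpen_compl.preimage continuous_flip))

instance [CompactSpace M] : CompactSpace (OrientationCover I M) := by
  have h : IsProperMap (pt : OrientationCover I M → M) := by
    refine isProperMap_iff_isClosedMap_and_compact_fibers.2
      ⟨continuous_pt, isClosedMap_pt, fun p => ?_⟩
    have : (pt ⁻¹' {p} : Set (OrientationCover I M)) ⊆ {⟨p, 1⟩, ⟨p, -1⟩} := by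
      intro x hx
      rcases Int.units_eq_one_or x.sgn with h | h
      · exact Or.inl (OrientationCover.ext hx h)
      · exact Or.inr (OrientationCover.ext hx h)
    exact ((Set.toFinite _).subset this).isCompact
  refine ⟨?_⟩
  rw [← preimage_univ (f := (pt : OrientationCover I M → M))]
  exact h.isCompact_preimage isCompact_univ

theorem connectedSpace [ConnectedSpace M] (hM : ¬ IsOrientableManifold I M) :
    ConnectedSpace (OrientationCover I M) := by
  have hne : Nonempty (OrientationCover I M) := by
    obtain ⟨p⟩ := (inferInstance : Nonempty M)
    exact ⟨⟨p, 1⟩⟩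
  refine @ConnectedSpace.mk _ _ ?_ hne
  rw [preconnectedSpace_iff_clopen]
  intro U hU
  by_contra hcon
  push Not at hcon
  have hclopen : ∀ V : Set (OrientationCover I M), IsClopen V → IsClopen (pt '' V) := fun V hV =>
    ⟨isClosedMap_pt _ hV.1, isOpenMap_pt _ hV.2⟩
  have hfU : IsClopen (flip ⁻¹' U) := hU.preimage continuous_flip
  have h1 : pt '' (U ∩ flip ⁻¹' U) = ∅ := by
    rcases isClopen_iff.1 (hclopen _ (hU.inter hfU)) with h | h
    · exact h
    · exfalso
      refine hcon.2 (eq_univ_of_forall fun x => ?_)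
      obtain ⟨y, hy, hxy⟩ : x.pt ∈ pt '' (U ∩ flip ⁻¹' U) := h ▸ mem_univ _
      rcases eq_or_eq_flip hxy.symm with rfl | rfl
      · exact hy.1
      · exact hy.2
  have h2 : pt '' U = univ := by
    rcases isClopen_iff.1 (hclopen _ hU) with h | h
    · exact absurd (image_eq_empty.1 h) hcon.1.ne_empty
    · exact h
  have h3 : ∀ p : M, ∃ s : ℤˣ, (⟨p, s⟩ : OrientationCover I M) ∈ U := by
    intro p
    obtain ⟨y, hy, rfl⟩ : p ∈ pt '' U := h2 ▸ mem_univ p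
    exact ⟨y.sgn, hy⟩
  choose σ hσ using h3
  refine hM ⟨σ, fun p => ?_⟩
  have hn : (U ∩ (chartAt H (⟨p, σ p⟩ : OrientationCover I M)).source) ∈
      𝓝 (⟨p, σ p⟩ : OrientationCover I M) :=
    Filter.inter_mem (hU.2.mem_nhds (hσ p)) (chart_source_mem_nhds H _)
  filter_upwards [isOpenMap_pt.image_mem_nhds hn] with q hq
  obtain ⟨y, ⟨hyU, hy⟩, rfl⟩ := hq
  have : y.sgn = σ y.pt := by
    rcases units_eq_or_eq_neg y.sgn (σ y.pt) with h | h
    · exact h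
    · exfalso
      have : y.pt ∈ pt '' (U ∩ flip ⁻¹' U) := by
        refine ⟨y, ⟨hyU, ?_⟩, rfl⟩
        have h4 : y.flip = ⟨y.pt, σ y.pt⟩ := by
          ext
          · rfl
          · simp [flip, h]
        rw [mem_preimage, h4]
        exact hσ _
      rw [h1] at this
      exact this
  rw [← this]
  exact hy.2

end OrientationCover

/-! ### Transport of orientations by families of maps -/

section Transport

variable {E : Type*} [NormedAddCommGroup E] [NormedSpace ℝ E]
  {E' : Type*} [NormedAddCommGroup E'] [NormedSpace ℝ E']
  {E'' : Type*} [NormedAddCommGroup E''] [NormedSpace ℝ E'']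
  {F : Type*} [NormedAddCommGroup F] [NormedSpace ℝ F]
  {H : Type*} [TopologicalSpace H] {I : ModelWithCorners ℝ E H}
  {H' : Type*} [TopologicalSpace H'] {I' : ModelWithCorners ℝ E' H'}
  {H₁ : Type*} [TopologicalSpace H₁] {I₁ : ModelWithCorners ℝ E H₁}
  {H'' : Type*} [TopologicalSpace H''] {I'' : ModelWithCorners ℝ E'' H''}
  {G : Type*} [TopologicalSpace G] {J : ModelWithCorners ℝ F G}
  {M : Type*} [TopologicalSpace M] [ChartedSpace H M]
  {M' : Type*} [TopologicalSpace M'] [ChartedSpace H' M']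
  {M₁ : Type*} [TopologicalSpace M₁] [ChartedSpace H₁ M₁]
  {M'' : Type*} [TopologicalSpace M''] [ChartedSpace H'' M'']
  {P : Type*} [TopologicalSpace P] [ChartedSpace G P]

theorem diffAt_comp {g : M' → M''} {f : M → M'} {x : M} (hg : MDifferentiableAt I' I'' g (f x))
    (hf : MDifferentiableAt I I' f x) :
    diffAt I I'' (g ∘ f) x = (diffAt I' I'' g (f x)).comp (diffAt I I' f x) :=
  mfderiv_comp x hg hf

theorem diffAt_congr {f f' : M → M'} {x : M} (h : f =ᶠ[𝓝 x] f') :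
    diffAt I I' f x = diffAt I I' f' x :=
  h.mfderiv_eq

theorem diffAt_id (x : M) : diffAt I I id x = ContinuousLinearMap.id ℝ E :=
  mfderiv_id

theorem jacSign_id : jacSign (ContinuousLinearMap.id ℝ E) = 1 := by
  simp [jacSign, ContinuousLinearMap.det]

theorem jacSign_mul_det_pos {L : E →L[ℝ] E} (h : L.det ≠ 0) : 0 < signReal (jacSign L) * L.det := by
  unfold jacSign signReal
  split_ifs with h1
  · simpa using h1
  · have : L.det < 0 := lt_of_le_of_ne (not_lt.1 h1) h
    simpa using this

theorem det_comp (A B : E →L[ℝ] E) : (A.comp B).det = A.det * B.det := by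
  simp [ContinuousLinearMap.det]

theorem det_ne_zero_of_injective [FiniteDimensional ℝ E] {L : E →L[ℝ] E}
    (h : Function.Injective L) : L.det ≠ 0 := by
  have := LinearEquiv.isUnit_det' (LinearEquiv.ofInjectiveEndo (L : E →ₗ[ℝ] E) h)
  exact this.ne_zero

theorem injective_of_det_ne_zero [FiniteDimensional ℝ E] {L : E →L[ℝ] E}
    (h : L.det ≠ 0) : Function.Injective L := by
  have h1 : IsUnit (L : E →ₗ[ℝ] E) := (LinearMap.isUnit_iff_isUnit_det _).2 (isUnit_iff_ne_zero.2 h)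
  exact ((Module.End.isUnit_iff _).1 h1).1

theorem signReal_mul (a b : ℤˣ) : signReal (a * b) = signReal a * signReal b := by
  simp [signReal]

theorem signReal_neg (a : ℤˣ) : signReal (-a) = -signReal a := by
  simp [signReal]

theorem signReal_mul_self (a : ℤˣ) : signReal a * signReal a = 1 := by
  rw [← signReal_mul, Int.units_mul_self]
  simp [signReal]

theorem eq_of_signReal_mul_pos {a b : ℤˣ} {r : ℝ} (ha : 0 < signReal a * r)
    (hb : 0 < signReal b * r) : a = b := by
  rcases units_eq_or_eq_neg a b with h | h
  · exact h
  · rw [h, signReal_neg] at ha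
    linarith

variable [IsManifold I 1 M] [IsManifold I' 1 M'] [IsManifold I₁ 1 M₁]

theorem jacSign_tangentCoordChange_symm {x y z : M} (hx : z ∈ (chartAt H x).source)
    (hy : z ∈ (chartAt H y).source) :
    jacSign (tangentCoordChange I x y z) = jacSign (tangentCoordChange I y x z) := by
  have h := OrientationCover.jacSign_cocycle I hy hx hy
  rw [OrientationCover.jacSign_self I hy] at h
  rw [← mul_one (jacSign (tangentCoordChange I y x z)), h, mul_left_comm, Int.units_mul_self,
    mul_one]

theorem tangentCoordChange_self_eq {x z : M} (hx : z ∈ (chartAt H x).source) :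
    tangentCoordChange I x x z = ContinuousLinearMap.id ℝ E := by
  ext v
  exact tangentCoordChange_self (by rwa [extChartAt_source])

variable (I I') in
/-- The derivative of a member of a family of maps, in the charts at one fixed point and its
image. -/
def coordDiff (f : P → M → M') (u : P → M) (p₀ p : P) : E →L[ℝ] E' :=
  (tangentCoordChange I' (f p (u p)) (f p₀ (u p₀)) (f p (u p))).comp
    ((diffAt I I' (f p) (u p)).comp (tangentCoordChange I (u p₀) (u p) (u p)))

theorem coordDiff_self {P : Type*} (f : P → M → M') (u : P → M) (p₀ : P) :
    coordDiff I I' f u p₀ p₀ = diffAt I I' (f p₀) (u p₀) := by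
  rw [coordDiff, tangentCoordChange_self_eq (mem_chart_source _ _),
    tangentCoordChange_self_eq (mem_chart_source _ _), ContinuousLinearMap.comp_id,
    ContinuousLinearMap.id_comp]

theorem continuousWithinAt_uncurry {f : P → M → M'} {u : P → M} {t : Set P} {p₀ : P}
    (hf : ContinuousWithinAt (Function.uncurry f) (t ×ˢ univ) (p₀, u p₀))
    (hu : ContinuousWithinAt u t p₀) : ContinuousWithinAt (fun p => f p (u p)) t p₀ :=
  hf.comp (f := fun p => (p, u p)) (continuousWithinAt_id.prodMk hu) fun _ hp => ⟨hp, mem_univ _⟩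

theorem continuousWithinAt_coordDiff [IsManifold J 1 P] {f : P → M → M'} {u : P → M} {t : Set P}
    {p₀ : P} (hf : ContMDiffWithinAt (J.prod I) I' 1 (Function.uncurry f) (t ×ˢ univ) (p₀, u p₀))
    (hu : ContMDiffWithinAt J I 1 u t p₀) (hp₀ : p₀ ∈ t) :
    ContinuousWithinAt (coordDiff I I' f u p₀) t p₀ := by
  have h := hf.mfderivWithin (m := 0) (hu.of_le zero_le_one) hp₀ (mapsTo_univ _ _)
    (by simp) uniqueMDiffOn_univ
  refine h.continuousWithinAt.congr_of_eventuallyEq_of_mem ?_ hp₀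
  filter_upwards [hu.continuousWithinAt.tendsto.eventually (chart_source_mem_nhds H (u p₀)),
    (continuousWithinAt_uncurry hf.continuousWithinAt hu.continuousWithinAt).tendsto.eventually
      (chart_source_mem_nhds H' (f p₀ (u p₀)))] with p hp1 hp2
  refine Eq.trans ?_ (inTangentCoordinates_eq _ _ _ hp1 hp2).symm
  simp only [mfderivWithin_univ]
  rfl

theorem eventually_jacSign_eq [FiniteDimensional ℝ E] {C : P → E →L[ℝ] E} {t : Set P} {p₀ : P}
    (hC : ContinuousWithinAt C t p₀) (h₀ : (C p₀).det ≠ 0) :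
    ∀ᶠ p in 𝓝[t] p₀, (C p).det ≠ 0 ∧ jacSign (C p) = jacSign (C p₀) := by
  have hc : ContinuousWithinAt (fun p => (C p).det) t p₀ :=
    ContinuousLinearMap.continuous_det.continuousAt.comp_continuousWithinAt hC
  rcases lt_or_gt_of_ne h₀ with h | h
  · filter_upwards [hc.tendsto.eventually (eventually_lt_nhds h)] with p hp
    simp [jacSign, hp.ne, hp.not_gt, h.not_gt]
  · filter_upwards [hc.tendsto.eventually (eventually_gt_nhds h)] with p hp
    simp [jacSign, hp.ne', hp, h]

theorem OrientsAlong.jacSign_diffAt [FiniteDimensional ℝ E] [IsManifold J 1 P] {f : P → M → M₁}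
    {u : P → M} {t : Set P} {p₀ : P} {e : P → ℤˣ}
    (he : OrientsAlong I u e t p₀)
    (hf : ContMDiffWithinAt (J.prod I) I₁ 1 (Function.uncurry f) (t ×ˢ univ) (p₀, u p₀))
    (hu : ContMDiffWithinAt J I 1 u t p₀) (hp₀ : p₀ ∈ t)
    (hd : (diffAt I I₁ (f p₀) (u p₀)).det ≠ 0) :
    OrientsAlong I₁ (fun p => f p (u p)) (fun p => jacSign (diffAt I I₁ (f p) (u p)) * e p) t p₀ := by
  have hC := continuousWithinAt_coordDiff hf hu hp₀
  have h0 := coordDiff_self (I := I) (I' := I₁) f u p₀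
  filter_upwards [eventually_jacSign_eq hC (by rwa [h0]), he,
    hu.continuousWithinAt.tendsto.eventually (chart_source_mem_nhds H (u p₀)),
    (continuousWithinAt_uncurry hf.continuousWithinAt hu.continuousWithinAt).tendsto.eventually
      (chart_source_mem_nhds H₁ (f p₀ (u p₀)))] with p hp1 hp2 hp3 hp4
  rw [h0] at hp1
  obtain ⟨hp1, hp1'⟩ := hp1
  rw [coordDiff] at hp1 hp1'
  have hp5 := hp1
  rw [det_comp] at hp5
  have hp6 := right_ne_zero_of_mul hp5
  have hp7 := hp6
  rw [det_comp] at hp7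
  rw [jacSign_comp (left_ne_zero_of_mul hp5) hp6,
    jacSign_comp (left_ne_zero_of_mul hp7) (right_ne_zero_of_mul hp7),
    jacSign_tangentCoordChange_symm hp3 (mem_chart_source _ _)] at hp1'
  rw [← hp1', ← hp2]
  simp only [mul_assoc]
  rw [← mul_assoc (jacSign (tangentCoordChange I (u p) (u p₀) (u p))), Int.units_mul_self, one_mul]

end Transport

/-! ### Orientations of fibres -/

section FiberCompatible

theorem stdDet_comp (n : ℕ) (L : EuclideanSpace ℝ (Fin n) →L[ℝ] EuclideanSpace ℝ (Fin n))
    (v : Fin n → EuclideanSpace ℝ (Fin n)) : stdDet n (fun i => L (v i)) = L.det * stdDet n v :=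
  Module.Basis.det_comp _ (L : EuclideanSpace ℝ (Fin n) →ₗ[ℝ] EuclideanSpace ℝ (Fin n)) v

theorem stdDet_eq (n : ℕ) (v : Fin n → EuclideanSpace ℝ (Fin n)) :
    stdDet n v = Matrix.det (Matrix.of fun i k => v k i) := by
  rw [stdDet, Module.Basis.det_apply]
  congr 1

theorem stdDet_two_comp (L : EuclideanSpace ℝ (Fin 2) →L[ℝ] EuclideanSpace ℝ (Fin 2))
    (v w : EuclideanSpace ℝ (Fin 2)) : stdDet 2 ![L v, L w] = L.det * stdDet 2 ![v, w] := by
  rw [← stdDet_comp]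
  congr 1
  ext i
  fin_cases i <;> rfl

theorem stdDet_four_comp (L : EuclideanSpace ℝ (Fin 4) →L[ℝ] EuclideanSpace ℝ (Fin 4))
    (a b c d : EuclideanSpace ℝ (Fin 4)) :
    stdDet 4 ![L a, L b, L c, L d] = L.det * stdDet 4 ![a, b, c, d] := by
  rw [← stdDet_comp]
  congr 1
  ext i
  fin_cases i <;> rfl

theorem stdDet_two_eq (v w : EuclideanSpace ℝ (Fin 2)) :
    stdDet 2 ![v, w] = v 0 * w 1 - w 0 * v 1 := by
  rw [stdDet_eq, Matrix.det_fin_two]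
  simp

theorem stdDet_two_basis : stdDet 2 ![stdVec 2 0, stdVec 2 1] = 1 := by
  rw [stdDet_two_eq]
  simp [stdVec]

/-- The orientations with signs `sB`, `sS`, `sX` of base, fibre and total space are compatible,
where `b` and `a` are the differentials of the fibration and of a parametrization of the fibre. -/
def FiberCompatible (b : EuclideanSpace ℝ (Fin 4) →L[ℝ] EuclideanSpace ℝ (Fin 2))
    (a : EuclideanSpace ℝ (Fin 2) →L[ℝ] EuclideanSpace ℝ (Fin 4)) (sB sS sX : ℤˣ) : Prop :=
  ∀ v w, let d := signReal sB * stdDet 2 ![b v, b w]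
    d ≠ 0 → 0 < d * signReal sS * (signReal sX * stdDet 4 ![v, w, a (stdVec 2 0), a (stdVec 2 1)])

variable {b : EuclideanSpace ℝ (Fin 4) →L[ℝ] EuclideanSpace ℝ (Fin 2)}
  {a : EuclideanSpace ℝ (Fin 2) →L[ℝ] EuclideanSpace ℝ (Fin 4)}

theorem exists_stdDet_ne_zero (hb : Function.Surjective b) :
    ∃ v w, stdDet 2 ![b v, b w] ≠ 0 := by
  obtain ⟨v, hv⟩ := hb (stdVec 2 0)
  obtain ⟨w, hw⟩ := hb (stdVec 2 1)
  exact ⟨v, w, by rw [hv, hw, stdDet_two_basis]; exact one_ne_zero⟩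

theorem FiberCompatible.unique (hb : Function.Surjective b) {sB sS s s' : ℤˣ}
    (h : FiberCompatible b a sB sS s) (h' : FiberCompatible b a sB sS s') : s = s' := by
  obtain ⟨v, w, hvw⟩ := exists_stdDet_ne_zero hb
  have hd : signReal sB * stdDet 2 ![b v, b w] ≠ 0 :=
    mul_ne_zero (by simp [signReal]) hvw
  have h1 := h v w hd
  have h2 := h' v w hd
  rw [mul_left_comm] at h1 h2
  exact eq_of_signReal_mul_pos h1 h2

/-- The splitting of the tangent space of the total space into a horizontal and a vertical part. -/
def splitMap (r a : EuclideanSpace ℝ (Fin 2) →L[ℝ] EuclideanSpace ℝ (Fin 4)) :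
    EuclideanSpace ℝ (Fin 4) →L[ℝ] EuclideanSpace ℝ (Fin 4) :=
  LinearMap.toContinuousLinearMap
    { toFun := fun x => r (!₂[x 0, x 1]) + a (!₂[x 2, x 3])
      map_add' := fun x y => by
        have h1 : (!₂[(x + y) 0, (x + y) 1] : EuclideanSpace ℝ (Fin 2)) =
          !₂[x 0, x 1] + !₂[y 0, y 1] := by ext i; fin_cases i <;> simp
        have h2 : (!₂[(x + y) 2, (x + y) 3] : EuclideanSpace ℝ (Fin 2)) =
          !₂[x 2, x 3] + !₂[y 2, y 3] := by ext i; fin_cases i <;> simp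
        rw [h1, h2, map_add, map_add]
        abel
      map_smul' := fun k x => by
        have h1 : (!₂[(k • x) 0, (k • x) 1] : EuclideanSpace ℝ (Fin 2)) =
          k • !₂[x 0, x 1] := by ext i; fin_cases i <;> simp
        have h2 : (!₂[(k • x) 2, (k • x) 3] : EuclideanSpace ℝ (Fin 2)) =
          k • !₂[x 2, x 3] := by ext i; fin_cases i <;> simp
        simp only [h1, h2, map_smul, smul_add, RingHom.id_apply] }

theorem splitMap_apply (r a : EuclideanSpace ℝ (Fin 2) →L[ℝ] EuclideanSpace ℝ (Fin 4))
    (v w : EuclideanSpace ℝ (Fin 2)) : splitMap r a !₂[v 0, v 1, w 0, w 1] = r v + a w := by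
  have h1 : (!₂[v 0, v 1] : EuclideanSpace ℝ (Fin 2)) = v := by ext i; fin_cases i <;> rfl
  have h2 : (!₂[w 0, w 1] : EuclideanSpace ℝ (Fin 2)) = w := by ext i; fin_cases i <;> rfl
  change r (!₂[v 0, v 1]) + a (!₂[w 0, w 1]) = _
  rw [h1, h2]

theorem stdDet_four_eq (v w v' w' : EuclideanSpace ℝ (Fin 2)) :
    stdDet 4 ![!₂[v 0, v 1, v' 0, v' 1], !₂[w 0, w 1, w' 0, w' 1], !₂[0, 0, 1, 0], !₂[0, 0, 0, 1]]
      = stdDet 2 ![v, w] := by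
  rw [stdDet_eq, stdDet_two_eq]
  simp [Matrix.det_succ_row_zero, Fin.sum_univ_succ, Fin.succAbove]
  ring

/-- The determinant of the total space is a multiple of that of the base. -/
theorem exists_stdDet_four_eq (ha : Function.Injective a) (hb : Function.Surjective b)
    (hba : b.comp a = 0) (hdim : ∀ v, b v = 0 → ∃ w, a w = v) :
    ∃ k : ℝ, k ≠ 0 ∧ ∀ v w,
      stdDet 4 ![v, w, a (stdVec 2 0), a (stdVec 2 1)] = k * stdDet 2 ![b v, b w] := by
  obtain ⟨r, hr⟩ := (b : EuclideanSpace ℝ (Fin 4) →ₗ[ℝ] EuclideanSpace ℝ (Fin 2)).exists_rightInverse_of_surjective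
    (LinearMap.range_eq_top.2 hb)
  have hbr : ∀ v, b (r v) = v := fun v => LinearMap.congr_fun hr v
  have hba' : ∀ v, b (a v) = 0 := fun v => congrArg (fun L => L v) hba
  set r' := LinearMap.toContinuousLinearMap r with hr'
  set L := splitMap r' a with hL
  have hLe : ∀ x : EuclideanSpace ℝ (Fin 4), L x = r' !₂[x 0, x 1] + a !₂[x 2, x 3] := fun x => rfl
  have hinj : Function.Injective L := by
    rw [injective_iff_map_eq_zero]
    intro x hx
    rw [hLe] at hx
    have h1 := congrArg b hx
    rw [map_add, hba', add_zero, map_zero] at h1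
    have h2 : (!₂[x 0, x 1] : EuclideanSpace ℝ (Fin 2)) = 0 := (hbr _).symm.trans h1
    rw [h2, map_zero, zero_add] at hx
    have h3 := ha (hx.trans (map_zero a).symm)
    have e0 := congrArg (fun y : EuclideanSpace ℝ (Fin 2) => y 0) h2
    have e1 := congrArg (fun y : EuclideanSpace ℝ (Fin 2) => y 1) h2
    have e2 := congrArg (fun y : EuclideanSpace ℝ (Fin 2) => y 0) h3
    have e3 := congrArg (fun y : EuclideanSpace ℝ (Fin 2) => y 1) h3
    ext i
    fin_cases i
    exacts [e0, e1, e2, e3]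
  have hsplit : ∀ v, ∃ v' : EuclideanSpace ℝ (Fin 2), v = L !₂[(b v) 0, (b v) 1, v' 0, v' 1] := by
    intro v
    obtain ⟨w, hw⟩ := hdim (v - r' (b v)) (by rw [map_sub, sub_eq_zero]; exact (hbr _).symm)
    exact ⟨w, by rw [hL, splitMap_apply, hw]; abel⟩
  have ha0 : a (stdVec 2 0) = L !₂[0, 0, 1, 0] := by
    rw [hLe]
    have h1 : (!₂[(0 : ℝ), 0] : EuclideanSpace ℝ (Fin 2)) = 0 := by ext i; fin_cases i <;> rfl
    have h2 : stdVec 2 0 = !₂[(1 : ℝ), 0] := by ext i; fin_cases i <;> simp [stdVec]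
    rw [h2]
    change _ = r' !₂[0, 0] + a !₂[1, 0]
    rw [h1, map_zero, zero_add]
  have ha1 : a (stdVec 2 1) = L !₂[0, 0, 0, 1] := by
    rw [hLe]
    have h1 : (!₂[(0 : ℝ), 0] : EuclideanSpace ℝ (Fin 2)) = 0 := by ext i; fin_cases i <;> rfl
    have h2 : stdVec 2 1 = !₂[(0 : ℝ), 1] := by ext i; fin_cases i <;> simp [stdVec]
    rw [h2]
    change _ = r' !₂[0, 0] + a !₂[0, 1]
    rw [h1, map_zero, zero_add]
  refine ⟨L.det, det_ne_zero_of_injective hinj, fun v w => ?_⟩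
  obtain ⟨v', hv'⟩ := hsplit v
  obtain ⟨w', hw'⟩ := hsplit w
  rw [ha0, ha1]
  conv_lhs => rw [hv', hw']
  rw [stdDet_four_comp, stdDet_four_eq]

variable (b a) in
/-- The orientation of the total space that is compatible with the standard orientations of base and
fibre. -/
def fiberSign : ℤˣ :=
  open Classical in
  if ∃ v w, 0 < stdDet 2 ![b v, b w] * stdDet 4 ![v, w, a (stdVec 2 0), a (stdVec 2 1)]
    then 1 else -1

theorem fiberCompatible_fiberSign (ha : Function.Injective a) (hb : Function.Surjective b)
    (hba : b.comp a = 0) (hdim : ∀ v, b v = 0 → ∃ w, a w = v) (sB sS : ℤˣ) :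
    FiberCompatible b a sB sS (fiberSign b a * (sB * sS)) := by
  obtain ⟨k, hk, h⟩ := exists_stdDet_four_eq ha hb hba hdim
  have hs : 0 < signReal (fiberSign b a) * k := by
    unfold fiberSign
    split_ifs with hc
    · obtain ⟨v, w, hvw⟩ := hc
      rw [h] at hvw
      have : 0 < k * (stdDet 2 ![b v, b w]) ^ 2 := by linarith [hvw]
      simpa [signReal] using pos_of_mul_pos_left this (sq_nonneg _)
    · obtain ⟨v, w, hvw⟩ := exists_stdDet_ne_zero hb
      push Not at hc
      have h1 := hc v w
      rw [h] at h1
      have h2 : 0 < (stdDet 2 ![b v, b w]) ^ 2 := by positivity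
      have h3 : k ≤ 0 := by
        by_contra hk'
        push Not at hk'
        have := mul_pos hk' h2
        linarith
      have h4 := lt_of_le_of_ne h3 hk
      simpa [signReal] using h4
  intro v w d hd
  rw [h, signReal_mul, signReal_mul]
  have hd2 : 0 < d * d := mul_self_pos.2 hd
  have e : d * signReal sS * (signReal (fiberSign b a) * (signReal sB * signReal sS) *
      (k * stdDet 2 ![b v, b w])) =
      (signReal sS * signReal sS) * ((signReal (fiberSign b a) * k) * (d * d)) := by
    simp only [d]
    ring
  rw [e, signReal_mul_self, one_mul]
  exact mul_pos hs hd2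

theorem FiberCompatible.transform {sB sS sX : ℤˣ} (h : FiberCompatible b a sB sS sX)
    {B A : EuclideanSpace ℝ (Fin 2) →L[ℝ] EuclideanSpace ℝ (Fin 2)}
    {L L' : EuclideanSpace ℝ (Fin 4) →L[ℝ] EuclideanSpace ℝ (Fin 4)} (hB : B.det ≠ 0)
    (hA : A.det ≠ 0) (hL : L.comp L' = ContinuousLinearMap.id ℝ _) :
    FiberCompatible (B.comp (b.comp L')) (L.comp (a.comp A)) (jacSign B * sB) (jacSign A * sS)
      (jacSign L * sX) := by
  have hLd : L.det ≠ 0 := by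
    intro h0
    have := congrArg ContinuousLinearMap.det hL
    rw [det_comp, h0] at this
    simp [ContinuousLinearMap.det] at this
  have hL1 : ∀ v, L (L' v) = v := fun v => congrArg (fun T => T v) hL
  intro v w d hd
  have hd' : signReal sB * stdDet 2 ![b (L' v), b (L' w)] ≠ 0 := by
    intro h0
    apply hd
    change signReal (jacSign B * sB) * stdDet 2 ![B (b (L' v)), B (b (L' w))] = 0
    rw [stdDet_two_comp, signReal_mul]
    linear_combination (signReal (jacSign B) * B.det) * h0
  have h1 := h (L' v) (L' w) hd'
  have e4 : stdDet 4 ![v, w, L (a (A (stdVec 2 0))), L (a (A (stdVec 2 1)))] =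
      L.det * (A.det * stdDet 4 ![L' v, L' w, a (stdVec 2 0), a (stdVec 2 1)]) := by
    conv_lhs => rw [← hL1 v, ← hL1 w]
    rw [stdDet_four_comp]
    congr 1
    simp only [stdDet_eq]
    have hA1 : ∀ x : EuclideanSpace ℝ (Fin 2), x = x 0 • stdVec 2 0 + x 1 • stdVec 2 1 := by
      intro x
      ext i
      fin_cases i <;> simp [stdVec]
    have hAd : A.det = (A (stdVec 2 0)) 0 * (A (stdVec 2 1)) 1 -
        (A (stdVec 2 1)) 0 * (A (stdVec 2 0)) 1 := by
      rw [← stdDet_two_eq, stdDet_two_comp, stdDet_two_basis, mul_one]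
    rw [hAd]
    have k0 := congrArg a (hA1 (A (stdVec 2 0)))
    have k1 := congrArg a (hA1 (A (stdVec 2 1)))
    rw [k0, k1]
    simp only [map_add, map_smul]
    simp [Matrix.det_succ_row_zero, Fin.sum_univ_succ, Fin.succAbove]
    ring
  change 0 < signReal (jacSign B * sB) * stdDet 2 ![B (b (L' v)), B (b (L' w))] *
    signReal (jacSign A * sS) *
    (signReal (jacSign L * sX) * stdDet 4 ![v, w, L (a (A (stdVec 2 0))), L (a (A (stdVec 2 1)))])
  rw [e4, stdDet_two_comp]
  simp only [signReal_mul]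
  have pB := jacSign_mul_det_pos hB
  have pA := jacSign_mul_det_pos hA
  have pL := jacSign_mul_det_pos hLd
  have := mul_pos (mul_pos (mul_pos pB pA) pL) h1
  refine lt_of_lt_of_eq this ?_
  ring

end FiberCompatible

/-! ### Maps between orientation covers -/

namespace OrientationCover

variable {E : Type*} [NormedAddCommGroup E] [NormedSpace ℝ E] [FiniteDimensional ℝ E]
  {F : Type*} [NormedAddCommGroup F] [NormedSpace ℝ F]
  {H : Type*} [TopologicalSpace H] {I : ModelWithCorners ℝ E H}
  {H₁ : Type*} [TopologicalSpace H₁] {I₁ : ModelWithCorners ℝ E H₁}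
  {H₂ : Type*} [TopologicalSpace H₂] {I₂ : ModelWithCorners ℝ E H₂}
  {G : Type*} [TopologicalSpace G] {J : ModelWithCorners ℝ F G}
  {M : Type*} [TopologicalSpace M] [ChartedSpace H M]
  {M₁ : Type*} [TopologicalSpace M₁] [ChartedSpace H₁ M₁]
  {M₂ : Type*} [TopologicalSpace M₂] [ChartedSpace H₂ M₂]
  {P : Type*} [TopologicalSpace P] [ChartedSpace G P]

variable (I I₁) in
/-- The map of orientation covers induced by a map with invertible differentials. -/
def map (g : M → M₁) (x : OrientationCover I M) : OrientationCover I₁ M₁ :=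
  ⟨g x.pt, jacSign (diffAt I I₁ g x.pt) * x.sgn⟩

variable (I) in
/-- The section of the orientation cover given by an orientation. -/
def ofOrientation (σ : M → ℤˣ) (p : M) : OrientationCover I M := ⟨p, σ p⟩

omit [FiniteDimensional ℝ E] in
theorem map_flip (g : M → M₁) (x : OrientationCover I M) :
    map I I₁ g x.flip = (map I I₁ g x).flip := by
  ext <;> simp [map, flip]

omit [FiniteDimensional ℝ E] in
theorem map_map {g : M → M₁} {h : M₁ → M₂} (x : OrientationCover I M)
    (hg : MDifferentiableAt I I₁ g x.pt) (hh : MDifferentiableAt I₁ I₂ h (g x.pt))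
    (hg' : (diffAt I I₁ g x.pt).det ≠ 0) (hh' : (diffAt I₁ I₂ h (g x.pt)).det ≠ 0) :
    map I₁ I₂ h (map I I₁ g x) = map I I₂ (h ∘ g) x := by
  ext1
  · rfl
  · change jacSign _ * (jacSign _ * _) = jacSign _ * _
    rw [diffAt_comp hh hg, jacSign_comp hh' hg', mul_assoc]
    rfl

omit [FiniteDimensional ℝ E] in
theorem map_id (x : OrientationCover I M) : map I I id x = x := by
  ext1
  · rfl
  · change jacSign _ * _ = _
    rw [diffAt_id, jacSign_id, one_mul]

omit [FiniteDimensional ℝ E] in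
theorem map_eq_self {g : M → M} {x : OrientationCover I M} (h : g =ᶠ[𝓝 x.pt] id) :
    map I I g x = x := by
  conv_rhs => rw [← map_id x]
  ext1
  · exact h.eq_of_nhds
  · change jacSign _ * _ = jacSign _ * _
    rw [diffAt_congr h]

variable [IsManifold I ∞ M] [IsManifold I₁ ∞ M₁] [IsManifold I₂ ∞ M₂] [IsManifold J ∞ P]

theorem contMDiffWithinAt_map {f : P → M → M₁} {w : P → OrientationCover I M} {t : Set P} {p₀ : P}
    (hf : ContMDiffWithinAt (J.prod I) I₁ ∞ (Function.uncurry f) (t ×ˢ univ) (p₀, (w p₀).pt))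
    (hw : ContMDiffWithinAt J I ∞ w t p₀) (hp₀ : p₀ ∈ t)
    (hd : (diffAt I I₁ (f p₀) (w p₀).pt).det ≠ 0) :
    ContMDiffWithinAt J I₁ ∞ (fun p => map I I₁ (f p) (w p)) t p₀ := by
  have hw' := contMDiffWithinAt_iff.1 hw
  refine contMDiffWithinAt_iff.2 ⟨?_, ?_⟩
  · exact hf.comp (f := fun p => (p, (w p).pt)) p₀ (contMDiffWithinAt_id.prodMk hw'.1)
      fun p hp => ⟨hp, mem_univ _⟩
  · exact hw'.2.jacSign_diffAt (f := f) (hf.of_le (by simp)) (hw'.1.of_le (by simp)) hp₀ hd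

theorem contMDiff_map {g : M → M₁} (hg : ContMDiff I I₁ ∞ g)
    (hd : ∀ p, (diffAt I I₁ g p).det ≠ 0) : ContMDiff I I₁ ∞ (map I I₁ g) := by
  intro x
  rw [← contMDiffWithinAt_univ]
  exact contMDiffWithinAt_map (P := OrientationCover I M) (f := fun _ => g) (w := id)
    (hg.comp contMDiff_snd _).contMDiffWithinAt contMDiffWithinAt_id (mem_univ _) (hd _)

omit [IsManifold I₁ ∞ M₁] [IsManifold I₂ ∞ M₂] [IsManifold J ∞ P] in
theorem contMDiff_ofOrientation {σ : M → ℤˣ} (hσ : IsOrientation I σ) :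
    ContMDiff I I ∞ (ofOrientation I σ) := by
  intro x
  rw [← contMDiffWithinAt_univ]
  refine contMDiffWithinAt_iff.2 ⟨contMDiffWithinAt_id, ?_⟩
  exact hσ.orientsAlong continuousWithinAt_id

theorem diffAt_eq_diffAt_pt {E' : Type*} [NormedAddCommGroup E'] [NormedSpace ℝ E']
    {H' : Type*} [TopologicalSpace H'] {I' : ModelWithCorners ℝ E' H'}
    {M' : Type*} [TopologicalSpace M'] [ChartedSpace H' M'] {w : M' → OrientationCover I M}
    {p : M'} (hw : MDifferentiableAt I' I w p) :
    diffAt I' I w p = diffAt I' I (fun p => (w p).pt) p := by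
  have h1 : MDifferentiableAt I I (pt : OrientationCover I M → M) (w p) :=
    (contMDiff_pt (n := 1) (w p)).mdifferentiableAt one_ne_zero
  have h := diffAt_comp h1 hw
  rw [diffAt_pt, ContinuousLinearMap.id_comp] at h
  exact h.symm

theorem diffAt_comp_pt {E' : Type*} [NormedAddCommGroup E'] [NormedSpace ℝ E']
    {H' : Type*} [TopologicalSpace H'] {I' : ModelWithCorners ℝ E' H'}
    {M' : Type*} [TopologicalSpace M'] [ChartedSpace H' M'] {g : M → M'}
    {x : OrientationCover I M} (hg : MDifferentiableAt I I' g x.pt) :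
    diffAt I I' (fun x : OrientationCover I M => g x.pt) x = diffAt I I' g x.pt := by
  have h1 : MDifferentiableAt I I (pt : OrientationCover I M → M) x :=
    (contMDiff_pt (n := 1) x).mdifferentiableAt one_ne_zero
  have h := diffAt_comp hg h1
  rw [diffAt_pt, ContinuousLinearMap.comp_id] at h
  exact h

theorem eventuallyEq_of_pt {Q : Type*} [TopologicalSpace Q] {v w : Q → OrientationCover I M}
    {q : Q} (hv : ContinuousAt v q) (hw : ContinuousAt w q) (h : v q = w q)
    (hpt : ∀ᶠ p in 𝓝 q, (v p).pt = (w p).pt) : v =ᶠ[𝓝 q] w := by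
  have h1 := hv.eventually (chart_source_mem_nhds H (v q))
  have h2 := hw.eventually (chart_source_mem_nhds H (w q))
  filter_upwards [hpt, h1, h2] with p hp hp1 hp2
  rcases eq_or_eq_flip hp with h3 | h3
  · exact h3
  · exfalso
    have k1 : jacSign (tangentCoordChange I (v p).pt (v q).pt (v p).pt) * (v p).sgn = (v q).sgn :=
      hp1.2
    have k2 : jacSign (tangentCoordChange I (w p).pt (w q).pt (w p).pt) * (w p).sgn = (w q).sgn :=
      hp2.2
    have k3 : (v p).sgn = -(w p).sgn := by rw [h3]; rfl
    rw [k3, hp, h, mul_neg, k2] at k1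
    exact units_ne_neg_self _ k1.symm

end OrientationCover

/-! ### Orientation double coverings and the standard one -/

section DoubleCovering

open OrientationCover

variable {E : Type*} [NormedAddCommGroup E] [NormedSpace ℝ E] [FiniteDimensional ℝ E]
  {H : Type*} [TopologicalSpace H] {I : ModelWithCorners ℝ E H}
  {H' : Type*} [TopologicalSpace H'] {I' : ModelWithCorners ℝ E H'}
  {S : Type*} [TopologicalSpace S] [ChartedSpace H S] [IsManifold I ∞ S]
  {S' : Type*} [TopologicalSpace S'] [ChartedSpace H' S']
  {N : Type*} [TopologicalSpace N] [ChartedSpace H N] [IsManifold I ∞ N]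

omit [IsManifold I ∞ S] in
theorem IsLocalDiffeomorphAt.det_ne_zero {g : S → S'} {s : S}
    (hg : IsLocalDiffeomorphAt I I' ∞ g s) : (diffAt I I' g s).det ≠ 0 :=
  det_ne_zero_of_injective (hg.mfderivToContinuousLinearEquiv (by simp)).injective

/-- The points of the orientation cover corresponding to the points of an orientation double
covering. -/
def toCover (I : ModelWithCorners ℝ E H) (σ : S → ℤˣ) (J : S → N) (s : S) : OrientationCover I N :=
  map I I J (ofOrientation I σ s)

variable {σ : S → ℤˣ} {J : S → N}

omit [FiniteDimensional ℝ E] [IsManifold I ∞ N] in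
theorem bijective_toCover (hJ : IsOrientationDoubleCovering I σ J) :
    Function.Bijective (toCover I σ J) := by
  have hinj : Function.Injective (toCover I σ J) := by
    intro s s' h
    by_contra hne
    have h1 := hJ.reversing s s' hne (congrArg pt h)
    have h2 : jacSign (diffAt I I J s) * σ s = jacSign (diffAt I I J s') * σ s' := congrArg sgn h
    rw [h2] at h1
    exact units_ne_neg_self _ h1
  refine ⟨hinj, fun x => ?_⟩
  obtain ⟨a, b, hab, he⟩ := encard_eq_two.1 (hJ.two_points x.pt)
  have ha : J a = x.pt := by
    have : a ∈ J ⁻¹' {x.pt} := he ▸ mem_insert a {b}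
    exact this
  have hb : J b = x.pt := by
    have : b ∈ J ⁻¹' {x.pt} := he ▸ mem_insert_of_mem a rfl
    exact this
  rcases eq_or_eq_flip (x := toCover I σ J a) (y := x) ha with h | h
  · exact ⟨a, h⟩
  · rcases eq_or_eq_flip (x := toCover I σ J b) (y := x) hb with h' | h'
    · exact ⟨b, h'⟩
    · exact absurd (hinj (h.trans h'.symm)) hab

theorem contMDiff_toCover (hJ : IsOrientationDoubleCovering I σ J) :
    ContMDiff I I ∞ (toCover I σ J) :=
  (contMDiff_map hJ.isLocalDiffeomorph.contMDiff fun s =>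
    (hJ.isLocalDiffeomorph s).det_ne_zero).comp (contMDiff_ofOrientation hJ.isOrientation)

/-- Orientation double coverings are isomorphic to the standard one. -/
def coverDiffeo (hJ : IsOrientationDoubleCovering I σ J) : S ≃ₘ^∞⟮I, I⟯ OrientationCover I N where
  toEquiv := Equiv.ofBijective (toCover I σ J) (bijective_toCover hJ)
  contMDiff_toFun := contMDiff_toCover hJ
  contMDiff_invFun := by
    intro y
    obtain ⟨s, rfl⟩ := (bijective_toCover hJ).2 y
    have hs := hJ.isLocalDiffeomorph s
    have hsmooth : ContMDiffAt I I ∞ (fun z : OrientationCover I N => hs.localInverse z.pt)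
        (toCover I σ J s) :=
      ContMDiffAt.comp (toCover I σ J s) (g := hs.localInverse) hs.localInverse_contMDiffAt
        contMDiff_pt.contMDiffAt
    refine hsmooth.congr_of_eventuallyEq ?_
    have hs0 : hs.localInverse (toCover I σ J s).pt = s :=
      hs.localInverse_left_inv hs.localInverse_mem_target
    have h : (fun z : OrientationCover I N => toCover I σ J (hs.localInverse z.pt))
        =ᶠ[𝓝 (toCover I σ J s)] id := by
      refine eventuallyEq_of_pt ?_ continuousAt_id ?_ ?_
      · exact (contMDiff_toCover hJ).continuous.continuousAt.comp (f := fun z : OrientationCover I N =>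
          hs.localInverse z.pt) hsmooth.continuousAt
      · change toCover I σ J (hs.localInverse (toCover I σ J s).pt) = toCover I σ J s
        rw [hs0]
      · exact (continuous_pt.continuousAt (x := toCover I σ J s)).eventually
          (p := fun q => J (hs.localInverse q) = q) hs.localInverse_eventuallyEq_right
    filter_upwards [h] with z hz
    refine (bijective_toCover hJ).1 ?_
    refine Eq.trans ?_ hz.symm
    exact (Equiv.ofBijective (toCover I σ J) (bijective_toCover hJ)).apply_symm_apply z

theorem coverDiffeo_pt (hJ : IsOrientationDoubleCovering I σ J) (s : S) :
    (coverDiffeo hJ s).pt = J s := rfl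

theorem apply_coverDiffeo_symm (hJ : IsOrientationDoubleCovering I σ J)
    (x : OrientationCover I N) : J ((coverDiffeo hJ).symm x) = x.pt := by
  rw [← coverDiffeo_pt hJ, Diffeomorph.apply_symm_apply]

end DoubleCovering

/-! ### Lifts of diffeomorphisms of surfaces -/

section LiftDiffeo

open OrientationCover

variable {N : Type*} [TopologicalSpace N] [ChartedSpace (EuclideanSpace ℝ (Fin 2)) N]

theorem SelfDiffeo.det_ne_zero (D : SelfDiffeo N) (p : N) :
    (diffAt (𝓡 2) (𝓡 2) D.toMap p).det ≠ 0 :=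
  (Diffeomorph.isLocalDiffeomorph D p).det_ne_zero

theorem SelfDiffeo.mdifferentiableAt (D : SelfDiffeo N) (p : N) :
    MDifferentiableAt (𝓡 2) (𝓡 2) D.toMap p :=
  D.contMDiff.mdifferentiable (by simp) p

theorem SelfDiffeo.ext {D D' : SelfDiffeo N} (h : ∀ p, D.toMap p = D'.toMap p) : D = D' :=
  Diffeomorph.ext h

theorem SelfDiffeo.toMap_inv_toMap (D : SelfDiffeo N) (p : N) : D⁻¹.toMap (D.toMap p) = p :=
  Diffeomorph.symm_apply_apply D p

theorem SelfDiffeo.toMap_toMap_inv (D : SelfDiffeo N) (p : N) : D.toMap (D⁻¹.toMap p) = p :=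
  Diffeomorph.apply_symm_apply D p

theorem SelfDiffeo.injective (D : SelfDiffeo N) : Function.Injective D.toMap :=
  (Diffeomorph.toEquiv D).injective

theorem SelfDiffeo.map_mul (D D' : SelfDiffeo N) (x : OrientationCover (𝓡 2) N) :
    OrientationCover.map (𝓡 2) (𝓡 2) (D * D').toMap x =
      OrientationCover.map (𝓡 2) (𝓡 2) D'.toMap (OrientationCover.map (𝓡 2) (𝓡 2) D.toMap x) :=
  (map_map x (D.mdifferentiableAt _) (D'.mdifferentiableAt _) (D.det_ne_zero _)
    (D'.det_ne_zero _)).symm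

theorem SelfDiffeo.map_inv_map (D : SelfDiffeo N) (x : OrientationCover (𝓡 2) N) :
    OrientationCover.map (𝓡 2) (𝓡 2) D⁻¹.toMap (OrientationCover.map (𝓡 2) (𝓡 2) D.toMap x) = x := by
  rw [← SelfDiffeo.map_mul, mul_inv_cancel]
  exact map_id x

theorem SelfDiffeo.map_map_inv (D : SelfDiffeo N) (x : OrientationCover (𝓡 2) N) :
    OrientationCover.map (𝓡 2) (𝓡 2) D.toMap (OrientationCover.map (𝓡 2) (𝓡 2) D⁻¹.toMap x) = x := by
  rw [← SelfDiffeo.map_mul, inv_mul_cancel]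
  exact map_id x

variable [IsManifold (𝓡 2) ∞ N]
  {S : Type*} [TopologicalSpace S] [ChartedSpace (EuclideanSpace ℝ (Fin 2)) S]
  [IsManifold (𝓡 2) ∞ S] {σ : S → ℤˣ} {J : S → N} (hJ : IsOrientationDoubleCovering (𝓡 2) σ J)

/-- The orientation preserving lifts of the diffeomorphisms of `N`. -/
def liftDiffeo : SelfDiffeo N →* SelfDiffeo S where
  toFun D :=
    { toFun := fun s => (coverDiffeo hJ).symm
        (OrientationCover.map (𝓡 2) (𝓡 2) D.toMap (coverDiffeo hJ s))
      invFun := fun s => (coverDiffeo hJ).symm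
        (OrientationCover.map (𝓡 2) (𝓡 2) D⁻¹.toMap (coverDiffeo hJ s))
      left_inv := fun s => by
        simp only [Diffeomorph.apply_symm_apply, SelfDiffeo.map_inv_map, Diffeomorph.symm_apply_apply]
      right_inv := fun s => by
        simp only [Diffeomorph.apply_symm_apply, SelfDiffeo.map_map_inv, Diffeomorph.symm_apply_apply]
      contMDiff_toFun := (coverDiffeo hJ).symm.contMDiff.comp
        ((contMDiff_map D.contMDiff D.det_ne_zero).comp (coverDiffeo hJ).contMDiff)
      contMDiff_invFun := (coverDiffeo hJ).symm.contMDiff.comp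
        ((contMDiff_map D⁻¹.contMDiff D⁻¹.det_ne_zero).comp (coverDiffeo hJ).contMDiff) }
  map_one' := SelfDiffeo.ext fun s => by
    change (coverDiffeo hJ).symm (OrientationCover.map (𝓡 2) (𝓡 2) id (coverDiffeo hJ s)) = s
    rw [map_id, Diffeomorph.symm_apply_apply]
  map_mul' D D' := SelfDiffeo.ext fun s => by
    change (coverDiffeo hJ).symm (OrientationCover.map (𝓡 2) (𝓡 2) (D * D').toMap (coverDiffeo hJ s)) =
      (coverDiffeo hJ).symm (OrientationCover.map (𝓡 2) (𝓡 2) D'.toMap (coverDiffeo hJ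
        ((coverDiffeo hJ).symm (OrientationCover.map (𝓡 2) (𝓡 2) D.toMap (coverDiffeo hJ s)))))
    rw [Diffeomorph.apply_symm_apply, SelfDiffeo.map_mul]

theorem coverDiffeo_liftDiffeo (D : SelfDiffeo N) (s : S) :
    coverDiffeo hJ ((liftDiffeo hJ D).toMap s) =
      OrientationCover.map (𝓡 2) (𝓡 2) D.toMap (coverDiffeo hJ s) :=
  Diffeomorph.apply_symm_apply _ _

theorem apply_liftDiffeo (D : SelfDiffeo N) (s : S) :
    J ((liftDiffeo hJ D).toMap s) = D.toMap (J s) :=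
  congrArg pt (coverDiffeo_liftDiffeo hJ D s)

theorem isSmoothFamily_liftDiffeo {F : ℝ → SelfDiffeo N} (hF : IsSmoothFamily F) :
    IsSmoothFamily fun t => liftDiffeo hJ (F t) := by
  have key : ∀ G : ℝ → SelfDiffeo N,
      ContMDiff (𝓘(ℝ, ℝ).prod (𝓡 2)) (𝓡 2) ∞ (fun q : ℝ × N => (G q.1).toMap q.2) →
      ContMDiff (𝓘(ℝ, ℝ).prod (𝓡 2)) (𝓡 2) ∞ (fun q : ℝ × S => (liftDiffeo hJ (G q.1)).toMap q.2) := by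
    intro G hG
    refine (coverDiffeo hJ).symm.contMDiff.comp (g := (coverDiffeo hJ).symm) (f := fun q : ℝ × S =>
      OrientationCover.map (𝓡 2) (𝓡 2) (G q.1).toMap (coverDiffeo hJ q.2)) ?_
    intro q
    rw [← contMDiffWithinAt_univ]
    refine contMDiffWithinAt_map (P := ℝ × S) (f := fun q => (G q.1).toMap)
      (w := fun q => coverDiffeo hJ q.2) ?_ ?_ (mem_univ _) ((G q.1).det_ne_zero _)
    · have : ContMDiff ((𝓘(ℝ, ℝ).prod (𝓡 2)).prod (𝓡 2)) (𝓡 2) ∞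
          (fun r : (ℝ × S) × N => (G r.1.1).toMap r.2) :=
        hG.comp (f := fun r : (ℝ × S) × N => (r.1.1, r.2))
          ((contMDiff_fst.comp contMDiff_fst).prodMk contMDiff_snd)
      exact this.contMDiffAt.contMDiffWithinAt
    · exact ((coverDiffeo hJ).contMDiff.comp contMDiff_snd).contMDiffAt.contMDiffWithinAt
  refine ⟨key F hF.1, ?_⟩
  have := key (fun t => (F t)⁻¹) hF.2
  simpa only [map_inv] using this

theorem liftDiffeo_mem_isotopicToId {D : SelfDiffeo N} (hD : D ∈ isotopicToId N) :
    liftDiffeo hJ D ∈ isotopicToId S := by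
  obtain ⟨F, hF, hF0, hF1⟩ := hD
  exact ⟨_, isSmoothFamily_liftDiffeo hJ hF, by simp [hF0], by simp [hF1]⟩

/-- The lift of mapping classes. -/
def liftClass : MappingClasses N →* MappingClasses S :=
  QuotientGroup.map (isotopicToId N) (isotopicToId S) (liftDiffeo hJ)
    fun _ hD => liftDiffeo_mem_isotopicToId hJ hD

theorem liftClass_mk (D : SelfDiffeo N) :
    liftClass hJ (QuotientGroup.mk D) = QuotientGroup.mk (liftDiffeo hJ D) := rfl

end LiftDiffeo

/-! ### Lifts of parametrizations of fibres -/

section LiftFiber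

open OrientationCover

variable {X : Type*} [TopologicalSpace X] [ChartedSpace (EuclideanHalfSpace 4) X]
  {B : Type*} [TopologicalSpace B] [ChartedSpace (EuclideanHalfSpace 2) B]
  {N : Type*} [TopologicalSpace N] [ChartedSpace (EuclideanSpace ℝ (Fin 2)) N]

theorem surjective_diffAt {f : X → B} {x : X} (hx : f x ∉ criticalValues f) :
    Function.Surjective (diffAt (𝓡∂ 4) (𝓡∂ 2) f x) := by
  by_contra h
  exact hx ⟨x, h, rfl⟩

theorem IsFiberParam.diffAt_comp_eq_zero {f : X → B} {b : B} {j : N → X} (hj : IsFiberParam f b j)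
    (hf : ContMDiff (𝓡∂ 4) (𝓡∂ 2) ∞ f) (p : N) :
    (diffAt (𝓡∂ 4) (𝓡∂ 2) f (j p)).comp (diffAt (𝓡 2) (𝓡∂ 4) j p) = 0 := by
  rw [← diffAt_comp (hf.mdifferentiable (by simp) _) (hj.smooth.mdifferentiable (by simp) _)]
  have : f ∘ j = fun _ => b := by
    ext q
    have : j q ∈ f ⁻¹' {b} := hj.range_eq ▸ mem_range_self q
    exact this
  rw [this]
  exact mfderiv_const

theorem exists_apply_eq_of_apply_eq_zero
    {b : EuclideanSpace ℝ (Fin 4) →L[ℝ] EuclideanSpace ℝ (Fin 2)}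
    {a : EuclideanSpace ℝ (Fin 2) →L[ℝ] EuclideanSpace ℝ (Fin 4)}
    (ha : Function.Injective a) (hb : Function.Surjective b) (hba : b.comp a = 0)
    (v : EuclideanSpace ℝ (Fin 4)) (hv : b v = 0) : ∃ w, a w = v := by
  have hle : LinearMap.range (a : EuclideanSpace ℝ (Fin 2) →ₗ[ℝ] EuclideanSpace ℝ (Fin 4)) ≤
      LinearMap.ker (b : EuclideanSpace ℝ (Fin 4) →ₗ[ℝ] EuclideanSpace ℝ (Fin 2)) := by
    rintro _ ⟨w, rfl⟩
    exact congrArg (fun T => T w) hba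
  have h1 := LinearMap.finrank_range_of_inj
    (f := (a : EuclideanSpace ℝ (Fin 2) →ₗ[ℝ] EuclideanSpace ℝ (Fin 4))) ha
  have h2 := LinearMap.finrank_range_add_finrank_ker
    (b : EuclideanSpace ℝ (Fin 4) →ₗ[ℝ] EuclideanSpace ℝ (Fin 2))
  rw [LinearMap.range_eq_top.2 hb, finrank_top] at h2
  simp only [finrank_euclideanSpace, Fintype.card_fin] at h1 h2
  have h3 := Submodule.eq_of_le_of_finrank_eq hle (by omega)
  have : v ∈ LinearMap.ker (b : EuclideanSpace ℝ (Fin 4) →ₗ[ℝ] EuclideanSpace ℝ (Fin 2)) := hv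
  rw [← h3] at this
  exact this

variable (σB : B → ℤˣ) (f : X → B)

/-- The sign comparing the orientation of the fibre at a point with that of the total space. -/
def totalSign (j : N → X) (p : N) : ℤˣ :=
  fiberSign (diffAt (𝓡∂ 4) (𝓡∂ 2) f (j p)) (diffAt (𝓡 2) (𝓡∂ 4) j p) * σB (f (j p))

/-- The lift of a parametrization of a fibre to the orientation covers. -/
def liftFiber (j : N → X) (x : OrientationCover (𝓡 2) N) : OrientationCover (𝓡∂ 4) X :=
  ⟨j x.pt, totalSign σB f j x.pt * x.sgn⟩

variable {σB f}

omit [TopologicalSpace B] [ChartedSpace (EuclideanHalfSpace 2) B] in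
theorem IsFiberParam.apply_eq {b : B} {j : N → X} (hj : IsFiberParam f b j) (p : N) :
    f (j p) = b := by
  have : j p ∈ f ⁻¹' {b} := hj.range_eq ▸ mem_range_self p
  exact this

theorem IsFiberParam.fiberCompatible {b : B} {j : N → X} (hj : IsFiberParam f b j)
    (hf : ContMDiff (𝓡∂ 4) (𝓡∂ 2) ∞ f) (hb : b ∉ criticalValues f) (p : N) (s : ℤˣ) :
    FiberCompatible (diffAt (𝓡∂ 4) (𝓡∂ 2) f (j p)) (diffAt (𝓡 2) (𝓡∂ 4) j p) (σB (f (j p))) s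
      (totalSign σB f j p * s) := by
  have h1 : Function.Surjective (diffAt (𝓡∂ 4) (𝓡∂ 2) f (j p)) :=
    surjective_diffAt (by rwa [hj.apply_eq])
  rw [totalSign, mul_assoc]
  exact fiberCompatible_fiberSign (hj.immersion p) h1 (hj.diffAt_comp_eq_zero hf p)
    (exists_apply_eq_of_apply_eq_zero (hj.immersion p) h1 (hj.diffAt_comp_eq_zero hf p)) _ _

variable [IsManifold (𝓡∂ 4) ∞ X] [IsManifold (𝓡∂ 2) ∞ B] [IsManifold (𝓡 2) ∞ N]

theorem OrientsAlong.fiberCompatible {F : Type*} [NormedAddCommGroup F] [NormedSpace ℝ F]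
    {G : Type*} [TopologicalSpace G] {J : ModelWithCorners ℝ F G} {P : Type*} [TopologicalSpace P]
    [ChartedSpace G P] [IsManifold J ∞ P] (hσB : IsOrientation (𝓡∂ 2) σB)
    (hf : ContMDiff (𝓡∂ 4) (𝓡∂ 2) ∞ f) {j : P → N → X} {u : P → N} {t : Set P} {p₀ : P}
    (hj : ContMDiffWithinAt (J.prod (𝓡 2)) (𝓡∂ 4) ∞ (Function.uncurry j) (t ×ˢ univ) (p₀, u p₀))
    (hu : ContMDiffWithinAt J (𝓡 2) ∞ u t p₀) (hp₀ : p₀ ∈ t) {e e' : P → ℤˣ}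
    (he : OrientsAlong (𝓡 2) u e t p₀)
    (hc : ∀ p ∈ t, FiberCompatible (diffAt (𝓡∂ 4) (𝓡∂ 2) f (j p (u p)))
      (diffAt (𝓡 2) (𝓡∂ 4) (j p) (u p)) (σB (f (j p (u p)))) (e p) (e' p))
    (hs : Function.Surjective (diffAt (𝓡∂ 4) (𝓡∂ 2) f (j p₀ (u p₀)))) :
    OrientsAlong (𝓡∂ 4) (fun p => j p (u p)) e' t p₀ := by
  have hv : ContMDiffWithinAt J (𝓡∂ 4) ∞ (fun p => j p (u p)) t p₀ :=
    hj.comp (f := fun p => (p, u p)) p₀ (contMDiffWithinAt_id.prodMk hu)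
      fun p hp => ⟨hp, mem_univ _⟩
  have hff : ContMDiff (J.prod (𝓡∂ 4)) (𝓡∂ 2) ∞ (Function.uncurry fun _ : P => f) :=
    hf.comp contMDiff_snd
  have ca := continuousWithinAt_coordDiff (hj.of_le (m := 1) (by simp)) (hu.of_le (by simp)) hp₀
  have cb := continuousWithinAt_coordDiff (f := fun _ : P => f) (u := fun p => j p (u p))
    (t := t) (p₀ := p₀) ((hff _).contMDiffWithinAt.of_le (m := 1) (by simp)) (hv.of_le (by simp)) hp₀
  have ea := coordDiff_self (I := 𝓡 2) (I' := 𝓡∂ 4) j u p₀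
  have eb := coordDiff_self (I := 𝓡∂ 4) (I' := 𝓡∂ 2) (fun _ : P => f) (fun p => j p (u p)) p₀
  set a := coordDiff (𝓡 2) (𝓡∂ 4) j u p₀ with ha
  set b := coordDiff (𝓡∂ 4) (𝓡∂ 2) (fun _ : P => f) (fun p => j p (u p)) p₀ with hb
  obtain ⟨v, w, hvw⟩ := exists_stdDet_ne_zero hs
  have hcp := hc p₀ hp₀
  rw [← eb] at hvw hcp
  rw [← ea] at hcp
  have hd₀ : signReal (σB (f (j p₀ (u p₀)))) * stdDet 2 ![b p₀ v, b p₀ w] ≠ 0 :=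
    mul_ne_zero (by simp [signReal]) hvw
  have h₀ := hcp v w hd₀
  have hstd : ∀ (n : ℕ), Continuous (stdDet n) := fun n =>
    Continuous.congr (f := fun v : Fin n → EuclideanSpace ℝ (Fin n) =>
      Matrix.det (Matrix.of fun i k => v k i)) (by
        refine Continuous.matrix_det ?_
        refine continuous_matrix fun i k => ?_
        exact (EuclideanSpace.proj (𝕜 := ℝ) i).continuous.comp (continuous_apply k))
      fun v => (stdDet_eq n v).symm
  have c2 : ContinuousWithinAt (fun p => stdDet 2 ![b p v, b p w]) t p₀ := by
    refine (hstd 2).continuousAt.comp_continuousWithinAt (f := fun p => ![b p v, b p w])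
      (continuousWithinAt_pi.2 fun i => ?_)
    fin_cases i
    · exact cb.clm_apply continuousWithinAt_const
    · exact cb.clm_apply continuousWithinAt_const
  have c4 : ContinuousWithinAt (fun p => stdDet 4 ![v, w, a p (stdVec 2 0), a p (stdVec 2 1)])
      t p₀ := by
    refine (hstd 4).continuousAt.comp_continuousWithinAt
      (f := fun p => ![v, w, a p (stdVec 2 0), a p (stdVec 2 1)]) (continuousWithinAt_pi.2 fun i => ?_)
    fin_cases i
    · exact continuousWithinAt_const
    · exact continuousWithinAt_const
    · exact ca.clm_apply continuousWithinAt_const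
    · exact ca.clm_apply continuousWithinAt_const
  have c : ContinuousWithinAt (fun p => signReal (σB (f (j p₀ (u p₀)))) * stdDet 2 ![b p v, b p w] *
      signReal (e p₀) * (signReal (e' p₀) * stdDet 4 ![v, w, a p (stdVec 2 0), a p (stdVec 2 1)]))
      t p₀ :=
    ((continuousWithinAt_const.mul c2).mul continuousWithinAt_const).mul
      (continuousWithinAt_const.mul c4)
  have hcontf : ContinuousWithinAt (fun p => f (j p (u p))) t p₀ :=
    hf.continuous.continuousAt.comp_continuousWithinAt hv.continuousWithinAt
  filter_upwards [c.tendsto.eventually (eventually_gt_nhds h₀), he, hσB.orientsAlong hcontf,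
    self_mem_nhdsWithin,
    hu.continuousWithinAt.tendsto.eventually (chart_source_mem_nhds (EuclideanSpace ℝ (Fin 2)) (u p₀)),
    hv.continuousWithinAt.tendsto.eventually (chart_source_mem_nhds (EuclideanHalfSpace 4) (j p₀ (u p₀))),
    hcontf.tendsto.eventually (chart_source_mem_nhds (EuclideanHalfSpace 2) (f (j p₀ (u p₀))))]
    with p hp1 hp2 hp3 hp4 hp5 hp6 hp7
  have hL : (tangentCoordChange (𝓡∂ 4) (j p (u p)) (j p₀ (u p₀)) (j p (u p))).comp
      (tangentCoordChange (𝓡∂ 4) (j p₀ (u p₀)) (j p (u p)) (j p (u p))) =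
      ContinuousLinearMap.id ℝ _ := by
    ext1 v
    rw [ContinuousLinearMap.comp_apply, tangentCoordChange_comp, tangentCoordChange_self]
    · rfl
    · rwa [extChartAt_source]
    · simp only [extChartAt_source]
      exact ⟨⟨hp6, mem_chart_source _ _⟩, hp6⟩
  have ht := (hc p hp4).transform
    (B := tangentCoordChange (𝓡∂ 2) (f (j p (u p))) (f (j p₀ (u p₀))) (f (j p (u p))))
    (A := tangentCoordChange (𝓡 2) (u p₀) (u p) (u p))
    (OrientationCover.det_ne_zero _ (mem_chart_source _ _) hp7)
    (OrientationCover.det_ne_zero _ hp5 (mem_chart_source _ _)) hL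
  have hp3' : jacSign (tangentCoordChange (𝓡∂ 2) (f (j p (u p))) (f (j p₀ (u p₀))) (f (j p (u p)))) *
      σB (f (j p (u p))) = σB (f (j p₀ (u p₀))) := hp3
  rw [hp3', jacSign_tangentCoordChange_symm hp5 (mem_chart_source _ _), hp2] at ht
  have hp1' := hp1
  have hne : signReal (σB (f (j p₀ (u p₀)))) * stdDet 2 ![b p v, b p w] ≠ 0 := by
    intro h0
    rw [h0] at hp1
    simp at hp1
  have h1 := ht v w hne
  change 0 < signReal (σB (f (j p₀ (u p₀)))) * stdDet 2 ![b p v, b p w] *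
      signReal (e p₀) * (signReal _ * stdDet 4 ![v, w, a p (stdVec 2 0), a p (stdVec 2 1)]) at h1
  rw [mul_left_comm] at h1 hp1'
  exact eq_of_signReal_mul_pos h1 hp1'

theorem contMDiffWithinAt_liftFiber {F : Type*} [NormedAddCommGroup F] [NormedSpace ℝ F]
    {G : Type*} [TopologicalSpace G] {J : ModelWithCorners ℝ F G} {P : Type*} [TopologicalSpace P]
    [ChartedSpace G P] [IsManifold J ∞ P] (hσB : IsOrientation (𝓡∂ 2) σB)
    (hf : ContMDiff (𝓡∂ 4) (𝓡∂ 2) ∞ f) {j : P → N → X} {w : P → OrientationCover (𝓡 2) N}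
    {t : Set P} {p₀ : P} {b : P → B}
    (hj : ContMDiffWithinAt (J.prod (𝓡 2)) (𝓡∂ 4) ∞ (Function.uncurry j) (t ×ˢ univ) (p₀, (w p₀).pt))
    (hw : ContMDiffWithinAt J (𝓡 2) ∞ w t p₀) (hp₀ : p₀ ∈ t)
    (hfib : ∀ p ∈ t, IsFiberParam f (b p) (j p)) (hb : ∀ p ∈ t, b p ∉ criticalValues f) :
    ContMDiffWithinAt J (𝓡∂ 4) ∞ (fun p => liftFiber σB f (j p) (w p)) t p₀ := by
  have hw' := OrientationCover.contMDiffWithinAt_iff.1 hw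
  refine OrientationCover.contMDiffWithinAt_iff.2 ⟨?_, ?_⟩
  · exact hj.comp (f := fun p => (p, (w p).pt)) p₀ (contMDiffWithinAt_id.prodMk hw'.1)
      fun p hp => ⟨hp, mem_univ _⟩
  · refine OrientsAlong.fiberCompatible hσB hf hj hw'.1 hp₀ hw'.2 ?_ ?_
    · intro p hp
      exact (hfib p hp).fiberCompatible hf (hb p hp) _ _
    · exact surjective_diffAt (by rw [(hfib p₀ hp₀).apply_eq]; exact hb p₀ hp₀)

theorem contMDiff_liftFiber (hσB : IsOrientation (𝓡∂ 2) σB) (hf : ContMDiff (𝓡∂ 4) (𝓡∂ 2) ∞ f)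
    {j : N → X} {b : B} (hj : IsFiberParam f b j) (hb : b ∉ criticalValues f) :
    ContMDiff (𝓡 2) (𝓡∂ 4) ∞ (liftFiber σB f j) := by
  intro x
  rw [← contMDiffWithinAt_univ]
  exact contMDiffWithinAt_liftFiber (P := OrientationCover (𝓡 2) N) (j := fun _ => j) (w := id)
    (b := fun _ => b) hσB hf (hj.smooth.comp contMDiff_snd _).contMDiffWithinAt
    contMDiffWithinAt_id (mem_univ _) (fun _ _ => hj) fun _ _ => hb

theorem diffAt_liftFiber (hσB : IsOrientation (𝓡∂ 2) σB) (hf : ContMDiff (𝓡∂ 4) (𝓡∂ 2) ∞ f)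
    {j : N → X} {b : B} (hj : IsFiberParam f b j) (hb : b ∉ criticalValues f)
    (x : OrientationCover (𝓡 2) N) :
    diffAt (𝓡 2) (𝓡∂ 4) (liftFiber σB f j) x = diffAt (𝓡 2) (𝓡∂ 4) j x.pt := by
  rw [diffAt_eq_diffAt_pt ((contMDiff_liftFiber hσB hf hj hb).mdifferentiable (by simp) x)]
  exact diffAt_comp_pt (hj.smooth.mdifferentiable (by simp) _)

theorem isFiberParam_liftFiber (hσB : IsOrientation (𝓡∂ 2) σB) (hf : ContMDiff (𝓡∂ 4) (𝓡∂ 2) ∞ f)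
    {j : N → X} {b : B} (hj : IsFiberParam f b j) (hb : b ∉ criticalValues f) :
    IsFiberParam (fun x : OrientationCover (𝓡∂ 4) X => f x.pt) b (liftFiber σB f j) where
  smooth := contMDiff_liftFiber hσB hf hj hb
  injective x y h := by
    have h1 : x.pt = y.pt := hj.injective (congrArg pt h)
    have h2 : totalSign σB f j x.pt * x.sgn = totalSign σB f j y.pt * y.sgn := congrArg sgn h
    rw [h1] at h2
    exact OrientationCover.ext h1 (mul_left_cancel h2)
  immersion x := by
    rw [diffAt_liftFiber hσB hf hj hb]
    exact hj.immersion _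
  range_eq := by
    ext y
    constructor
    · rintro ⟨x, rfl⟩
      exact hj.apply_eq _
    · intro hy
      have : y.pt ∈ range j := hj.range_eq ▸ hy
      obtain ⟨n, hn⟩ := this
      refine ⟨⟨n, totalSign σB f j n * y.sgn⟩, OrientationCover.ext hn ?_⟩
      change totalSign σB f j n * (totalSign σB f j n * y.sgn) = y.sgn
      rw [← mul_assoc, Int.units_mul_self, one_mul]

variable {S : Type*} [TopologicalSpace S] [ChartedSpace (EuclideanSpace ℝ (Fin 2)) S]
  [IsManifold (𝓡 2) ∞ S] {σS : S → ℤˣ} {J : S → N} (hJ : IsOrientationDoubleCovering (𝓡 2) σS J)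

omit [TopologicalSpace B] [ChartedSpace (EuclideanHalfSpace 2) B] [IsManifold (𝓡∂ 2) ∞ B]
  [IsManifold (𝓡 2) ∞ S] in
theorem IsFiberParam.comp_diffeo {X' : Type*} [TopologicalSpace X']
    [ChartedSpace (EuclideanHalfSpace 4) X'] {f' : X' → B}
    {N' : Type*} [TopologicalSpace N'] [ChartedSpace (EuclideanSpace ℝ (Fin 2)) N']
    {b : B} {j : N' → X'} (hj : IsFiberParam f' b j) (K : S ≃ₘ^∞⟮𝓡 2, 𝓡 2⟯ N') :
    IsFiberParam f' b (fun s => j (K s)) where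
  smooth := hj.smooth.comp K.contMDiff
  injective := hj.injective.comp K.injective
  immersion s := by
    have h : diffAt (𝓡 2) (𝓡∂ 4) (j ∘ K) s = _ :=
      diffAt_comp (hj.smooth.mdifferentiable (by simp) _) (K.mdifferentiable (by simp) _)
    change Function.Injective (diffAt (𝓡 2) (𝓡∂ 4) (j ∘ K) s)
    rw [h]
    exact (hj.immersion _).comp
      (injective_of_det_ne_zero (K.isLocalDiffeomorph s).det_ne_zero)
  range_eq := by
    rw [← hj.range_eq]
    exact K.surjective.range_comp j

variable (σB f) in
/-- The lift of a parametrization of a fibre by `N` to one by its orientation double covering. -/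
def liftParam (j : N → X) (s : S) : OrientationCover (𝓡∂ 4) X :=
  liftFiber σB f j (coverDiffeo hJ s)

theorem isFiberParam_liftParam (hσB : IsOrientation (𝓡∂ 2) σB) (hf : ContMDiff (𝓡∂ 4) (𝓡∂ 2) ∞ f)
    {j : N → X} {b : B} (hj : IsFiberParam f b j) (hb : b ∉ criticalValues f) :
    IsFiberParam (fun x : OrientationCover (𝓡∂ 4) X => f x.pt) b (liftParam σB f hJ j) :=
  (isFiberParam_liftFiber hσB hf hj hb).comp_diffeo (coverDiffeo hJ)

theorem isOrientedFiberParam_liftParam (hσB : IsOrientation (𝓡∂ 2) σB)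
    (hf : ContMDiff (𝓡∂ 4) (𝓡∂ 2) ∞ f) {j : N → X} {b : B} (hj : IsFiberParam f b j)
    (hb : b ∉ criticalValues f) :
    IsOrientedFiberParam (OrientationCover.sgn : OrientationCover (𝓡∂ 4) X → ℤˣ) σB σS
      (fun x : OrientationCover (𝓡∂ 4) X => f x.pt) (liftParam σB f hJ j) := by
  intro s
  have e1 : diffAt (𝓡∂ 4) (𝓡∂ 2) (fun x : OrientationCover (𝓡∂ 4) X => f x.pt)
      (liftParam σB f hJ j s) = diffAt (𝓡∂ 4) (𝓡∂ 2) f (j (J s)) :=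
    diffAt_comp_pt (hf.mdifferentiable (by simp) _)
  have hlp := (isFiberParam_liftParam hJ hσB hf hj hb).smooth
  have hJs := hJ.isLocalDiffeomorph s
  have e2 : diffAt (𝓡 2) (𝓡∂ 4) (liftParam σB f hJ j) s =
      (diffAt (𝓡 2) (𝓡∂ 4) j (J s)).comp (diffAt (𝓡 2) (𝓡 2) J s) := by
    rw [diffAt_eq_diffAt_pt (hlp.mdifferentiable (by simp) s)]
    exact diffAt_comp (hj.smooth.mdifferentiable (by simp) _) (hJs.mdifferentiableAt (by simp))
  have h := (hj.fiberCompatible (σB := σB) hf hb (J s) (jacSign (diffAt (𝓡 2) (𝓡 2) J s) * σS s))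
  have h2 := h.transform (B := ContinuousLinearMap.id ℝ _) (L := ContinuousLinearMap.id ℝ _)
    (L' := ContinuousLinearMap.id ℝ _) (A := diffAt (𝓡 2) (𝓡 2) J s)
    (by simp [ContinuousLinearMap.det]) hJs.det_ne_zero (by simp)
  rw [jacSign_id, jacSign_id, one_mul, one_mul, ContinuousLinearMap.comp_id,
    ContinuousLinearMap.id_comp, ContinuousLinearMap.id_comp, ← mul_assoc (jacSign _),
    Int.units_mul_self, one_mul] at h2
  rw [e1, e2]
  exact h2

include hJ in
theorem hasRegularFiber_cover (hσB : IsOrientation (𝓡∂ 2) σB) (hf : ContMDiff (𝓡∂ 4) (𝓡∂ 2) ∞ f)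
    (hfib : HasRegularFiber N f)
    (hcrit : criticalValues (fun x : OrientationCover (𝓡∂ 4) X => f x.pt) = criticalValues f) :
    HasRegularFiber S (fun x : OrientationCover (𝓡∂ 4) X => f x.pt) := by
  intro b hb
  rw [hcrit] at hb
  obtain ⟨j, hj⟩ := hfib b hb
  exact ⟨_, isFiberParam_liftParam (σB := σB) hJ hσB hf hj hb⟩

variable (σB f) in
/-- The lift of a trivialization. -/
def liftTrivialization (Φ : ℝ × N → X) (q : ℝ × S) : OrientationCover (𝓡∂ 4) X :=
  liftParam σB f hJ (fun p => Φ (q.1, p)) q.2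

theorem IsTrivializationAlong.lift (hσB : IsOrientation (𝓡∂ 2) σB)
    (hf : ContMDiff (𝓡∂ 4) (𝓡∂ 2) ∞ f) {a : ℝ → B} {r : ℝ} {Φ : ℝ × N → X}
    (hΦ : IsTrivializationAlong f a r Φ) (ha : ∀ t ∈ Icc 0 r, a t ∉ criticalValues f) :
    IsTrivializationAlong (fun x : OrientationCover (𝓡∂ 4) X => f x.pt) a r
      (liftTrivialization σB f hJ Φ) where
  smooth := by
    rintro ⟨t, s⟩ ⟨ht, -⟩
    refine contMDiffWithinAt_liftFiber (P := ℝ × S) (j := fun q p => Φ (q.1, p))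
      (w := fun q => coverDiffeo hJ q.2) (b := fun q => a q.1) hσB hf ?_ ?_ ⟨ht, mem_univ _⟩
      (fun q hq => hΦ.fiber _ hq.1) fun q hq => ha _ hq.1
    · refine ContMDiffWithinAt.comp (t := Icc 0 r ×ˢ univ) (g := Φ)
        (f := fun q : (ℝ × S) × N => (q.1.1, q.2)) _ (hΦ.smooth _ ⟨ht, mem_univ _⟩) ?_ ?_
      · exact ((contMDiff_fst.comp contMDiff_fst).prodMk contMDiff_snd).contMDiffAt.contMDiffWithinAt
      · rintro q ⟨hq, -⟩
        exact ⟨hq.1, mem_univ _⟩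
    · exact ((coverDiffeo hJ).contMDiff.comp contMDiff_snd).contMDiffAt.contMDiffWithinAt
  fiber t ht := isFiberParam_liftParam hJ hσB hf (hΦ.fiber t ht) (ha t ht)

omit [IsManifold (𝓡∂ 4) ∞ X] [IsManifold (𝓡∂ 2) ∞ B] [IsManifold (𝓡 2) ∞ N] in
theorem liftFiber_comp_diffeo (hf : ContMDiff (𝓡∂ 4) (𝓡∂ 2) ∞ f) {j : N → X} {b : B}
    (hj : IsFiberParam f b j) (hb : b ∉ criticalValues f) (D : SelfDiffeo N)
    (x : OrientationCover (𝓡 2) N) :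
    liftFiber σB f (fun p => j (D.toMap p)) x =
      liftFiber σB f j (OrientationCover.map (𝓡 2) (𝓡 2) D.toMap x) := by
  have hjD : IsFiberParam f b (fun p => j (D.toMap p)) := hj.comp_diffeo (X' := X) D
  refine OrientationCover.ext rfl ?_
  have h1 := hjD.fiberCompatible (σB := σB) hf hb x.pt x.sgn
  have h2 := hj.fiberCompatible (σB := σB) hf hb (D.toMap x.pt)
    (OrientationCover.map (𝓡 2) (𝓡 2) D.toMap x).sgn
  have h3 := h2.transform (B := ContinuousLinearMap.id ℝ _) (L := ContinuousLinearMap.id ℝ _)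
    (L' := ContinuousLinearMap.id ℝ _) (A := diffAt (𝓡 2) (𝓡 2) D.toMap x.pt)
    (by simp [ContinuousLinearMap.det]) (D.det_ne_zero _) (by simp)
  have e : diffAt (𝓡 2) (𝓡∂ 4) (fun p => j (D.toMap p)) x.pt = _ :=
    diffAt_comp (hj.smooth.mdifferentiable (by simp) _) (D.mdifferentiableAt _)
  have e2 : jacSign (diffAt (𝓡 2) (𝓡 2) D.toMap x.pt) *
      (OrientationCover.map (𝓡 2) (𝓡 2) D.toMap x).sgn = x.sgn := by
    change _ * (_ * _) = _
    rw [← mul_assoc, Int.units_mul_self, one_mul]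
  rw [jacSign_id, jacSign_id, one_mul, one_mul, ContinuousLinearMap.comp_id,
    ContinuousLinearMap.id_comp, ContinuousLinearMap.id_comp, e2, ← e] at h3
  exact h1.unique (surjective_diffAt (by rw [hj.apply_eq]; exact hb)) h3

end LiftFiber

/-! ### The Lefschetz fibration on the orientation cover -/

section Sheets

open OrientationCover

theorem isOrientation_const {E : Type*} [NormedAddCommGroup E] [NormedSpace ℝ E] (s : ℤˣ) :
    IsOrientation 𝓘(ℝ, E) (fun _ : E => s) := by
  intro x₀
  refine Filter.Eventually.of_forall fun x => ?_
  have : tangentCoordChange 𝓘(ℝ, E) x x₀ x = ContinuousLinearMap.id ℝ E := by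
    rw [tangentCoordChange_def]
    simp only [mfld_simps]
    exact fderivWithin_id uniqueDiffWithinAt_univ
  rw [this, jacSign_id, one_mul]

variable {X : Type*} [TopologicalSpace X] [ChartedSpace (EuclideanHalfSpace 4) X]
  {B : Type*} [TopologicalSpace B] [ChartedSpace (EuclideanHalfSpace 2) B]

/-- An identification of `ℂ²` with `ℝ⁴`. -/
def complexTwoEquiv : (ℂ × ℂ) ≃L[ℝ] EuclideanSpace ℝ (Fin 4) :=
  ContinuousLinearEquiv.ofFinrankEq (by simp [Complex.finrank_real_complex])

variable (φ : PartialDiffeomorph (𝓡∂ 4) 𝓘(ℝ, ℂ × ℂ) X (ℂ × ℂ) ∞)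

theorem PartialDiffeomorph.mdifferentiableAt_toFun {x : X} (hx : x ∈ φ.source) :
    MDifferentiableAt (𝓡∂ 4) 𝓘(ℝ, ℂ × ℂ) φ.toFun x :=
  φ.mdifferentiableAt (by simp) hx

/-- The inverse of a complex chart, as a parametrization by an open subset of `ℝ⁴`. -/
def chartParam (v : EuclideanSpace ℝ (Fin 4)) : X := φ.invFun (complexTwoEquiv.symm v)

theorem contMDiffAt_chartParam {m : ℂ × ℂ} (hm : m ∈ φ.target) :
    ContMDiffAt 𝓘(ℝ, EuclideanSpace ℝ (Fin 4)) (𝓡∂ 4) ∞ (chartParam φ) (complexTwoEquiv m) := by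
  refine ContMDiffAt.comp (g := φ.invFun) (complexTwoEquiv m) ?_
    complexTwoEquiv.symm.contDiff.contMDiff.contMDiffAt
  rw [ContinuousLinearEquiv.symm_apply_apply]
  exact φ.contMDiffOn_invFun.contMDiffAt (φ.open_target.mem_nhds hm)

theorem comp_chartParam {m : ℂ × ℂ} (hm : m ∈ φ.target) :
    (diffAt (𝓡∂ 4) 𝓘(ℝ, ℂ × ℂ) φ.toFun (φ.invFun m)).comp
      (diffAt 𝓘(ℝ, EuclideanSpace ℝ (Fin 4)) (𝓡∂ 4) (chartParam φ) (complexTwoEquiv m)) =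
      (complexTwoEquiv.symm : EuclideanSpace ℝ (Fin 4) →L[ℝ] ℂ × ℂ) := by
  have h0 : chartParam φ (complexTwoEquiv m) = φ.invFun m := by
    rw [chartParam, ContinuousLinearEquiv.symm_apply_apply]
  have h1 : MDifferentiableAt (𝓡∂ 4) 𝓘(ℝ, ℂ × ℂ) φ.toFun (chartParam φ (complexTwoEquiv m)) := by
    rw [h0]
    exact φ.mdifferentiableAt_toFun (φ.map_target hm)
  have h := diffAt_comp h1 ((contMDiffAt_chartParam φ hm).mdifferentiableAt (by simp))
  rw [h0] at h
  rw [← h]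
  have hev : φ.toFun ∘ chartParam φ =ᶠ[𝓝 (complexTwoEquiv m)] complexTwoEquiv.symm := by
    have : ∀ᶠ v in 𝓝 (complexTwoEquiv m), complexTwoEquiv.symm v ∈ φ.target := by
      refine complexTwoEquiv.symm.continuous.continuousAt.eventually ?_
      rw [ContinuousLinearEquiv.symm_apply_apply]
      exact φ.open_target.mem_nhds hm
    filter_upwards [this] with v hv
    exact φ.right_inv hv
  rw [diffAt_congr hev, diffAt, mfderiv_eq_fderiv]
  exact complexTwoEquiv.symm.fderiv

theorem det_chartParam_ne_zero {m : ℂ × ℂ} (hm : m ∈ φ.target) :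
    (diffAt 𝓘(ℝ, EuclideanSpace ℝ (Fin 4)) (𝓡∂ 4) (chartParam φ) (complexTwoEquiv m)).det ≠ 0 := by
  apply det_ne_zero_of_injective
  have h : Function.Injective ((diffAt (𝓡∂ 4) 𝓘(ℝ, ℂ × ℂ) φ.toFun (φ.invFun m)) ∘
      (diffAt 𝓘(ℝ, EuclideanSpace ℝ (Fin 4)) (𝓡∂ 4) (chartParam φ) (complexTwoEquiv m))) := by
    rw [← ContinuousLinearMap.coe_comp, comp_chartParam φ hm]
    exact complexTwoEquiv.symm.injective
  exact h.of_comp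

theorem injective_diffAt_toFun {x : X} (hx : x ∈ φ.source) :
    Function.Injective (diffAt (𝓡∂ 4) 𝓘(ℝ, ℂ × ℂ) φ.toFun x) := by
  have hm := φ.map_source hx
  have h := comp_chartParam φ hm
  have h0 : φ.invFun (φ.toFun x) = x := φ.left_inv hx
  rw [show φ.invFun (φ.toPartialEquiv x) = x from h0] at h
  have hs : Function.Surjective (diffAt (𝓡∂ 4) 𝓘(ℝ, ℂ × ℂ) φ.toFun x) := by
    have : Function.Surjective ((diffAt (𝓡∂ 4) 𝓘(ℝ, ℂ × ℂ) φ.toFun x) ∘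
        (diffAt 𝓘(ℝ, EuclideanSpace ℝ (Fin 4)) (𝓡∂ 4) (chartParam φ)
          (complexTwoEquiv (φ.toFun x)))) := by
      rw [← ContinuousLinearMap.coe_comp]
      exact (congrArg (fun T : EuclideanSpace ℝ (Fin 4) →L[ℝ] ℂ × ℂ => Function.Surjective T) h).mpr
        complexTwoEquiv.symm.surjective
    exact this.of_comp
  exact (LinearMap.injective_iff_surjective_of_finrank_eq_finrank
    (f := (diffAt (𝓡∂ 4) 𝓘(ℝ, ℂ × ℂ) φ.toFun x : EuclideanSpace ℝ (Fin 4) →ₗ[ℝ] ℂ × ℂ))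
    (by simp [Complex.finrank_real_complex])).2 hs

/-- The sign by which a chart compares the preferred orientation at a point with the standard one. -/
def chartSign (x : X) : ℤˣ :=
  jacSign (diffAt 𝓘(ℝ, EuclideanSpace ℝ (Fin 4)) (𝓡∂ 4) (chartParam φ) (complexTwoEquiv (φ.toFun x)))

variable [IsManifold (𝓡∂ 4) ∞ X]

theorem contMDiffAt_sheet (ε : ℤˣ) {m : ℂ × ℂ} (hm : m ∈ φ.target) :
    ContMDiffAt 𝓘(ℝ, ℂ × ℂ) (𝓡∂ 4) ∞ (fun m => OrientationCover.map 𝓘(ℝ, EuclideanSpace ℝ (Fin 4))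
      (𝓡∂ 4) (chartParam φ) ⟨complexTwoEquiv m, ε⟩) m := by
  rw [← contMDiffWithinAt_univ]
  refine contMDiffWithinAt_map (P := ℂ × ℂ) (f := fun _ => chartParam φ)
    (w := fun m => ⟨complexTwoEquiv m, ε⟩) ?_ ?_ (mem_univ _) (det_chartParam_ne_zero φ hm)
  · exact ((contMDiffAt_chartParam φ hm).comp (f := fun q : (ℂ × ℂ) × EuclideanSpace ℝ (Fin 4) =>
      q.2) (m, complexTwoEquiv m) contMDiffAt_snd).contMDiffWithinAt
  · exact ((contMDiff_ofOrientation (isOrientation_const ε)).comp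
      complexTwoEquiv.contDiff.contMDiff).contMDiffAt.contMDiffWithinAt

theorem orientsAlong_chartSign {x : X} (hx : x ∈ φ.source) :
    OrientsAlong (𝓡∂ 4) id (chartSign φ) univ x := by
  have h := (OrientationCover.contMDiffWithinAt_iff.1
    ((contMDiffAt_sheet φ 1 (φ.map_source hx)).contMDiffWithinAt (s := univ))).2
  have hc : ContinuousAt φ.toFun x := (φ.mdifferentiableAt_toFun hx).continuousAt
  have h2 := h.comp (w := φ.toFun) (t := univ) hc.continuousWithinAt (mapsTo_univ _ _)
  rw [OrientsAlong, nhdsWithin_univ] at h2 ⊢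
  have hl : ∀ z ∈ φ.source, φ.invFun (φ.toFun z) = z := fun z hz => φ.left_inv hz
  filter_upwards [h2, φ.open_source.mem_nhds hx] with z hz hzs
  have e : ∀ z ∈ φ.source, chartParam φ (complexTwoEquiv (φ.toFun z)) = z := fun z hz => by
    rw [chartParam, ContinuousLinearEquiv.symm_apply_apply, hl z hz]
  simp only [Function.comp_apply, OrientationCover.map, mul_one, e z hzs, e x hx] at hz
  exact hz

/-- The lift of a complex chart to one of the two sheets of the orientation cover over its domain. -/
def sheetChart (ε : ℤˣ) :
    PartialDiffeomorph (𝓡∂ 4) 𝓘(ℝ, ℂ × ℂ) (OrientationCover (𝓡∂ 4) X) (ℂ × ℂ) ∞ where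
  toFun x := φ.toFun x.pt
  invFun m := OrientationCover.map 𝓘(ℝ, EuclideanSpace ℝ (Fin 4)) (𝓡∂ 4) (chartParam φ)
    ⟨complexTwoEquiv m, ε⟩
  source := {x | x.pt ∈ φ.source ∧ x.sgn = chartSign φ x.pt * ε}
  target := φ.target
  map_source' x hx := φ.map_source hx.1
  map_target' m hm := by
    have h0 : chartParam φ (complexTwoEquiv m) = φ.invFun m := by
      rw [chartParam, ContinuousLinearEquiv.symm_apply_apply]
    have h1 : φ.toFun (φ.invFun m) = m := φ.right_inv hm
    refine ⟨?_, ?_⟩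
    · change chartParam φ (complexTwoEquiv m) ∈ _
      rw [h0]
      exact φ.map_target hm
    · change jacSign _ * ε = chartSign φ (chartParam φ (complexTwoEquiv m)) * ε
      rw [h0, chartSign, h1]
  left_inv' x hx := by
    have h1 : φ.invFun (φ.toFun x.pt) = x.pt := φ.left_inv hx.1
    refine OrientationCover.ext ?_ hx.2.symm
    change chartParam φ (complexTwoEquiv (φ.toFun x.pt)) = x.pt
    rw [chartParam, ContinuousLinearEquiv.symm_apply_apply, h1]
  right_inv' m hm := by
    change φ.toFun (chartParam φ (complexTwoEquiv m)) = m
    rw [chartParam, ContinuousLinearEquiv.symm_apply_apply]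
    exact φ.right_inv hm
  open_source := isOpen_sheet φ.open_source (o := fun x => chartSign φ x * ε) fun x hx => by
    simpa only [mul_comm] using (orientsAlong_chartSign φ hx).mul_left ε
  open_target := φ.open_target
  contMDiffOn_toFun := φ.contMDiffOn_toFun.comp contMDiff_pt.contMDiffOn fun _ hx => hx.1
  contMDiffOn_invFun _ hm := (contMDiffAt_sheet φ ε hm).contMDiffWithinAt

theorem sheetChart_toFun (ε : ℤˣ) (x : OrientationCover (𝓡∂ 4) X) :
    (sheetChart φ ε).toFun x = φ.toFun x.pt := rfl

theorem sheetChart_invFun_pt (ε : ℤˣ) (m : ℂ × ℂ) :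
    ((sheetChart φ ε).invFun m).pt = φ.invFun m := by
  change chartParam φ (complexTwoEquiv m) = _
  rw [chartParam, ContinuousLinearEquiv.symm_apply_apply]

variable {φ}

theorem IsLefschetzChart.sheet {f : X → B} {x : X}
    {ψ : PartialDiffeomorph (𝓡∂ 2) 𝓘(ℝ, ℂ) B ℂ ∞} (h : IsLefschetzChart f x φ ψ) (ε : ℤˣ) :
    IsLefschetzChart (fun x : OrientationCover (𝓡∂ 4) X => f x.pt) ⟨x, chartSign φ x * ε⟩
      (sheetChart φ ε) ψ where
  mem_source := ⟨h.mem_source, rfl⟩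
  map_center := h.map_center
  mapsTo _ hx := h.mapsTo hx.1
  value_center := h.value_center
  local_form _ hq := h.local_form _ hq.1

theorem complexDetTwo_ne_zero {L : EuclideanSpace ℝ (Fin 4) →L[ℝ] ℂ × ℂ}
    (hL : Function.Injective L) :
    complexDetTwo (L (stdVec 4 0)) (L (stdVec 4 1)) (L (stdVec 4 2)) (L (stdVec 4 3)) ≠ 0 := by
  let e : EuclideanSpace ℝ (Fin 4) ≃ₗ[ℝ] ℂ × ℂ :=
    LinearEquiv.ofInjectiveOfFinrankEq (L : EuclideanSpace ℝ (Fin 4) →ₗ[ℝ] ℂ × ℂ) hL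
      (by simp [Complex.finrank_real_complex])
  let b := ((EuclideanSpace.basisFun (Fin 4) ℝ).toBasis.map e).reindex
    (finSumFinEquiv (m := 2) (n := 2)).symm
  have h := (Complex.basisOneI.prod Complex.basisOneI).isUnit_det b
  have hb : (b : Fin 2 ⊕ Fin 2 → ℂ × ℂ) =
      Sum.elim ![L (stdVec 4 0), L (stdVec 4 1)] ![L (stdVec 4 2), L (stdVec 4 3)] := by
    funext i
    simp only [b, Module.Basis.reindex_apply, Module.Basis.map_apply, Equiv.symm_symm,
      OrthonormalBasis.coe_toBasis, EuclideanSpace.basisFun_apply]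
    rcases i with i | i <;> fin_cases i <;> rfl
  rw [hb] at h
  exact h.ne_zero

variable {f : X → B}

theorem criticalPoints_cover (hf : ContMDiff (𝓡∂ 4) (𝓡∂ 2) ∞ f) :
    criticalPoints (fun x : OrientationCover (𝓡∂ 4) X => f x.pt) = pt ⁻¹' criticalPoints f := by
  ext x
  change ¬ _ ↔ ¬ _
  rw [diffAt_comp_pt (hf.mdifferentiable (by simp) _)]

theorem criticalValues_cover (hf : ContMDiff (𝓡∂ 4) (𝓡∂ 2) ∞ f) :
    criticalValues (fun x : OrientationCover (𝓡∂ 4) X => f x.pt) = criticalValues f := by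
  rw [criticalValues, criticalPoints_cover hf]
  ext b
  constructor
  · rintro ⟨x, hx, rfl⟩
    exact ⟨x.pt, hx, rfl⟩
  · rintro ⟨x, hx, rfl⟩
    exact ⟨⟨x, 1⟩, hx, rfl⟩

variable [IsManifold (𝓡∂ 2) ∞ B]

theorem IsLefschetzFibration.cover (hf : IsLefschetzFibration f)
    (hX : ¬ IsOrientableManifold (𝓡∂ 4) X) :
    IsLefschetzFibration (fun x : OrientationCover (𝓡∂ 4) X => f x.pt) := by
  have := hf.t2_total
  have := hf.compact_total
  have := hf.connected_total
  refine ⟨inferInstance, inferInstance, OrientationCover.connectedSpace hX, hf.t2_base,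
    hf.compact_base, hf.connected_base, hf.orientable_base, hf.smooth.comp contMDiff_pt, ?_, ?_, ?_⟩
  · have h : (𝓡∂ 4).boundary (OrientationCover (𝓡∂ 4) X) = pt ⁻¹' (𝓡∂ 4).boundary X := rfl
    rw [h, hf.boundary_eq]
    rfl
  · rw [criticalPoints_cover hf.smooth]
    exact fun x hx => hf.critical_interior hx
  · rw [criticalPoints_cover hf.smooth]
    intro x hx
    obtain ⟨φ, ψ, h⟩ := hf.exists_chart x.pt hx
    refine ⟨sheetChart φ (chartSign φ x.pt * x.sgn), ψ, ?_⟩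
    have h2 := h.sheet (chartSign φ x.pt * x.sgn)
    rw [← mul_assoc, Int.units_mul_self, one_mul] at h2
    exact h2

theorem isAchiral_cover (hf : IsLefschetzFibration f) (hne : (criticalPoints f).Nonempty) :
    IsAchiral (OrientationCover.sgn : OrientationCover (𝓡∂ 4) X → ℤˣ)
      (fun x : OrientationCover (𝓡∂ 4) X => f x.pt) := by
  obtain ⟨x, hx⟩ := hne
  obtain ⟨φ, ψ, h⟩ := hf.exists_chart x hx
  have hd := complexDetTwo_ne_zero (injective_diffAt_toFun φ h.mem_source)
  have key : ∃ s : ℤˣ, signReal s * complexDetTwo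
      (diffAt (𝓡∂ 4) 𝓘(ℝ, ℂ × ℂ) φ.toFun x (stdVec 4 0))
      (diffAt (𝓡∂ 4) 𝓘(ℝ, ℂ × ℂ) φ.toFun x (stdVec 4 1))
      (diffAt (𝓡∂ 4) 𝓘(ℝ, ℂ × ℂ) φ.toFun x (stdVec 4 2))
      (diffAt (𝓡∂ 4) 𝓘(ℝ, ℂ × ℂ) φ.toFun x (stdVec 4 3)) < 0 := by
    rcases lt_or_gt_of_ne hd with h1 | h1
    · exact ⟨1, by simpa [signReal] using h1⟩
    · exact ⟨-1, by simpa [signReal] using h1⟩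
  obtain ⟨s, hs⟩ := key
  refine ⟨⟨x, s⟩, by rw [criticalPoints_cover hf.smooth]; exact hx,
    sheetChart φ (chartSign φ x * s), ψ, ?_, ?_⟩
  · have h2 := h.sheet (chartSign φ x * s)
    rw [← mul_assoc, Int.units_mul_self, one_mul] at h2
    exact h2
  · have e : diffAt (𝓡∂ 4) 𝓘(ℝ, ℂ × ℂ) (sheetChart φ (chartSign φ x * s)).toFun ⟨x, s⟩ =
        diffAt (𝓡∂ 4) 𝓘(ℝ, ℂ × ℂ) φ.toFun x :=
      diffAt_comp_pt (x := (⟨x, s⟩ : OrientationCover (𝓡∂ 4) X))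
        (φ.mdifferentiableAt_toFun h.mem_source)
    rw [e]
    exact hs

end Sheets

/-! ### Lifts of Dehn twists -/

section Twist

open OrientationCover

variable {S : Type*} [TopologicalSpace S] [ChartedSpace (EuclideanSpace ℝ (Fin 2)) S]
  {N : Type*} [TopologicalSpace N] [ChartedSpace (EuclideanSpace ℝ (Fin 2)) N]

/-- The data in the definition of a right handed Dehn twist. -/
structure IsTwistAnnulus (θ : S → ℤˣ) (C : Set S) (T : SelfDiffeo S) (A : ℝ × ℝ → S) (β : ℝ → ℝ) :
    Prop where
  smooth : ContMDiff 𝓘(ℝ, ℝ × ℝ) (𝓡 2) ∞ A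
  immersion : ∀ q, Function.Injective (diffAt 𝓘(ℝ, ℝ × ℝ) (𝓡 2) A q)
  eq_iff : ∀ x t x' t', A (x, t) = A (x', t') ↔ t = t' ∧ ∃ k : ℤ, x' = x + k
  core : C = range (fun x : ℝ => A (x, 0))
  orient : ∀ x : ℝ, 0 < signReal (θ (A (x, 0))) *
      stdDet 2 ![diffAt 𝓘(ℝ, ℝ × ℝ) (𝓡 2) A (x, 0) (1, 0),
        diffAt 𝓘(ℝ, ℝ × ℝ) (𝓡 2) A (x, 0) (0, 1)]
  contDiff : ContDiff ℝ ∞ β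
  eq_zero : ∀ t ≤ -1, β t = 0
  eq_one : ∀ t ≥ 1, β t = 1
  twist : ∀ x t, T.toMap (A (x, t)) = A (x + β t, t)
  outside : ∀ p, p ∉ range A → T.toMap p = p

theorem isRightDehnTwist_iff {θ : S → ℤˣ} {C : Set S} {T : SelfDiffeo S} :
    IsRightDehnTwist θ C T ↔ ∃ A β, IsTwistAnnulus θ C T A β := by
  constructor
  · rintro ⟨A, β, h1, h2, h3, h4, h5, h6, h7, h8, h9, h10⟩
    exact ⟨A, β, h1, h2, h3, h4, h5, h6, h7, h8, h9, h10⟩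
  · rintro ⟨A, β, h1, h2, h3, h4, h5, h6, h7, h8, h9, h10⟩
    exact ⟨A, β, h1, h2, h3, h4, h5, h6, h7, h8, h9, h10⟩

/-- The reflection of the annulus in its core circle direction. -/
def reflect : (ℝ × ℝ) →L[ℝ] ℝ × ℝ :=
  (-ContinuousLinearMap.fst ℝ ℝ ℝ).prod (ContinuousLinearMap.snd ℝ ℝ ℝ)

theorem reflect_apply (x t : ℝ) : reflect (x, t) = (-x, t) := rfl

theorem reflect_reflect (q : ℝ × ℝ) : reflect (reflect q) = q := by
  ext <;> simp [reflect]

theorem diffAt_reflect (q : ℝ × ℝ) : diffAt 𝓘(ℝ, ℝ × ℝ) 𝓘(ℝ, ℝ × ℝ) reflect q = reflect := by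
  rw [diffAt, mfderiv_eq_fderiv]
  exact reflect.fderiv

omit [TopologicalSpace S] [ChartedSpace (EuclideanSpace ℝ (Fin 2)) S] in
theorem range_comp_reflect (A : ℝ × ℝ → S) : range (A ∘ reflect) = range A :=
  (show Function.Surjective reflect from fun q => ⟨_, reflect_reflect q⟩).range_comp A

/-- The inverse of a right handed twist is right handed for the reversed orientation. -/
theorem IsTwistAnnulus.inv {θ : S → ℤˣ} {C : Set S} {T : SelfDiffeo S} {A : ℝ × ℝ → S} {β : ℝ → ℝ}
    (h : IsTwistAnnulus θ C T A β) : IsTwistAnnulus (fun p => -θ p) C T⁻¹ (A ∘ reflect) β := by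
  have hd : ∀ q, diffAt 𝓘(ℝ, ℝ × ℝ) (𝓡 2) (A ∘ reflect) q =
      (diffAt 𝓘(ℝ, ℝ × ℝ) (𝓡 2) A (reflect q)).comp reflect := fun q => by
    have := diffAt_comp (I := 𝓘(ℝ, ℝ × ℝ)) (I' := 𝓘(ℝ, ℝ × ℝ)) (I'' := 𝓡 2) (f := reflect)
      (x := q) (h.smooth.mdifferentiable (by simp) _)
      (reflect.contDiff.contMDiff.mdifferentiable (n := 1) (by simp) q)
    rwa [diffAt_reflect] at this
  refine ⟨h.smooth.comp reflect.contDiff.contMDiff, ?_, ?_, ?_, ?_, h.contDiff, h.eq_zero, h.eq_one,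
    ?_, ?_⟩
  · intro q
    rw [hd]
    exact (h.immersion _).comp (Function.LeftInverse.injective reflect_reflect)
  · intro x t x' t'
    change A (-x, t) = A (-x', t') ↔ _
    rw [h.eq_iff]
    refine and_congr_right fun _ => ⟨?_, ?_⟩
    · rintro ⟨k, hk⟩
      exact ⟨-k, by push_cast; linarith⟩
    · rintro ⟨k, hk⟩
      exact ⟨-k, by push_cast; linarith⟩
  · rw [h.core]
    ext p
    constructor
    · rintro ⟨x, rfl⟩
      exact ⟨-x, by simp [reflect_apply]⟩
    · rintro ⟨x, rfl⟩
      exact ⟨-x, rfl⟩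
  · intro x
    rw [hd]
    have := h.orient (-x)
    have e : reflect (1, 0) = -(1, 0) := by ext <;> simp [reflect]
    have e' : reflect (0, 1) = (0, 1) := by ext <;> simp [reflect]
    simp only [ContinuousLinearMap.comp_apply, Function.comp_apply, e, e', map_neg, signReal_neg]
    rw [reflect_apply]
    rw [stdDet_two_eq] at this ⊢
    simp only [PiLp.neg_apply]
    linarith
  · intro x t
    have h1 := h.twist (-(x + β t)) t
    have h2 : -(x + β t) + β t = -x := by ring
    rw [h2] at h1
    change T⁻¹.toMap (A (-x, t)) = A (-(x + β t), t)
    rw [← h1, SelfDiffeo.toMap_inv_toMap]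
  · intro p hp
    rw [range_comp_reflect] at hp
    conv_lhs => rw [← h.outside p hp]
    rw [SelfDiffeo.toMap_inv_toMap]

/-- Coordinates of the plane. -/
def planeEquiv : EuclideanSpace ℝ (Fin 2) ≃L[ℝ] ℝ × ℝ :=
  LinearEquiv.toContinuousLinearEquiv
    { toFun := fun v => (v 0, v 1)
      map_add' := fun _ _ => rfl
      map_smul' := fun _ _ => rfl
      invFun := fun q => !₂[q.1, q.2]
      left_inv := fun v => by ext i; fin_cases i <;> rfl
      right_inv := fun _ => rfl }

theorem planeEquiv_zero : planeEquiv (stdVec 2 0) = (1, 0) := by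
  change ((stdVec 2 0) 0, (stdVec 2 0) 1) = _
  simp [stdVec]

theorem planeEquiv_one : planeEquiv (stdVec 2 1) = (0, 1) := by
  change ((stdVec 2 1) 0, (stdVec 2 1) 1) = _
  simp [stdVec]

theorem diffAt_comp_planeEquiv {A : ℝ × ℝ → S} (hA : ContMDiff 𝓘(ℝ, ℝ × ℝ) (𝓡 2) ∞ A)
    (v : EuclideanSpace ℝ (Fin 2)) : diffAt (𝓡 2) (𝓡 2) (A ∘ planeEquiv) v =
      (diffAt 𝓘(ℝ, ℝ × ℝ) (𝓡 2) A (planeEquiv v)).comp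
        (planeEquiv : EuclideanSpace ℝ (Fin 2) →L[ℝ] ℝ × ℝ) := by
  have h1 : diffAt (𝓡 2) 𝓘(ℝ, ℝ × ℝ) planeEquiv v =
      (planeEquiv : EuclideanSpace ℝ (Fin 2) →L[ℝ] ℝ × ℝ) := by
    rw [diffAt, mfderiv_eq_fderiv]
    exact planeEquiv.fderiv
  rw [← h1]
  exact diffAt_comp (hA.mdifferentiable (by simp) _)
    (planeEquiv.contDiff.contMDiff.mdifferentiable (n := 1) (by simp) v)

theorem det_comp_planeEquiv (L : (ℝ × ℝ) →L[ℝ] EuclideanSpace ℝ (Fin 2)) :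
    (L.comp (planeEquiv : EuclideanSpace ℝ (Fin 2) →L[ℝ] ℝ × ℝ)).det =
      stdDet 2 ![L (1, 0), L (0, 1)] := by
  have := stdDet_two_comp (L.comp (planeEquiv : EuclideanSpace ℝ (Fin 2) →L[ℝ] ℝ × ℝ))
    (stdVec 2 0) (stdVec 2 1)
  rw [stdDet_two_basis, mul_one] at this
  rw [← this, ← planeEquiv_zero, ← planeEquiv_one]
  rfl

theorem det_diffAt_comp_planeEquiv_ne_zero {A : ℝ × ℝ → S}
    (hA : ContMDiff 𝓘(ℝ, ℝ × ℝ) (𝓡 2) ∞ A)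
    (hi : ∀ q, Function.Injective (diffAt 𝓘(ℝ, ℝ × ℝ) (𝓡 2) A q)) (v : EuclideanSpace ℝ (Fin 2)) :
    (diffAt (𝓡 2) (𝓡 2) (A ∘ planeEquiv) v).det ≠ 0 := by
  rw [diffAt_comp_planeEquiv hA]
  exact det_ne_zero_of_injective ((hi _).comp planeEquiv.injective)

/-- Immersions of the plane into a surface are open. -/
theorem isOpenMap_of_det_ne_zero [IsManifold (𝓡 2) ∞ S] {g : EuclideanSpace ℝ (Fin 2) → S}
    (hg : ContMDiff (𝓡 2) (𝓡 2) ∞ g) (hd : ∀ v, (diffAt (𝓡 2) (𝓡 2) g v).det ≠ 0) :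
    IsOpenMap g := by
  refine IsOpenMap.of_nhds_le fun v => ?_
  have h1 := (contMDiffAt_iff.1 (hg v)).2
  simp only [chartAt_self_eq, mfld_simps] at h1
  rw [contDiffWithinAt_univ] at h1
  have h2 := h1.hasStrictFDerivAt (by simp)
  have h3 : diffAt (𝓡 2) (𝓡 2) g v =
      fderiv ℝ (chartAt (EuclideanSpace ℝ (Fin 2)) (g v) ∘ g) v := by
    rw [diffAt, (hg.mdifferentiable (by simp) v).mfderiv]
    simp only [chartAt_self_eq, mfld_simps]
    rw [fderivWithin_univ]
  rw [← h3] at h2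
  have h4 : Function.Surjective (diffAt (𝓡 2) (𝓡 2) g v) :=
    (LinearMap.injective_iff_surjective
      (f := (diffAt (𝓡 2) (𝓡 2) g v : EuclideanSpace ℝ (Fin 2) →ₗ[ℝ] _))).1
      (injective_of_det_ne_zero (hd v))
  have h5 := h2.map_nhds_eq_of_surj (LinearMap.range_eq_top.2 h4)
  intro W hW
  rw [Filter.mem_map] at hW
  have hW' : g ⁻¹' (W ∩ (chartAt (EuclideanSpace ℝ (Fin 2)) (g v)).source) ∈ 𝓝 v :=
    Filter.inter_mem hW (hg.continuous.continuousAt.preimage_mem_nhds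
      (chart_source_mem_nhds (EuclideanSpace ℝ (Fin 2)) (g v)))
  have h6 := Filter.image_mem_map (m := chartAt (EuclideanSpace ℝ (Fin 2)) (g v) ∘ g) hW'
  rw [h5] at h6
  have hc : ContinuousAt (chartAt (EuclideanSpace ℝ (Fin 2)) (g v)) (g v) :=
    (chartAt (EuclideanSpace ℝ (Fin 2)) (g v)).continuousAt (mem_chart_source _ _)
  filter_upwards [hc.preimage_mem_nhds h6,
    chart_source_mem_nhds (EuclideanSpace ℝ (Fin 2)) (g v)] with s hs hs2
  obtain ⟨w, hw, hws⟩ := hs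
  have : g w = s := (chartAt (EuclideanSpace ℝ (Fin 2)) (g v)).injOn hw.2 hs2 hws
  rw [← this]
  exact hw.1

theorem exists_cutoff (D : SelfDiffeo S) {U C : Set S} (hU : IsOpen U) (hC : IsClosed C)
    (hCU : C ⊆ U) (hD : ∀ s, D.toMap s ∈ U ↔ s ∈ U) (hid : ∀ s ∈ U, s ∉ C → D.toMap s = s) :
    ∃ D' : SelfDiffeo S, (∀ s ∈ U, D'.toMap s = D.toMap s) ∧ ∀ s ∉ U, D'.toMap s = s := by
  classical
  have smooth : ∀ D : SelfDiffeo S, (∀ s ∈ U, s ∉ C → D.toMap s = s) →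
      ContMDiff (𝓡 2) (𝓡 2) ∞ (fun s => if s ∈ U then D.toMap s else s) := by
    intro D hid s
    by_cases hs : s ∈ U
    · refine (D.contMDiff s).congr_of_eventuallyEq ?_
      filter_upwards [hU.mem_nhds hs] with z hz
      rw [if_pos hz]
    · refine (contMDiff_id (I := 𝓡 2) s).congr_of_eventuallyEq ?_
      filter_upwards [hC.isOpen_compl.mem_nhds fun h => hs (hCU h)] with z hz
      split_ifs with h
      · exact hid z h hz
      · rfl
  have hinv : ∀ s, D⁻¹.toMap s ∈ U ↔ s ∈ U := fun s => by
    rw [← hD, SelfDiffeo.toMap_toMap_inv]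
  let D' : S ≃ₘ^∞⟮𝓡 2, 𝓡 2⟯ S :=
    { toFun := fun s => if s ∈ U then D.toMap s else s
      invFun := fun s => if s ∈ U then D⁻¹.toMap s else s
      left_inv := fun s => by
        by_cases hs : s ∈ U
        · simp only [if_pos hs, if_pos ((hD s).2 hs), SelfDiffeo.toMap_inv_toMap]
        · simp only [if_neg hs]
      right_inv := fun s => by
        by_cases hs : s ∈ U
        · simp only [if_pos hs, if_pos ((hinv s).2 hs), SelfDiffeo.toMap_toMap_inv]
        · simp only [if_neg hs]
      contMDiff_toFun := smooth D hid
      contMDiff_invFun := smooth D⁻¹ fun s hs hs' => by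
        conv_lhs => rw [← hid s hs hs']
        rw [SelfDiffeo.toMap_inv_toMap] }
  exact ⟨D', fun s hs => if_pos hs, fun s hs => if_neg hs⟩

/-- The lift of an immersion of the plane to the orientation cover. -/
def annulusLift (A : ℝ × ℝ → N) (ε : ℤˣ) (q : ℝ × ℝ) : OrientationCover (𝓡 2) N :=
  OrientationCover.map (𝓡 2) (𝓡 2) (A ∘ planeEquiv) ⟨planeEquiv.symm q, ε⟩

theorem annulusLift_pt (A : ℝ × ℝ → N) (ε : ℤˣ) (q : ℝ × ℝ) : (annulusLift A ε q).pt = A q := by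
  change A (planeEquiv (planeEquiv.symm q)) = A q
  rw [ContinuousLinearEquiv.apply_symm_apply]

theorem annulusLift_neg (A : ℝ × ℝ → N) (ε : ℤˣ) (q : ℝ × ℝ) :
    annulusLift A (-ε) q = (annulusLift A ε q).flip :=
  map_flip (I := 𝓡 2) (I₁ := 𝓡 2) (A ∘ planeEquiv) ⟨planeEquiv.symm q, ε⟩

theorem eq_annulusLift {A : ℝ × ℝ → N} {q : ℝ × ℝ} {x : OrientationCover (𝓡 2) N} (h : x.pt = A q) :
    x = annulusLift A 1 q ∨ x = annulusLift A (-1) q := by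
  rw [annulusLift_neg]
  exact eq_or_eq_flip (h.trans (annulusLift_pt A 1 q).symm)

theorem map_annulusLift {A A' : ℝ × ℝ → N} (hA : ContMDiff 𝓘(ℝ, ℝ × ℝ) (𝓡 2) ∞ A)
    (hi : ∀ q, Function.Injective (diffAt 𝓘(ℝ, ℝ × ℝ) (𝓡 2) A q))
    (hA' : ContMDiff 𝓘(ℝ, ℝ × ℝ) (𝓡 2) ∞ A')
    (hi' : ∀ q, Function.Injective (diffAt 𝓘(ℝ, ℝ × ℝ) (𝓡 2) A' q)) (T : SelfDiffeo N)
    {τ : ℝ × ℝ → ℝ × ℝ} {q : ℝ × ℝ} (hτ : DifferentiableAt ℝ τ q)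
    (hdet : (fderiv ℝ τ q).det ≠ 0)
    (h : ∀ q, T.toMap (A' q) = A (τ q)) (ε : ℤˣ) :
    OrientationCover.map (𝓡 2) (𝓡 2) T.toMap (annulusLift A' ε q) =
      annulusLift A (jacSign (fderiv ℝ τ q) * ε) (τ q) := by
  set τ' : EuclideanSpace ℝ (Fin 2) → EuclideanSpace ℝ (Fin 2) :=
    planeEquiv.symm ∘ τ ∘ planeEquiv with hτ'
  set v := planeEquiv.symm q with hv
  have hvq : planeEquiv v = q := planeEquiv.apply_symm_apply q
  have hder : HasFDerivAt τ' (((planeEquiv.symm : ℝ × ℝ →L[ℝ] EuclideanSpace ℝ (Fin 2)).comp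
      (fderiv ℝ τ q)).comp (planeEquiv : EuclideanSpace ℝ (Fin 2) →L[ℝ] ℝ × ℝ)) v := by
    have h1 : HasFDerivAt τ (fderiv ℝ τ q) (planeEquiv v) := by rw [hvq]; exact hτ.hasFDerivAt
    exact (planeEquiv.symm.hasFDerivAt.comp _ h1).comp v planeEquiv.hasFDerivAt
  have hdet' : (((planeEquiv.symm : ℝ × ℝ →L[ℝ] EuclideanSpace ℝ (Fin 2)).comp
      (fderiv ℝ τ q)).comp (planeEquiv : EuclideanSpace ℝ (Fin 2) →L[ℝ] ℝ × ℝ)).det =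
      (fderiv ℝ τ q).det := by
    have := LinearMap.det_conj (fderiv ℝ τ q : ℝ × ℝ →ₗ[ℝ] ℝ × ℝ) planeEquiv.symm.toLinearEquiv
    exact this
  have hdiff : diffAt (𝓡 2) (𝓡 2) τ' v =
      (((planeEquiv.symm : ℝ × ℝ →L[ℝ] EuclideanSpace ℝ (Fin 2)).comp
      (fderiv ℝ τ q)).comp (planeEquiv : EuclideanSpace ℝ (Fin 2) →L[ℝ] ℝ × ℝ)) := by
    rw [diffAt, mfderiv_eq_fderiv]
    exact hder.fderiv
  have hjac : jacSign (diffAt (𝓡 2) (𝓡 2) τ' v) = jacSign (fderiv ℝ τ q) := by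
    rw [hdiff, jacSign, hdet', jacSign]
  have hAp : ContMDiff (𝓡 2) (𝓡 2) ∞ (A ∘ planeEquiv) := hA.comp planeEquiv.contDiff.contMDiff
  have hAp' : ContMDiff (𝓡 2) (𝓡 2) ∞ (A' ∘ planeEquiv) := hA'.comp planeEquiv.contDiff.contMDiff
  have e1 : T.toMap ∘ (A' ∘ planeEquiv) = (A ∘ planeEquiv) ∘ τ' := by
    funext w
    simp only [hτ', Function.comp_apply, ContinuousLinearEquiv.apply_symm_apply]
    exact h _
  have e2 : OrientationCover.map (𝓡 2) (𝓡 2) τ' ⟨v, ε⟩ =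
      (⟨planeEquiv.symm (τ q), jacSign (fderiv ℝ τ q) * ε⟩ :
        OrientationCover (𝓡 2) (EuclideanSpace ℝ (Fin 2))) := by
    refine OrientationCover.ext ?_ ?_
    · change planeEquiv.symm (τ (planeEquiv v)) = _
      rw [hvq]
    · change jacSign _ * ε = _
      rw [hjac]
  rw [annulusLift, annulusLift, ← e2, map_map _ (hAp'.mdifferentiable (by simp) _)
    (T.mdifferentiableAt _) (det_diffAt_comp_planeEquiv_ne_zero hA' hi' _) (T.det_ne_zero _), e1,
    map_map _ _ (hAp.mdifferentiable (by simp) _) _ (det_diffAt_comp_planeEquiv_ne_zero hA hi _)]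
  · exact hder.differentiableAt.mdifferentiableAt
  · change (diffAt (𝓡 2) (𝓡 2) τ' v).det ≠ 0
    rw [hdiff, hdet']
    exact hdet

theorem det_prod_upper (a b d : ℝ) :
    ((a • ContinuousLinearMap.fst ℝ ℝ ℝ + b • ContinuousLinearMap.snd ℝ ℝ ℝ).prod
      (d • ContinuousLinearMap.snd ℝ ℝ ℝ)).det = a * d := by
  rw [ContinuousLinearMap.det, ← LinearMap.det_toMatrix (Module.Basis.finTwoProd ℝ),
    Matrix.det_fin_two]
  simp [LinearMap.toMatrix_apply]

namespace IsTwistAnnulus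

variable {θ : N → ℤˣ} {C : Set N} {T : SelfDiffeo N} {A : ℝ × ℝ → N} {β : ℝ → ℝ}
  (h : IsTwistAnnulus θ C T A β)
include h

theorem annulusLift_add_int (ε : ℤˣ) (x t : ℝ) (k : ℤ) :
    annulusLift A ε (x + k, t) = annulusLift A ε (x, t) := by
  have hder : HasFDerivAt (fun q : ℝ × ℝ => q + ((k : ℝ), (0 : ℝ))) (ContinuousLinearMap.id ℝ _)
      (x, t) := (hasFDerivAt_id _).add_const _
  have h1 := map_annulusLift h.smooth h.immersion h.smooth h.immersion 1
    (τ := fun q : ℝ × ℝ => q + ((k : ℝ), (0 : ℝ))) (q := (x, t)) hder.differentiableAt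
    (by rw [hder.fderiv]; simp [ContinuousLinearMap.det])
    (fun q => by
      obtain ⟨y, s⟩ := q
      change A (y, s) = A ((y, s) + ((k : ℝ), (0 : ℝ)))
      rw [Prod.mk_add_mk, add_zero, h.eq_iff]
      exact ⟨rfl, k, rfl⟩) ε
  rw [hder.fderiv, jacSign_id, one_mul, Prod.mk_add_mk, add_zero] at h1
  rw [← h1]
  exact map_id _

theorem map_annulusLift_eq (ε : ℤˣ) (x t : ℝ) :
    OrientationCover.map (𝓡 2) (𝓡 2) T.toMap (annulusLift A ε (x, t)) =
      annulusLift A ε (x + β t, t) := by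
  have hder : HasFDerivAt (fun q : ℝ × ℝ => (q.1 + β q.2, q.2))
      (((1 : ℝ) • ContinuousLinearMap.fst ℝ ℝ ℝ + (deriv β t) • ContinuousLinearMap.snd ℝ ℝ ℝ).prod
      ((1 : ℝ) • ContinuousLinearMap.snd ℝ ℝ ℝ)) (x, t) := by
    rw [one_smul, one_smul]
    refine (hasFDerivAt_fst.add ?_).prodMk hasFDerivAt_snd
    exact ((h.contDiff.differentiable (by simp) t).hasDerivAt).comp_hasFDerivAt (x, t)
      hasFDerivAt_snd
  have h1 := map_annulusLift h.smooth h.immersion h.smooth h.immersion T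
    (q := (x, t)) hder.differentiableAt (by rw [hder.fderiv, det_prod_upper]; norm_num)
    (fun q => h.twist q.1 q.2) ε
  have h2 : jacSign (((1 : ℝ) • ContinuousLinearMap.fst ℝ ℝ ℝ +
      (deriv β t) • ContinuousLinearMap.snd ℝ ℝ ℝ).prod
      ((1 : ℝ) • ContinuousLinearMap.snd ℝ ℝ ℝ)) = 1 := by
    rw [jacSign, det_prod_upper, if_pos (by norm_num)]
  rw [hder.fderiv, h2, one_mul] at h1
  exact h1

theorem annulusLift_reflect (ε : ℤˣ) (q : ℝ × ℝ) :
    annulusLift (A ∘ reflect) ε q = annulusLift A (-ε) (reflect q) := by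
  have hder : HasFDerivAt reflect reflect q := reflect.hasFDerivAt
  have hr : reflect = (((-1 : ℝ) • ContinuousLinearMap.fst ℝ ℝ ℝ +
      (0 : ℝ) • ContinuousLinearMap.snd ℝ ℝ ℝ).prod
      ((1 : ℝ) • ContinuousLinearMap.snd ℝ ℝ ℝ)) := by
    ext <;> simp [reflect]
  have hdet : reflect.det = -1 := by
    rw [hr, det_prod_upper]
    norm_num
  have h1 := map_annulusLift h.smooth h.immersion h.inv.smooth h.inv.immersion 1
    (q := q) hder.differentiableAt (by rw [hder.fderiv, hdet]; norm_num) (fun _ => rfl) ε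
  have h2 : jacSign reflect = -1 := by
    rw [jacSign, hdet, if_neg (by norm_num)]
  rw [hder.fderiv, h2, neg_one_mul] at h1
  rw [← h1]
  exact (map_id _).symm

theorem annulusLift_ne (q q' : ℝ × ℝ) : annulusLift A 1 q ≠ annulusLift A (-1) q' := by
  intro he
  obtain ⟨x, t⟩ := q
  obtain ⟨x', t'⟩ := q'
  have h1 : A (x, t) = A (x', t') := by
    rw [← annulusLift_pt A 1, he, annulusLift_pt]
  obtain ⟨rfl, k, rfl⟩ := (h.eq_iff _ _ _ _).1 h1
  rw [h.annulusLift_add_int, annulusLift_neg] at he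
  exact flip_ne _ he.symm

end IsTwistAnnulus

variable [IsManifold (𝓡 2) ∞ N] [IsManifold (𝓡 2) ∞ S] {σ : S → ℤˣ} {J : S → N}
  (hJ : IsOrientationDoubleCovering (𝓡 2) σ J)

theorem coverDiffeo_injective : Function.Injective (coverDiffeo hJ) := (coverDiffeo hJ).injective

/-- The lift of an immersed annulus that preserves orientations. -/
def upperAnnulus (A : ℝ × ℝ → N) (q : ℝ × ℝ) : S := (coverDiffeo hJ).symm (annulusLift A 1 q)

theorem coverDiffeo_upperAnnulus (A : ℝ × ℝ → N) (q : ℝ × ℝ) :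
    coverDiffeo hJ (upperAnnulus hJ A q) = annulusLift A 1 q :=
  Diffeomorph.apply_symm_apply _ _

theorem apply_upperAnnulus (A : ℝ × ℝ → N) (q : ℝ × ℝ) : J (upperAnnulus hJ A q) = A q := by
  rw [upperAnnulus, apply_coverDiffeo_symm hJ, annulusLift_pt]

namespace IsTwistAnnulus

variable {θ : N → ℤˣ} {C : Set N} {T : SelfDiffeo N} {A : ℝ × ℝ → N} {β : ℝ → ℝ}
  (h : IsTwistAnnulus θ C T A β)
include h

theorem contMDiff_upperAnnulus : ContMDiff 𝓘(ℝ, ℝ × ℝ) (𝓡 2) ∞ (upperAnnulus hJ A) := by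
  refine (coverDiffeo hJ).symm.contMDiff.comp ?_
  refine (contMDiff_map (I := 𝓡 2) (M := EuclideanSpace ℝ (Fin 2))
    (h.smooth.comp planeEquiv.contDiff.contMDiff)
    (det_diffAt_comp_planeEquiv_ne_zero h.smooth h.immersion)).comp ?_
  exact (contMDiff_ofOrientation (isOrientation_const 1)).comp planeEquiv.symm.contDiff.contMDiff

theorem comp_diffAt_upperAnnulus (q : ℝ × ℝ) : (diffAt (𝓡 2) (𝓡 2) J (upperAnnulus hJ A q)).comp
    (diffAt 𝓘(ℝ, ℝ × ℝ) (𝓡 2) (upperAnnulus hJ A) q) = diffAt 𝓘(ℝ, ℝ × ℝ) (𝓡 2) A q := by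
  rw [← diffAt_comp (hJ.isLocalDiffeomorph.mdifferentiable (by simp) _)
    ((h.contMDiff_upperAnnulus hJ).mdifferentiable (by simp) _)]
  congr 1
  funext q
  exact apply_upperAnnulus hJ A q

theorem injective_diffAt_upperAnnulus (q : ℝ × ℝ) :
    Function.Injective (diffAt 𝓘(ℝ, ℝ × ℝ) (𝓡 2) (upperAnnulus hJ A) q) := by
  have h1 := h.immersion q
  rw [← h.comp_diffAt_upperAnnulus hJ] at h1
  exact Function.Injective.of_comp (f := diffAt (𝓡 2) (𝓡 2) J (upperAnnulus hJ A q)) h1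

theorem upperAnnulus_add_int (x t : ℝ) (k : ℤ) :
    upperAnnulus hJ A (x + k, t) = upperAnnulus hJ A (x, t) := by
  rw [upperAnnulus, h.annulusLift_add_int, upperAnnulus]

theorem liftDiffeo_upperAnnulus (x t : ℝ) :
    (liftDiffeo hJ T).toMap (upperAnnulus hJ A (x, t)) = upperAnnulus hJ A (x + β t, t) := by
  apply (coverDiffeo_injective hJ)
  rw [coverDiffeo_liftDiffeo, coverDiffeo_upperAnnulus, coverDiffeo_upperAnnulus,
    h.map_annulusLift_eq]

theorem isOpen_range_upperAnnulus : IsOpen (range (upperAnnulus hJ A)) := by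
  have h1 := isOpenMap_of_det_ne_zero
    ((h.contMDiff_upperAnnulus hJ).comp planeEquiv.contDiff.contMDiff)
    (det_diffAt_comp_planeEquiv_ne_zero (h.contMDiff_upperAnnulus hJ)
      (h.injective_diffAt_upperAnnulus hJ))
  have h2 := h1.isOpen_range
  rwa [planeEquiv.surjective.range_comp] at h2

theorem isTwistAnnulus_upperAnnulus {T' : SelfDiffeo S}
    (hT : ∀ s ∈ range (upperAnnulus hJ A), T'.toMap s = (liftDiffeo hJ T).toMap s)
    (hT' : ∀ s ∉ range (upperAnnulus hJ A), T'.toMap s = s) :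
    IsTwistAnnulus σ ((⟨C, θ⟩ : OrientedCurve N).upperLift σ J) T' (upperAnnulus hJ A) β where
  smooth := h.contMDiff_upperAnnulus hJ
  immersion := h.injective_diffAt_upperAnnulus hJ
  eq_iff x t x' t' := by
    constructor
    · intro he
      have := congrArg J he
      rwa [apply_upperAnnulus hJ, apply_upperAnnulus hJ, h.eq_iff] at this
    · rintro ⟨rfl, k, rfl⟩
      exact (h.upperAnnulus_add_int hJ x t k).symm
  core := by
    have hsgn : ∀ x : ℝ, (annulusLift A 1 (x, 0)).sgn = θ (A (x, 0)) := by
      intro x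
      change jacSign (diffAt (𝓡 2) (𝓡 2) (A ∘ planeEquiv) (planeEquiv.symm (x, 0))) * 1 = _
      have h1 := h.orient x
      have h2 := jacSign_mul_det_pos (det_diffAt_comp_planeEquiv_ne_zero h.smooth h.immersion
        (planeEquiv.symm (x, 0)))
      rw [mul_one]
      refine eq_of_signReal_mul_pos h2 ?_
      rw [diffAt_comp_planeEquiv h.smooth, det_comp_planeEquiv,
        ContinuousLinearEquiv.apply_symm_apply]
      exact h1
    ext s
    constructor
    · rintro ⟨hs, hs2⟩
      change J s ∈ C at hs
      rw [h.core] at hs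
      obtain ⟨x, hx⟩ := hs
      refine ⟨x, (coverDiffeo_injective hJ) ?_⟩
      change coverDiffeo hJ (upperAnnulus hJ A (x, 0)) = _
      rw [coverDiffeo_upperAnnulus]
      refine OrientationCover.ext ?_ ?_
      · rw [annulusLift_pt]
        exact hx
      · rw [hsgn]
        change A (x, 0) = J s at hx
        rw [hx]
        exact hs2.symm
    · rintro ⟨x, rfl⟩
      have hx := apply_upperAnnulus hJ A (x, 0)
      refine ⟨?_, ?_⟩
      · change J (upperAnnulus hJ A (x, 0)) ∈ C
        rw [hx, h.core]
        exact ⟨x, rfl⟩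
      · change (coverDiffeo hJ (upperAnnulus hJ A (x, 0))).sgn = θ (J (upperAnnulus hJ A (x, 0)))
        rw [coverDiffeo_upperAnnulus, hsgn, hx]
  orient x := by
    set s := upperAnnulus hJ A (x, 0) with hs
    have h1 : jacSign (diffAt (𝓡 2) (𝓡 2) J s) * σ s =
        jacSign (diffAt (𝓡 2) (𝓡 2) (A ∘ planeEquiv) (planeEquiv.symm (x, 0))) * 1 :=
      congrArg sgn (coverDiffeo_upperAnnulus hJ A (x, 0))
    have hd := det_diffAt_comp_planeEquiv_ne_zero (h.contMDiff_upperAnnulus hJ)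
      (h.injective_diffAt_upperAnnulus hJ) (planeEquiv.symm (x, 0))
    have hJd := (hJ.isLocalDiffeomorph s).det_ne_zero
    rw [diffAt_comp_planeEquiv (h.contMDiff_upperAnnulus hJ),
      ContinuousLinearEquiv.apply_symm_apply] at hd
    rw [diffAt_comp_planeEquiv h.smooth, ContinuousLinearEquiv.apply_symm_apply,
      ← h.comp_diffAt_upperAnnulus hJ, ContinuousLinearMap.comp_assoc, jacSign_comp hJd hd, mul_one,
      mul_right_inj] at h1
    have h2 := jacSign_mul_det_pos hd
    rw [← h1, det_comp_planeEquiv] at h2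
    exact h2
  contDiff := h.contDiff
  eq_zero := h.eq_zero
  eq_one := h.eq_one
  twist x t := by
    rw [hT _ (mem_range_self _), h.liftDiffeo_upperAnnulus]
  outside := hT'

theorem exists_upper_twist [T2Space S] : ∃ T' : SelfDiffeo S,
    (∀ s ∈ range (upperAnnulus hJ A), T'.toMap s = (liftDiffeo hJ T).toMap s) ∧
    ∀ s ∉ range (upperAnnulus hJ A), T'.toMap s = s := by
  refine exists_cutoff (liftDiffeo hJ T) (h.isOpen_range_upperAnnulus hJ)
    (C := upperAnnulus hJ A '' (Icc 0 1 ×ˢ Icc (-1) 1)) ?_ (image_subset_range _ _) ?_ ?_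
  · exact ((isCompact_Icc.prod isCompact_Icc).image
      (h.contMDiff_upperAnnulus hJ).continuous).isClosed
  · intro s
    constructor
    · rintro ⟨⟨x, t⟩, hq⟩
      refine ⟨(x - β t, t), (liftDiffeo hJ T).injective ?_⟩
      rw [h.liftDiffeo_upperAnnulus, ← hq, sub_add_cancel]
    · rintro ⟨⟨x, t⟩, rfl⟩
      exact ⟨_, (h.liftDiffeo_upperAnnulus hJ x t).symm⟩
  · rintro _ ⟨⟨x, t⟩, rfl⟩ hC
    rw [h.liftDiffeo_upperAnnulus]
    rcases le_or_gt t (-1) with ht | ht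
    · rw [h.eq_zero t ht, add_zero]
    · rcases le_or_gt 1 t with ht' | ht'
      · rw [h.eq_one t ht']
        simpa using h.upperAnnulus_add_int hJ x t 1
      · exfalso
        refine hC ⟨(Int.fract x, t), ⟨⟨Int.fract_nonneg x, (Int.fract_lt_one x).le⟩, ht.le, ht'.le⟩,
          ?_⟩
        rw [← h.upperAnnulus_add_int hJ _ _ ⌊x⌋, Int.fract_add_floor]

theorem liftDiffeo_eq_self [T2Space N] {s : S} (hs : J s ∉ range A) :
    (liftDiffeo hJ T).toMap s = s := by
  apply (coverDiffeo_injective hJ)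
  rw [coverDiffeo_liftDiffeo]
  apply map_eq_self
  have hcl : IsClosed (A '' (Icc 0 1 ×ˢ Icc (-1) 1)) :=
    ((isCompact_Icc.prod isCompact_Icc).image h.smooth.continuous).isClosed
  have hmem : J s ∉ A '' (Icc 0 1 ×ˢ Icc (-1) 1) := fun hm => hs (image_subset_range _ _ hm)
  rw [coverDiffeo_pt]
  filter_upwards [hcl.isOpen_compl.mem_nhds hmem] with p hp
  by_cases hpA : p ∈ range A
  · obtain ⟨⟨x, t⟩, rfl⟩ := hpA
    rw [h.twist]
    change A _ = A _
    rcases le_or_gt t (-1) with ht | ht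
    · rw [h.eq_zero t ht, add_zero]
    · rcases le_or_gt 1 t with ht' | ht'
      · rw [h.eq_one t ht', h.eq_iff]
        exact ⟨rfl, -1, by simp⟩
      · exfalso
        refine hp ⟨(Int.fract x, t), ⟨⟨Int.fract_nonneg x, (Int.fract_lt_one x).le⟩, ht.le, ht'.le⟩,
          ?_⟩
        rw [h.eq_iff]
        exact ⟨rfl, ⌊x⌋, (Int.fract_add_floor x).symm⟩
  · exact h.outside p hpA

omit [IsManifold (𝓡 2) ∞ S] [IsManifold (𝓡 2) ∞ N] h in
theorem lowerLift_eq (C : Set N) (θ : N → ℤˣ) : (⟨C, θ⟩ : OrientedCurve N).lowerLift σ J =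
    (⟨C, fun p => -θ p⟩ : OrientedCurve N).upperLift σ J := by
  ext s
  constructor
  · rintro ⟨h1, h2⟩
    refine ⟨h1, ?_⟩
    rcases units_eq_or_eq_neg (jacSign (diffAt (𝓡 2) (𝓡 2) J s) * σ s) (θ (J s)) with h3 | h3
    · exact absurd ⟨h1, h3⟩ h2
    · exact h3
  · rintro ⟨h1, h2⟩
    refine ⟨h1, fun h3 => ?_⟩
    have h4 := h3.2.symm.trans h2
    exact units_ne_neg_self _ h4

end IsTwistAnnulus

/-- The lift of a right handed twist is the product of a right handed one and a left handed one. -/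
theorem IsRightDehnTwist.exists_lift [T2Space N] [T2Space S] {c : OrientedCurve N}
    {T : SelfDiffeo N} (hT : IsRightDehnTwist c.orient c.carrier T) :
    IsConnected (c.upperLift σ J) ∧ IsConnected (c.lowerLift σ J) ∧
    ∃ T₁ T₂ : SelfDiffeo S, IsRightDehnTwist σ (c.upperLift σ J) T₁ ∧
      IsRightDehnTwist σ (c.lowerLift σ J) T₂ ∧ liftDiffeo hJ T = T₁ * T₂⁻¹ := by
  obtain ⟨A, β, h⟩ := isRightDehnTwist_iff.1 hT
  have h' := h.inv
  obtain ⟨T₁, h1, h1'⟩ := h.exists_upper_twist hJ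
  obtain ⟨T₂, h2, h2'⟩ := h'.exists_upper_twist hJ
  have hup := h.isTwistAnnulus_upperAnnulus hJ h1 h1'
  have hlow := h'.isTwistAnnulus_upperAnnulus hJ h2 h2'
  have hl : c.lowerLift σ J = _ := IsTwistAnnulus.lowerLift_eq c.carrier c.orient
  rw [← hl] at hlow
  have hconn : ∀ {C : Set S} {T : SelfDiffeo S} {A : ℝ × ℝ → S}, IsTwistAnnulus σ C T A β →
      IsConnected C := by
    intro C T A h
    rw [h.core]
    exact isConnected_range (h.smooth.continuous.comp (by fun_prop))
  refine ⟨hconn hup, hconn hlow, T₁, T₂, isRightDehnTwist_iff.2 ⟨_, _, hup⟩,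
    isRightDehnTwist_iff.2 ⟨_, _, hlow⟩, ?_⟩
  have hdisj : ∀ q q', upperAnnulus hJ A q ≠ upperAnnulus hJ (A ∘ reflect) q' := by
    intro q q' he
    have := congrArg (coverDiffeo hJ) he
    rw [coverDiffeo_upperAnnulus, coverDiffeo_upperAnnulus, h.annulusLift_reflect] at this
    exact h.annulusLift_ne _ _ this
  have h2inv : ∀ s ∉ range (upperAnnulus hJ (A ∘ reflect)), T₂⁻¹.toMap s = s := by
    intro s hs
    conv_lhs => rw [← h2' s hs]
    rw [SelfDiffeo.toMap_inv_toMap]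
  refine SelfDiffeo.ext fun s => ?_
  rw [SelfDiffeo.toMap_mul]
  by_cases hs1 : s ∈ range (upperAnnulus hJ A)
  · rw [h1 s hs1, h2inv]
    rintro ⟨q', hq'⟩
    obtain ⟨⟨x, t⟩, rfl⟩ := hs1
    rw [h.liftDiffeo_upperAnnulus] at hq'
    exact hdisj _ _ hq'.symm
  · rw [h1' s hs1]
    by_cases hs2 : s ∈ range (upperAnnulus hJ (A ∘ reflect))
    · apply T₂.injective
      rw [SelfDiffeo.toMap_toMap_inv, h2]
      · rw [map_inv, SelfDiffeo.toMap_inv_toMap]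
      · obtain ⟨⟨x, t⟩, rfl⟩ := hs2
        refine ⟨(x - β t, t), (liftDiffeo hJ T⁻¹).injective ?_⟩
        rw [h'.liftDiffeo_upperAnnulus, map_inv, SelfDiffeo.toMap_inv_toMap, sub_add_cancel]
    · rw [h2inv s hs2]
      apply h.liftDiffeo_eq_self hJ
      rintro ⟨q, hq⟩
      rcases eq_annulusLift (x := coverDiffeo hJ s) (A := A) (q := q) hq.symm with h3 | h3
      · exact hs1 ⟨q, (coverDiffeo_injective hJ) ((coverDiffeo_upperAnnulus hJ A q).trans h3.symm)⟩
      · refine hs2 ⟨reflect q, (coverDiffeo_injective hJ) ?_⟩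
        rw [coverDiffeo_upperAnnulus, h.annulusLift_reflect, reflect_reflect, h3]

end Twist

/-! ### Lifts of monodromies and vanishing cycles -/

section Monodromy

open OrientationCover

variable {X : Type*} [TopologicalSpace X] [ChartedSpace (EuclideanHalfSpace 4) X]
  {B : Type*} [TopologicalSpace B] [ChartedSpace (EuclideanHalfSpace 2) B]
  {N : Type*} [TopologicalSpace N] [ChartedSpace (EuclideanSpace ℝ (Fin 2)) N]

/-- Monodromy along loops that avoid a given set. -/
def HasMonodromyAvoiding (Δ : Set B) (f : X → B) (j : N → X) {y : {b : B // b ∉ Δ}}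
    (α : Path.Homotopic.Quotient y y) (τ : MappingClasses N) : Prop :=
  ∃ (a : Path y y) (Φ : ℝ × N → X) (D : SelfDiffeo N), Path.Homotopic.Quotient.mk a = α ∧
    IsTrivializationAlong f (fun t => (a.extend t : B)) 1 Φ ∧
    (∀ p, Φ (0, p) = j p) ∧ (∀ p, Φ (1, p) = j (D.toMap p)) ∧ τ = QuotientGroup.mk D

/-- Monodromy factorizations with a given set instead of the set of critical values. -/
def IsMonodromyFactorizationAvoiding (Δ : Set B) (σB : B → ℤˣ) (f : X → B) (y : {b : B // b ∉ Δ})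
    (j : N → X) (l : List (TwistLetter N)) : Prop :=
  ∃ (n : ℕ) (μ : Fin n → ℝ → B) (α : Fin n → Path.Homotopic.Quotient y y)
    (block : Fin n → List (TwistLetter N)) (τ : Fin n → List (MappingClasses N)),
    IsHurwitzSystem σB Δ (y : B) μ ∧
    (∀ i, IsMeridian σB Δ (μ i) (α i)) ∧
    l = (List.ofFn block).flatten ∧
    (∀ i, List.Forall₂ TwistLetter.Represents (block i) (τ i)) ∧
    (∀ i, ∃ x : List X, x.Nodup ∧ (∀ q, q ∈ x ↔ q ∈ criticalPoints f ∧ f q = μ i 1) ∧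
      List.Forall₂ (fun q c => IsVanishingCycle f j (μ i) q c.curve.carrier) x (block i)) ∧
    (∀ i, HasMonodromyAvoiding Δ f j (α i) (τ i).prod) ∧
    HasMonodromyAvoiding Δ f j (loopProduct (List.ofFn α)) (List.ofFn τ).flatten.prod ∧
    (IsSphere B → (List.ofFn τ).flatten.prod = 1)

theorem isMonodromyFactorizationAvoiding_iff {σB : B → ℤˣ} {f : X → B}
    {y : {b : B // b ∉ criticalValues f}} {j : N → X} {l : List (TwistLetter N)} :
    IsMonodromyFactorizationAvoiding (criticalValues f) σB f y j l ↔
      IsMonodromyFactorizationAt σB f y j l := Iff.rfl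

theorem IsMonodromyFactorizationAvoiding.exists_at {Δ : Set B} {σB : B → ℤˣ} {f : X → B}
    {y : {b : B // b ∉ Δ}} {j : N → X} {l : List (TwistLetter N)}
    (h : IsMonodromyFactorizationAvoiding Δ σB f y j l) (hΔ : criticalValues f = Δ) :
    ∃ y' : {b : B // b ∉ criticalValues f}, (y' : B) = y ∧
      IsMonodromyFactorizationAt σB f y' j l := by
  subst hΔ
  exact ⟨y, rfl, isMonodromyFactorizationAvoiding_iff.1 h⟩

theorem TwistLetter.exists_lift {S : Type*} [TopologicalSpace S]
    [ChartedSpace (EuclideanSpace ℝ (Fin 2)) S] [IsManifold (𝓡 2) ∞ N] [IsManifold (𝓡 2) ∞ S]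
    [T2Space N] [T2Space S] {σS : S → ℤˣ} {J : S → N}
    (hJ : IsOrientationDoubleCovering (𝓡 2) σS J) {l : TwistLetter N} {τ : MappingClasses N}
    (h : l.Represents τ) (hl : l.exponent = 1) :
    ∃ τ₁ τ₂ : MappingClasses S,
      TwistLetter.Represents ⟨⟨l.curve.upperLift σS J, σS⟩, 1⟩ τ₁ ∧
      TwistLetter.Represents ⟨⟨l.curve.lowerLift σS J, σS⟩, -1⟩ τ₂ ∧ τ₁ * τ₂ = liftClass hJ τ := by
  obtain ⟨T, hT, rfl⟩ := h
  obtain ⟨-, -, T₁, T₂, h1, h2, h3⟩ := hT.exists_lift hJ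
  refine ⟨_, _, ⟨T₁, h1, rfl⟩, ⟨T₂, h2, rfl⟩, ?_⟩
  simp only [hl, Units.val_one, zpow_one, Units.val_neg, zpow_neg]
  rw [liftClass_mk, h3]
  rfl

variable [IsManifold (𝓡∂ 4) ∞ X] [IsManifold (𝓡∂ 2) ∞ B] [IsManifold (𝓡 2) ∞ N]
  {S : Type*} [TopologicalSpace S] [ChartedSpace (EuclideanSpace ℝ (Fin 2)) S]
  [IsManifold (𝓡 2) ∞ S] {σS : S → ℤˣ} {J : S → N} (hJ : IsOrientationDoubleCovering (𝓡 2) σS J)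
  {σB : B → ℤˣ} {f : X → B}

omit [IsManifold (𝓡∂ 4) ∞ X] [IsManifold (𝓡∂ 2) ∞ B] in
theorem liftParam_comp_diffeo (hf : ContMDiff (𝓡∂ 4) (𝓡∂ 2) ∞ f) {j : N → X} {b : B}
    (hj : IsFiberParam f b j) (hb : b ∉ criticalValues f) (D : SelfDiffeo N) (s : S) :
    liftParam σB f hJ (fun p => j (D.toMap p)) s =
      liftParam σB f hJ j ((liftDiffeo hJ D).toMap s) := by
  rw [liftParam, liftFiber_comp_diffeo hf hj hb, liftParam, coverDiffeo_liftDiffeo]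

theorem HasMonodromyAvoiding.lift (hσB : IsOrientation (𝓡∂ 2) σB)
    (hf : ContMDiff (𝓡∂ 4) (𝓡∂ 2) ∞ f) {y : {b : B // b ∉ criticalValues f}} {j : N → X}
    (hj : IsFiberParam f (y : B) j) {α : Path.Homotopic.Quotient y y} {τ : MappingClasses N}
    (h : HasMonodromyAvoiding (criticalValues f) f j α τ) :
    HasMonodromyAvoiding (criticalValues f) (fun x : OrientationCover (𝓡∂ 4) X => f x.pt)
      (liftParam σB f hJ j) α (liftClass hJ τ) := by
  obtain ⟨a, Φ, D, ha, hΦ, h0, h1, rfl⟩ := h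
  refine ⟨a, liftTrivialization σB f hJ Φ, liftDiffeo hJ D, ha,
    hΦ.lift hJ hσB hf fun t _ => (a.extend t).2, fun s => ?_, fun s => ?_, rfl⟩
  · change liftParam σB f hJ (fun p => Φ (0, p)) s = _
    rw [funext h0]
  · change liftParam σB f hJ (fun p => Φ (1, p)) s = _
    rw [funext h1, liftParam_comp_diffeo hJ hf hj y.2]

/-- The other point of a fibre of an orientation double covering. -/
def deckInvolution (s : S) : S := (coverDiffeo hJ).symm (coverDiffeo hJ s).flip

theorem coverDiffeo_deckInvolution (s : S) :
    coverDiffeo hJ (deckInvolution hJ s) = (coverDiffeo hJ s).flip :=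
  Diffeomorph.apply_symm_apply _ _

theorem apply_deckInvolution (s : S) : J (deckInvolution hJ s) = J s :=
  congrArg pt (coverDiffeo_deckInvolution hJ s)

theorem liftDiffeo_deckInvolution (D : SelfDiffeo N) (s : S) :
    (liftDiffeo hJ D).toMap (deckInvolution hJ s) =
      deckInvolution hJ ((liftDiffeo hJ D).toMap s) := by
  apply coverDiffeo_injective hJ
  rw [coverDiffeo_liftDiffeo, coverDiffeo_deckInvolution, coverDiffeo_deckInvolution,
    coverDiffeo_liftDiffeo, map_flip]

omit [IsManifold (𝓡∂ 4) ∞ X] [IsManifold (𝓡∂ 2) ∞ B] in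
theorem liftParam_deckInvolution (j : N → X) (s : S) :
    liftParam σB f hJ j (deckInvolution hJ s) = (liftParam σB f hJ j s).flip := by
  rw [liftParam, coverDiffeo_deckInvolution]
  refine OrientationCover.ext rfl ?_
  change _ * -_ = -(_ * _)
  rw [mul_neg]
  rfl

theorem deckInvolution_mem_upperLift {c : OrientedCurve N} {s : S} (hs : s ∈ c.lowerLift σS J) :
    deckInvolution hJ s ∈ c.upperLift σS J := by
  obtain ⟨h1, h2⟩ := hs
  refine ⟨?_, ?_⟩
  · rw [apply_deckInvolution hJ]
    exact h1
  · rw [apply_deckInvolution hJ]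
    change (coverDiffeo hJ (deckInvolution hJ s)).sgn = _
    rw [coverDiffeo_deckInvolution]
    change -(coverDiffeo hJ s).sgn = _
    rcases units_eq_or_eq_neg (coverDiffeo hJ s).sgn (c.orient (J s)) with h3 | h3
    · exact absurd ⟨h1, h3⟩ h2
    · rw [h3, neg_neg]

theorem IsVanishingCycle.lift (hσB : IsOrientation (𝓡∂ 2) σB)
    (hf : ContMDiff (𝓡∂ 4) (𝓡∂ 2) ∞ f) {j : N → X} {μ : ℝ → B} {x : X} {c : OrientedCurve N}
    (hμ : ∀ t ∈ Ico (0 : ℝ) 1, μ t ∉ criticalValues f) (hc : IsConnected (c.upperLift σS J))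
    (h : IsVanishingCycle f j μ x c.carrier) :
    ∃ ε : ℤˣ,
      IsVanishingCycle (fun x : OrientationCover (𝓡∂ 4) X => f x.pt) (liftParam σB f hJ j) μ ⟨x, ε⟩
        (c.upperLift σS J) ∧
      IsVanishingCycle (fun x : OrientationCover (𝓡∂ 4) X => f x.pt) (liftParam σB f hJ j) μ ⟨x, -ε⟩
        (c.lowerLift σS J) := by
  obtain ⟨hx, hμ1, φ, ψ, hφ, s, hs, hcond, Φ, hΦ, hΦ0, D, hD, hDC⟩ := h
  set V := {p | ∃ z w : ℂ, z * w = ψ.toFun (μ s) ∧ ‖z‖ = ‖w‖ ∧ φ.invFun (z, w) = Φ (s, p)} with hV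
  have hΦ' := hΦ.lift (σB := σB) hJ hσB hf fun t ht => hμ t ⟨ht.1, ht.2.trans_lt hs.2⟩
  set Ψ := liftTrivialization σB f hJ Φ with hΨ
  have hΨpt : ∀ p, (Ψ (s, p)).pt = Φ (s, J p) := fun p => rfl
  have htarget : ∀ z w : ℂ, z * w = ψ.toFun (μ s) → ‖z‖ = ‖w‖ → (z, w) ∈ φ.target :=
    (hcond s ⟨le_rfl, hs.2.le⟩).2
  set U : ℤˣ → Set S := fun ε => {p | Ψ (s, p) ∈ (sheetChart φ ε).source} with hU
  have hVε : ∀ ε, {p | ∃ z w : ℂ, z * w = ψ.toFun (μ s) ∧ ‖z‖ = ‖w‖ ∧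
      (sheetChart φ ε).invFun (z, w) = Ψ (s, p)} = {p | J p ∈ V ∧ p ∈ U ε} := by
    intro ε
    ext p
    constructor
    · rintro ⟨z, w, h1, h2, h3⟩
      refine ⟨⟨z, w, h1, h2, ?_⟩, ?_⟩
      · rw [← hΨpt, ← h3, sheetChart_invFun_pt]
      · change Ψ (s, p) ∈ (sheetChart φ ε).source
        rw [← h3]
        exact (sheetChart φ ε).map_target (htarget z w h1 h2)
    · rintro ⟨⟨z, w, h1, h2, h3⟩, h4⟩
      refine ⟨z, w, h1, h2, ?_⟩
      have h5 : (sheetChart φ ε).invFun ((sheetChart φ ε).toFun (Ψ (s, p))) = Ψ (s, p) :=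
        (sheetChart φ ε).left_inv h4
      have h6 : φ.toFun (φ.invFun (z, w)) = (z, w) := φ.right_inv (htarget z w h1 h2)
      rwa [sheetChart_toFun, hΨpt, ← h3, h6] at h5
  have hUopen : ∀ ε, IsOpen (U ε) := fun ε =>
    (sheetChart φ ε).open_source.preimage (hΦ'.fiber s ⟨hs.1.le, le_rfl⟩).smooth.continuous
  have hUdisj : ∀ ε p, p ∈ U ε → p ∉ U (-ε) := by
    rintro ε p ⟨-, h1⟩ ⟨-, h2⟩
    rw [h1, mul_neg] at h2
    exact units_ne_neg_self _ h2
  have hcover : ∀ p, J p ∈ V → p ∈ U 1 ∪ U (-1) := by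
    rintro p ⟨z, w, h1, h2, h3⟩
    have h4 : (Ψ (s, p)).pt ∈ φ.source := by
      rw [hΨpt, ← h3]
      exact φ.map_target (htarget z w h1 h2)
    rcases units_eq_or_eq_neg (Ψ (s, p)).sgn (chartSign φ (Ψ (s, p)).pt) with h5 | h5
    · exact Or.inl ⟨h4, by rw [h5, mul_one]⟩
    · exact Or.inr ⟨h4, by rw [h5, mul_neg, mul_one]⟩
  set D' := liftDiffeo hJ D with hD'
  have hmemV : ∀ p, J (D'.toMap p) ∈ c.carrier ↔ J p ∈ V := by
    intro p
    rw [hD', apply_liftDiffeo hJ, ← hDC, D.injective.mem_set_image]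
  have hup : ∀ p, D'.toMap p ∈ c.upperLift σS J → J p ∈ V := fun p hp => (hmemV p).1 hp.1
  have hlow : ∀ p, D'.toMap p ∈ c.lowerLift σS J → J p ∈ V := fun p hp => (hmemV p).1 hp.1
  have hW : IsPreconnected {p | D'.toMap p ∈ c.upperLift σS J} := by
    have : {p | D'.toMap p ∈ c.upperLift σS J} = D'⁻¹.toMap '' c.upperLift σS J := by
      ext p
      constructor
      · intro hp
        exact ⟨_, hp, SelfDiffeo.toMap_inv_toMap _ _⟩
      · rintro ⟨q, hq, rfl⟩
        rwa [mem_ofPred_eq, SelfDiffeo.toMap_toMap_inv]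
    rw [this]
    exact hc.isPreconnected.image _ D'⁻¹.contMDiff.continuous.continuousOn
  have hε : ∃ ε, {p | D'.toMap p ∈ c.upperLift σS J} ⊆ U ε := by
    have hdis : Disjoint (U 1) (U (-1)) := Set.disjoint_left.2 fun p => hUdisj 1 p
    rcases hW.subset_or_subset (hUopen 1) (hUopen (-1)) hdis fun p hp => hcover p (hup p hp)
      with h1 | h1
    · exact ⟨1, h1⟩
    · exact ⟨-1, h1⟩
  obtain ⟨ε, hε⟩ := hε
  have hlowU : ∀ p, D'.toMap p ∈ c.lowerLift σS J → p ∈ U (-ε) := by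
    intro p hp
    have h1 : D'.toMap (deckInvolution hJ p) ∈ c.upperLift σS J := by
      rw [liftDiffeo_deckInvolution]
      exact deckInvolution_mem_upperLift hJ hp
    have h2 := hε h1
    have h3 : Ψ (s, deckInvolution hJ p) = (Ψ (s, p)).flip :=
      liftParam_deckInvolution hJ (fun p => Φ (s, p)) p
    change Ψ (s, deckInvolution hJ p) ∈ (sheetChart φ ε).source at h2
    rw [h3] at h2
    refine ⟨h2.1, ?_⟩
    have h4 : -(Ψ (s, p)).sgn = chartSign φ (Ψ (s, p)).pt * ε := h2.2
    rw [mul_neg, ← h4, neg_neg]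
  have hsplit : ∀ p, J p ∈ V → D'.toMap p ∈ c.upperLift σS J ∨ D'.toMap p ∈ c.lowerLift σS J := by
    intro p hp
    by_cases h1 : D'.toMap p ∈ c.upperLift σS J
    · exact Or.inl h1
    · exact Or.inr ⟨(hmemV p).2 hp, h1⟩
  have himage : ∀ (W : Set S) (C : Set S), (∀ p, p ∈ W ↔ D'.toMap p ∈ C) → D'.toMap '' W = C := by
    intro W C hWC
    ext p
    constructor
    · rintro ⟨q, hq, rfl⟩
      exact (hWC q).1 hq
    · intro hp
      refine ⟨D'⁻¹.toMap p, (hWC _).2 ?_, SelfDiffeo.toMap_toMap_inv _ _⟩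
      rwa [SelfDiffeo.toMap_toMap_inv]
  have key : ∀ (ε' : ℤˣ) (C : Set S), (∀ p, (J p ∈ V ∧ p ∈ U ε') ↔ D'.toMap p ∈ C) →
      IsVanishingCycle (fun x : OrientationCover (𝓡∂ 4) X => f x.pt) (liftParam σB f hJ j) μ
        ⟨x, chartSign φ x * ε'⟩ C := by
    intro ε' C hC
    refine ⟨by rw [criticalPoints_cover hf]; exact hx, hμ1, sheetChart φ ε', ψ, hφ.sheet ε', s, hs,
      hcond, Ψ, hΦ', fun p => ?_, D', liftDiffeo_mem_isotopicToId hJ hD, ?_⟩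
    · change liftParam σB f hJ (fun p => Φ (0, p)) p = _
      rw [funext hΦ0]
    · rw [hVε]
      exact himage _ _ hC
  refine ⟨chartSign φ x * ε, key ε _ fun p => ⟨?_, fun hp => ⟨hup p hp, hε hp⟩⟩, ?_⟩
  · rintro ⟨h1, h2⟩
    exact (hsplit p h1).resolve_right fun h3 => hUdisj ε p h2 (hlowU p h3)
  · rw [← mul_neg]
    refine key (-ε) _ fun p => ⟨?_, fun hp => ⟨hlow p hp, hlowU p hp⟩⟩
    rintro ⟨h1, h2⟩
    exact (hsplit p h1).resolve_left fun h3 => hUdisj ε p (hε h3) h2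

/-! ### Lifts of words -/

variable (σS J) in
/-- The two letters that lift a right handed twist. -/
def liftLetter (l : TwistLetter N) : List (TwistLetter S) :=
  [⟨⟨l.curve.upperLift σS J, σS⟩, 1⟩, ⟨⟨l.curve.lowerLift σS J, σS⟩, -1⟩]

theorem exists_forall₂_represents_lift [T2Space N] [T2Space S] {w : List (TwistLetter N)}
    {τ : List (MappingClasses N)} (h : List.Forall₂ TwistLetter.Represents w τ)
    (hw : ∀ l ∈ w, l.exponent = 1) :
    ∃ τ' : List (MappingClasses S), List.Forall₂ TwistLetter.Represents (w.flatMap (liftLetter σS J)) τ' ∧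
      τ'.prod = liftClass hJ τ.prod := by
  induction h with
  | nil => exact ⟨[], List.Forall₂.nil, by simp⟩
  | @cons l t w τ hl _ ih =>
    obtain ⟨τ', h1, h2⟩ := ih fun l hl => hw l (List.mem_cons_of_mem _ hl)
    obtain ⟨t₁, t₂, ht₁, ht₂, ht⟩ := TwistLetter.exists_lift hJ hl (hw l List.mem_cons_self)
    refine ⟨t₁ :: t₂ :: τ', List.Forall₂.cons ht₁ (List.Forall₂.cons ht₂ h1), ?_⟩
    rw [List.prod_cons, List.prod_cons, List.prod_cons, map_mul, h2, ← mul_assoc, ht]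

theorem exists_forall₂_isVanishingCycle_lift (hσB : IsOrientation (𝓡∂ 2) σB)
    (hf : ContMDiff (𝓡∂ 4) (𝓡∂ 2) ∞ f) {j : N → X} {μ : ℝ → B}
    (hμ : ∀ t ∈ Ico (0 : ℝ) 1, μ t ∉ criticalValues f) {w : List (TwistLetter N)}
    (hw : ∀ l ∈ w, IsConnected (l.curve.upperLift σS J)) {x : List X} (hx : x.Nodup)
    (h : List.Forall₂ (fun q c => IsVanishingCycle f j μ q c.curve.carrier) x w) :
    ∃ x' : List (OrientationCover (𝓡∂ 4) X), x'.Nodup ∧ (∀ q, q ∈ x' ↔ q.pt ∈ x) ∧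
      List.Forall₂ (fun q c => IsVanishingCycle (fun x : OrientationCover (𝓡∂ 4) X => f x.pt)
        (liftParam σB f hJ j) μ q c.curve.carrier) x' (w.flatMap (liftLetter σS J)) := by
  induction h with
  | nil => exact ⟨[], List.nodup_nil, by simp, List.Forall₂.nil⟩
  | @cons q l x w hq _ ih =>
    obtain ⟨x', h1, h2, h3⟩ := ih (fun l hl => hw l (List.mem_cons_of_mem _ hl))
      (List.nodup_cons.1 hx).2
    have hqx := (List.nodup_cons.1 hx).1
    obtain ⟨ε, hε, hε'⟩ := hq.lift hJ hσB hf hμ (hw l List.mem_cons_self)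
    refine ⟨⟨q, ε⟩ :: ⟨q, -ε⟩ :: x', ?_, ?_, List.Forall₂.cons hε (List.Forall₂.cons hε' h3)⟩
    · rw [List.nodup_cons, List.nodup_cons]
      refine ⟨?_, fun hm => hqx ((h2 _).1 hm), h1⟩
      rw [List.mem_cons]
      rintro (he | hm)
      · exact units_ne_neg_self _ (congrArg sgn he)
      · exact hqx ((h2 _).1 hm)
    · intro p
      rw [List.mem_cons, List.mem_cons, h2, List.mem_cons]
      constructor
      · rintro (rfl | rfl | hp)
        · exact Or.inl rfl
        · exact Or.inl rfl
        · exact Or.inr hp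
      · rintro (hp | hp)
        · rcases units_eq_or_eq_neg p.sgn ε with h4 | h4
          · exact Or.inl (OrientationCover.ext hp h4)
          · exact Or.inr (Or.inl (OrientationCover.ext hp h4))
        · exact Or.inr (Or.inr hp)

theorem IsMonodromyFactorizationAvoiding.lift [T2Space N] [T2Space S]
    (hσB : IsOrientation (𝓡∂ 2) σB) (hf : ContMDiff (𝓡∂ 4) (𝓡∂ 2) ∞ f)
    {y : {b : B // b ∉ criticalValues f}} {j : N → X} (hj : IsFiberParam f (y : B) j)
    {w : List (TwistLetter N)} (hw : ∀ l ∈ w, l.exponent = 1)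
    (h : IsMonodromyFactorizationAvoiding (criticalValues f) σB f y j w) :
    IsMonodromyFactorizationAvoiding (criticalValues f) σB
      (fun x : OrientationCover (𝓡∂ 4) X => f x.pt) y (liftParam σB f hJ j)
      (w.flatMap (liftLetter σS J)) := by
  obtain ⟨n, μ, α, block, τ, hH, hM, rfl, hrep, hvan, hmon, hloop, hsph⟩ := h
  have hexp : ∀ i, ∀ l ∈ block i, l.exponent = 1 := fun i l hl =>
    hw l (List.mem_flatten.2 ⟨block i, (List.mem_ofFn' _ _).2 ⟨i, rfl⟩, hl⟩)
  choose τ' hrep' hprod using fun i => exists_forall₂_represents_lift hJ (hrep i) (hexp i)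
  have hprods : (List.ofFn τ').flatten.prod = liftClass hJ (List.ofFn τ).flatten.prod := by
    rw [List.prod_flatten, List.prod_flatten, map_list_prod, List.map_ofFn, List.map_ofFn,
      List.map_ofFn]
    congr 2
    funext i
    exact hprod i
  refine ⟨n, μ, α, fun i => (block i).flatMap (liftLetter σS J), τ', hH, hM, ?_, hrep', ?_, ?_, ?_, ?_⟩
  · rw [List.flatMap_def, List.map_flatten, List.flatten_flatten, List.map_map, List.map_ofFn]
    simp only [List.flatMap_def]
    rfl
  · intro i
    obtain ⟨x, hx, hxc, hxv⟩ := hvan i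
    have hconn : ∀ l ∈ block i, IsConnected (l.curve.upperLift σS J) := by
      intro l hl
      obtain ⟨k, hk, rfl⟩ := List.mem_iff_getElem.1 hl
      have h2 := (List.forall₂_iff_get.1 (hrep i)).2 k hk ((hrep i).length_eq ▸ hk)
      obtain ⟨T, hT, -⟩ := h2
      exact (hT.exists_lift hJ).1
    obtain ⟨x', h1, h2, h3⟩ := exists_forall₂_isVanishingCycle_lift (σB := σB) hJ hσB hf (hH.avoid i)
      hconn hx hxv
    refine ⟨x', h1, fun q => ?_, h3⟩
    rw [h2, hxc, criticalPoints_cover hf]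
    rfl
  · intro i
    rw [hprod]
    exact (hmon i).lift hJ hσB hf hj
  · rw [hprods]
    exact hloop.lift hJ hσB hf hj
  · intro hB
    rw [hprods, hsph hB, map_one]

end Monodromy

theorem IsMonodromyFactorizationAt.criticalPoints_nonempty {X : Type*} [TopologicalSpace X]
    [ChartedSpace (EuclideanHalfSpace 4) X] {B : Type*} [TopologicalSpace B]
    [ChartedSpace (EuclideanHalfSpace 2) B] {N : Type*} [TopologicalSpace N]
    [ChartedSpace (EuclideanSpace ℝ (Fin 2)) N] {σB : B → ℤˣ} {f : X → B}
    {y : {b : B // b ∉ criticalValues f}} {j : N → X} {w : List (TwistLetter N)}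
    (h : IsMonodromyFactorizationAt σB f y j w) (hw : w ≠ []) : (criticalPoints f).Nonempty := by
  obtain ⟨n, μ, α, block, τ, -, -, rfl, -, hvan, -⟩ := h
  obtain ⟨l, hl⟩ := List.exists_mem_of_ne_nil _ hw
  obtain ⟨bl, hbl, hlb⟩ := List.mem_flatten.1 hl
  obtain ⟨i, rfl⟩ := (List.mem_ofFn' _ _).1 hbl
  obtain ⟨x, -, hxc, hxv⟩ := hvan i
  cases x with
  | nil =>
    have := hxv.length_eq
    rw [List.length_nil] at this
    rw [List.length_eq_zero_iff.1 this.symm] at hlb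
    simp at hlb
  | cons q x => exact ⟨q, ((hxc q).1 List.mem_cons_self).1⟩

end

theorem corollary4p3 {g : ℕ} (hg : 3 ≤ g)
    -- the total space and the base
    {X : Type*} [TopologicalSpace X] [ChartedSpace (EuclideanHalfSpace 4) X]
    [IsManifold (𝓡∂ 4) ∞ X]
    {B : Type*} [TopologicalSpace B] [ChartedSpace (EuclideanHalfSpace 2) B]
    [IsManifold (𝓡∂ 2) ∞ B]
    (hB : IsDisk B ∨ IsSphere B) (σB : B → ℤˣ) (hσB : IsOrientation (𝓡∂ 2) σB)
    -- the surface of genus `g`, the oriented surface of genus `g - 1`, and the double covering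
    {N : Type*} [TopologicalSpace N] [ChartedSpace (EuclideanSpace ℝ (Fin 2)) N]
    [IsManifold (𝓡 2) ∞ N] (hN : IsNonorientableSurface g N)
    {S : Type*} [TopologicalSpace S] [ChartedSpace (EuclideanSpace ℝ (Fin 2)) S]
    [IsManifold (𝓡 2) ∞ S] (hS : IsOrientableSurface (g - 1) S)
    (σS : S → ℤˣ) (J : S → N) (hJ : IsOrientationDoubleCovering (𝓡 2) σS J)
    -- the non-orientable Lefschetz fibration of genus `g`
    (f : X → B) (hf : IsLefschetzFibration f) (hX : ¬ IsOrientableManifold (𝓡∂ 4) X)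
    (hfib : HasRegularFiber N f)
    (c : List (OrientedCurve N)) (hc : HasPositiveMonodromyFactorization σB f c) :
    IsOrientation (𝓡∂ 4) (OrientationCover.sgn : OrientationCover (𝓡∂ 4) X → ℤˣ) ∧
    IsLefschetzFibration (fun x : OrientationCover (𝓡∂ 4) X => f x.pt) ∧
    HasRegularFiber S (fun x : OrientationCover (𝓡∂ 4) X => f x.pt) ∧
    (c ≠ [] → IsAchiral (OrientationCover.sgn : OrientationCover (𝓡∂ 4) X → ℤˣ)
      (fun x : OrientationCover (𝓡∂ 4) X => f x.pt)) ∧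
    HasMonodromyFactorization (OrientationCover.sgn : OrientationCover (𝓡∂ 4) X → ℤˣ) σB σS
      (fun x : OrientationCover (𝓡∂ 4) X => f x.pt)
      (c.flatMap fun e => [(e.upperLift σS J, 1), (e.lowerLift σS J, -1)]) := by
  have := hN.t2Space
  have := hS.t2Space
  have hcrit := criticalValues_cover hf.smooth
  obtain ⟨y, j, hj, hfac⟩ := hc
  refine ⟨OrientationCover.isOrientation_sgn, hf.cover hX,
    hasRegularFiber_cover hJ hσB hf.smooth hfib hcrit, fun hne => ?_, ?_⟩
  · exact isAchiral_cover hf (hfac.criticalPoints_nonempty (by simpa using hne))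
  · have hlift := IsMonodromyFactorizationAvoiding.lift hJ hσB hf.smooth hj
      (w := c.map fun e => ⟨e, 1⟩) (by simp) (isMonodromyFactorizationAvoiding_iff.2 hfac)
    obtain ⟨y', hy', h⟩ := hlift.exists_at hcrit
    refine ⟨y', liftParam σB f hJ j, ?_, isOrientedFiberParam_liftParam hJ hσB hf.smooth hj y.2, ?_⟩
    · rw [hy']
      exact isFiberParam_liftParam hJ hσB hf.smooth hj y.2
    · convert h using 1
      rw [List.map_flatMap, List.flatMap_map]
      rfl
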